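/- **Notation.** Let $\mathbb D$ be the open unit disc, $\mathbb T$ the unit circle, $dA$ the normalized area measure on $\mathbb D$. For a finite positive Borel measure $\nu$ on $\mathbb T$ put $P_\nu(z)=\frac1{2\pi}\int_{\mathbb T}\frac{1-|z|^2}{|\xi-z|^2}\,d\nu(\xi)$. For finite positive Borel measures $\mu_1,\mu_2$ on $\mathbb T$, write $\boldsymbol\mu=\mu_1\times\mu_2$ (understood as the pair $(\mu_1,\mu_2)$; $\mu_1$ or $\mu_2$ may be zero), and for $f$ holomorphic on $\mathbb D^2$ let $$\|f\|_{\boldsymbol\mu}^2=\|f\|_{H^2(\mathbb D^2)}^2+\lim_{r\to1^-}\frac1{2\pi}\iint_{\mathbb D\times[0,2\pi]}|\partial_1f(z_1,re^{it})|^2P_{\mu_1}(z_1)\,dA(z_1)\,dt+\lim_{r\to1^-}\frac1{2\pi}\iint_{[0,2\pi]\times\mathbb D}|\partial_2f(re^{it},z_2)|^2P_{\mu_2}(z_2)\,dA(z_2)\,dt+\iint_{\mathbb D^2}|\partial_1\partial_2f|^2P_{\mu_1}(z_1)P_{\mu_2}(z_2)\,dA(z_1)\,dA(z_2),$$ where $\|f\|_{H^2(\mathbb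 D^2)}^2=\sup_{0<r<1}\frac1{4\pi^2}\int_0^{2\pi}\!\int_0^{2\pi}|f(re^{is},re^{it})|^2\,ds\,dt$. The Dirichlet-type space $\mathcal D^2(\boldsymbol\mu)$ is the space of all holomorphic $f$ on $\mathbb D^2$ with $\|f\|_{\boldsymbol\mu}<\infty$, with this norm, and $M_{z_1},M_{z_2}$ are the operators on it of multiplication by the coordinate functions. A bounded operator $T$ on a complex Hilbert space $\mathcal H$ is a *2-isometry* if $\|T^2h\|^2-2\|Th\|^2+\|h\|^2=0$ for all $h\in\mathcal H$, and *analytic* if $\bigcap_{n\ge0}T^n\mathcal H=\{0\}$. For a 2-isometry $T_j$, $T_j^*T_j$ is invertible; put $L_j=(T_j^*T_j)^{-1}T_j^*$. A vector $x_0$ is *cyclic* for a commuting pair $(T_1,T_2)$ if the linear span of $\{T_1^kT_2^lx_0:k,l\ge0\}$ is dense in $\mathcal H$. **Theorem.** Let $(T_1,T_2)$ be a commuting pair of analytic 2-isometries on a complex Hilbert space $\mathcal H$ with a cyclic vector $x_0\in\ker T_1^*\cap\ker T_2^*$, $\|x_0\|=1$. Then there are finite positive Borel measures $\mu_1,\mu_2$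 on $\mathbb T$ such that $(T_1,T_2)$ is unitarily equivalent to $(M_{z_1},M_{z_2})$ on $\mathcal D^2(\boldsymbol\mu)$, $\boldsymbol\mu=\mu_1\times\mu_2$ (that is, there is a unitary $U:\mathcal H\to\mathcal D^2(\boldsymbol\mu)$ with $UT_j=M_{z_j}U$ for $j=1,2$), if and only if $L_1T_2=T_2L_1$, $L_2T_1=T_1L_2$, and for all integers $m,n\ge1$ $$\langle T_1^mT_2^nx_0,T_1T_2x_0\rangle=\langle T_1^mx_0,T_1x_0\rangle\,\langle T_2^nx_0,T_2x_0\rangle,$$ $$\langle T_1^mT_2x_0,T_1T_2^nx_0\rangle=\langle T_1^mx_0,T_1x_0\rangle\,\langle T_2x_0,T_2^nx_0\rangle.$$ -/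

import Mathlib

open MeasureTheory Filter Topology
open scoped ENNReal InnerProductSpace

namespace BidiscDirichlet

noncomputable section

/-! ### Operator-theoretic notions -/

section Operators

variable {H : Type*} [NormedAddCommGroup H] [InnerProductSpace ℂ H]

/-- `T` is a 2-isometry: `‖T²h‖² - 2‖Th‖² + ‖h‖² = 0` for all `h`. -/
def IsTwoIsometry (T : H →L[ℂ] H) : Prop :=
  ∀ h : H, ‖T (T h)‖ ^ 2 - 2 * ‖T h‖ ^ 2 + ‖h‖ ^ 2 = 0

/-- `T` is analytic: the intersection of the ranges of all powers of `T` is zero. -/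
def IsAnalytic (T : H →L[ℂ] H) : Prop :=
  ⋂ n : ℕ, Set.range (⇑(T ^ n)) = {0}

/-- `x` is a cyclic vector of the pair `(T₁, T₂)`: the vectors `T₁ᵐ T₂ⁿ x` span a dense subspace. -/
def IsCyclicVector (T₁ T₂ : H →L[ℂ] H) (x : H) : Prop :=
  closure (Submodule.span ℂ (Set.range fun k : ℕ × ℕ => (T₁ ^ k.1) ((T₂ ^ k.2) x)) : Set H) =
    Set.univ

/-- The adjoint of the Cauchy dual, `L = (T* T)⁻¹ T*`, of an operator `T` for which `T* T` is
invertible (this holds for every 2-isometry, because a 2-isometry satisfies `‖T h‖ ≥ ‖h‖`). -/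
def leftInv [CompleteSpace H] (T : H →L[ℂ] H) : H →L[ℂ] H :=
  Ring.inverse (ContinuousLinearMap.adjoint T * T) * ContinuousLinearMap.adjoint T

end Operators

/-! ### The Dirichlet-type spaces over the bidisc -/

/-- The unit circle `𝕋`. -/
abbrev unitCirc : Set ℂ := Metric.sphere (0 : ℂ) 1

/-- The open unit bidisc. -/
def bidisc : Set (ℂ × ℂ) := Metric.ball (0 : ℂ) 1 ×ˢ Metric.ball (0 : ℂ) 1

open Classical in
/-- Extension by zero of a function on the bidisc. Only its values on the (open) bidisc are used. -/
def extendZero (f : bidisc → ℂ) (z : ℂ × ℂ) : ℂ :=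
  if h : z ∈ bidisc then f ⟨z, h⟩ else 0

/-- `f` is holomorphic on the bidisc. -/
def IsHolomorphic (f : bidisc → ℂ) : Prop := DifferentiableOn ℂ (extendZero f) bidisc

/-- The partial derivative `∂F/∂z₁`. -/
def partial₁ (F : ℂ × ℂ → ℂ) (z : ℂ × ℂ) : ℂ := deriv (fun w => F (w, z.2)) z.1

/-- The partial derivative `∂F/∂z₂`. -/
def partial₂ (F : ℂ × ℂ → ℂ) (z : ℂ × ℂ) : ℂ := deriv (fun w => F (z.1, w)) z.2

/-- The normalized Lebesgue area measure on the open unit disc. -/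
def discArea : Measure ℂ :=
  (ENNReal.ofReal Real.pi)⁻¹ • (volume : Measure ℂ).restrict (Metric.ball 0 1)

/-- The average `(1 / 2π) ∫₀^{2π} g(r e^{it}) dt`. -/
def circleMean (r : ℝ) (g : ℂ → ℝ≥0∞) : ℝ≥0∞ :=
  (ENNReal.ofReal (2 * Real.pi))⁻¹ *
    ∫⁻ t in Set.Ioc 0 (2 * Real.pi), g ((r : ℂ) * Complex.exp ((t : ℂ) * Complex.I))

/-- The Poisson integral `P_μ(z) = (1 / 2π) ∫ (1 - |z|²) / |ξ - z|² dμ(ξ)`, for `|z| < 1`. -/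
def poissonIntegral (μ : Measure unitCirc) (z : ℂ) : ℝ≥0∞ :=
  (ENNReal.ofReal (2 * Real.pi))⁻¹ *
    ∫⁻ ξ : unitCirc, ENNReal.ofReal ((1 - ‖z‖ ^ 2) / ‖(ξ : ℂ) - z‖ ^ 2) ∂μ

/-- The square of the norm of the Hardy space `H²` of the bidisc (infinite outside this space). -/
def hardyNormSq (f : bidisc → ℂ) : ℝ≥0∞ :=
  ⨆ r ∈ Set.Ioo (0 : ℝ) 1,
    circleMean r fun z₁ => circleMean r fun z₂ => ‖extendZero f (z₁, z₂)‖ₑ ^ 2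

/-- `lim_{r → 1⁻} (1 / 2π) ∬_{𝔻 × 𝕋} |∂₁ f(z₁, r e^{it})|² P_{μ₁}(z₁) dA(z₁) dt`.
For holomorphic `f` the integral is nondecreasing in `r`, so that the upper limit is a limit in
`[0, ∞]`. -/
def dirichletIntegral₁ (μ₁ : Measure unitCirc) (f : bidisc → ℂ) : ℝ≥0∞ :=
  limsup (fun r : ℝ => ∫⁻ z₁, circleMean r (fun z₂ =>
    ‖partial₁ (extendZero f) (z₁, z₂)‖ₑ ^ 2 * poissonIntegral μ₁ z₁) ∂discArea) (𝓝[<] 1)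

/-- `lim_{r → 1⁻} (1 / 2π) ∬_{𝕋 × 𝔻} |∂₂ f(r e^{it}, z₂)|² P_{μ₂}(z₂) dA(z₂) dt`.
For holomorphic `f` the integral is nondecreasing in `r`, so that the upper limit is a limit in
`[0, ∞]`. -/
def dirichletIntegral₂ (μ₂ : Measure unitCirc) (f : bidisc → ℂ) : ℝ≥0∞ :=
  limsup (fun r : ℝ => ∫⁻ z₂, circleMean r (fun z₁ =>
    ‖partial₂ (extendZero f) (z₁, z₂)‖ₑ ^ 2 * poissonIntegral μ₂ z₂) ∂discArea) (𝓝[<] 1)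

/-- `∬_{𝔻²} |∂₁ ∂₂ f(z₁, z₂)|² P_{μ₁}(z₁) P_{μ₂}(z₂) dA(z₁) dA(z₂)`. -/
def dirichletIntegral₃ (μ₁ μ₂ : Measure unitCirc) (f : bidisc → ℂ) : ℝ≥0∞ :=
  ∫⁻ z₁, ∫⁻ z₂, ‖partial₁ (partial₂ (extendZero f)) (z₁, z₂)‖ₑ ^ 2 *
    (poissonIntegral μ₁ z₁ * poissonIntegral μ₂ z₂) ∂discArea ∂discArea

/-- The squared norm `‖f‖²_μ` of the Dirichlet-type space attached to `μ₁, μ₂`, with values in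
`[0, ∞]`. -/
def dirichletNormSq (μ₁ μ₂ : Measure unitCirc) (f : bidisc → ℂ) : ℝ≥0∞ :=
  hardyNormSq f +
    (dirichletIntegral₁ μ₁ f + dirichletIntegral₂ μ₂ f + dirichletIntegral₃ μ₁ μ₂ f)

/-- The Dirichlet-type space `𝓓²(μ)`, `μ = μ₁ × μ₂`: the holomorphic functions on the bidisc whose
norm is finite. If `μ₁` and `μ₂` are nonzero, finiteness of the three Dirichlet integrals already
forces `f` to be in the Hardy space; if both are zero, the space is the Hardy space. -/
def dirichletSpace (μ₁ μ₂ : Measure unitCirc) : Set (bidisc → ℂ) :=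
  {f | IsHolomorphic f ∧ dirichletNormSq μ₁ μ₂ f < ∞}

/-- `(T₁, T₂)` on `H` is unitarily equivalent to `(M_{z₁}, M_{z₂})` on `𝓓²(μ)`: there is a linear
bijection `U` of `H` onto `𝓓²(μ)` which preserves the norms (a unitary operator) and satisfies
`U T₁ = M_{z₁} U` and `U T₂ = M_{z₂} U`. -/
def IsUnitarilyEquivalentToShifts {H : Type*} [NormedAddCommGroup H] [InnerProductSpace ℂ H]
    (T₁ T₂ : H →L[ℂ] H) (μ₁ μ₂ : Measure unitCirc) : Prop :=
  ∃ U : H →ₗ[ℂ] (bidisc → ℂ),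
    Set.BijOn U Set.univ (dirichletSpace μ₁ μ₂) ∧
    (∀ x : H, dirichletNormSq μ₁ μ₂ (U x) = ‖x‖ₑ ^ 2) ∧
    (∀ (x : H) (z : bidisc), U (T₁ x) z = z.1.1 * U x z) ∧
    (∀ (x : H) (z : bidisc), U (T₂ x) z = z.1.2 * U x z)

end

end BidiscDirichlet

/-!
The proof describes `𝓓²(μ)` through Taylor coefficients. For a power series `F` on the disc and a
point `ξ` of the circle, `F(z) / (ξ - z)` is a Cauchy product whose coefficients have the moduli of
the partial sums of `F` at `ξ`. Parseval's identity on every circle (`lintegral_local`) therefore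
writes a Dirichlet integral with Poisson weight as a weighted sum of squares of such partial sums,
averaged over `ξ`. In this way the one-variable norm is the `L²` norm of a family `ev ω` of
functionals, each of which involves finitely many Taylor coefficients, over a parameter space with
measure `evalMeasure μ`; and the four terms of the norm on the bidisc add up to the `L²` norm
`coefNorm` of the tensor products `ev₂` over the product of two such spaces
(`HasTaylor.dirichletNormSq_eq`). Three consequences are used: the norm is lower semicontinuous
under coefficientwise convergence (`coefNorm_le_liminf`), Fejér means converge in norm, so that
polynomials are dense (`tendsto_coefNorm_fejer_sub`), and the Gram matrix of the monomials is the
product of the one-variable matrices `gram μ₁` and `gram μ₂` (`inner_polyLp_single`).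

If `(T₁, T₂)` is the pair of coordinate multiplications on such a space, then the preimage `e` of
the constant function `1` is cyclic and the vectors `T₁ᵐ T₂ⁿ e` have this product Gram matrix. This
makes `T₁*` vanish on the vectors `T₂ⁿ e` and `T₂*` on the vectors `T₁ᵐ e`, from which the
commutation relations follow on the orbit of `e`; moreover `ker T₁* ∩ ker T₂*` is spanned by `e`, so
that `x₀` is a unimodular multiple of `e`.

Conversely, for a 2-isometry `T` and a unit vector `x ∈ ker T*`, the matrix
`⟨(T*T - 1) Tᵐ x, Tᵖ x⟩` is Toeplitz, and it is positive because 2-isometries are expansive. The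
trigonometric moment problem (`exists_measure_moment_eq`) provides a measure with these moments, so
that the orbit of `x` under `T` has the Gram matrix `gram μ` (`IsTwoIsometry.exists_gram_eq`). The
commutation relations give `T₁* T₂ⁿ x₀ = 0` and `T₂* T₁ᵐ x₀ = 0`. The 2-isometry identities then
propagate the two families of product formulas for inner products to the whole orbit of `x₀`
(`inner_orbit`). The functionals `h ↦ ⟨L₁ᵐ L₂ⁿ h, x₀⟩` read off the coefficients of `T₁ᵐ T₂ⁿ x₀` and
extend to all of `H` by continuity. Lower semicontinuity gives that they determine the norm
(`coefNorm_coord`), and the convergence of Fejér means that every sequence of finite norm is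
attained (`exists_coord`). The unitary operator maps `h` to the power series with these
coefficients.
-/

namespace BidiscDirichlet

noncomputable section

open Complex ComplexConjugate

/-! ### Parseval's identity on circles -/

theorem eLpNorm_two_sq {α E : Type*} [MeasurableSpace α] [NormedAddCommGroup E] (μ : Measure α)
    (f : α → E) : eLpNorm f 2 μ ^ 2 = ∫⁻ x, ‖f x‖ₑ ^ 2 ∂μ := by
  have := eLpNorm_nnreal_pow_eq_lintegral (f := f) (μ := μ) (p := 2) (by norm_num)
  simpa using this

instance : Fact (0 < 2 * Real.pi) := ⟨Real.two_pi_pos⟩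

theorem setLIntegral_Ioc_eq_haar (a r : ℝ) (g : ℂ → ℝ≥0∞) :
    ∫⁻ t in Set.Ioc a (a + 2 * Real.pi), g ((r : ℂ) * Complex.exp ((t : ℂ) * I)) =
      ENNReal.ofReal (2 * Real.pi) *
        ∫⁻ x : AddCircle (2 * Real.pi), g (r * AddCircle.toCircle x)
          ∂AddCircle.haarAddCircle := by
  have h := AddCircle.lintegral_preimage (2 * Real.pi) a (fun x => g (r * AddCircle.toCircle x))
  rw [AddCircle.volume_eq_smul_haarAddCircle, lintegral_smul_measure, smul_eq_mul] at h
  have h2 : ∀ t : ℝ, (AddCircle.toCircle (T := 2 * Real.pi) t : ℂ) = Complex.exp (t * I) := by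
    intro t
    rw [AddCircle.toCircle_apply_mk]
    simp only [Circle.coe_exp]
    congr 2
    field_simp
  simpa only [h2] using h

theorem circleMean_eq_haar (r : ℝ) (g : ℂ → ℝ≥0∞) :
    circleMean r g = ∫⁻ x : AddCircle (2 * Real.pi), g (r * AddCircle.toCircle x)
      ∂AddCircle.haarAddCircle := by
  have h := setLIntegral_Ioc_eq_haar 0 r g
  rw [zero_add] at h
  rw [circleMean, h, ← mul_assoc, ENNReal.inv_mul_cancel, one_mul]
  · simpa using Real.pi_pos
  · exact ENNReal.ofReal_ne_top

/-- Parseval's identity for a power series on the circle of radius `r`. -/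
theorem circleMean_sq_of_hasSum {c : ℕ → ℂ} {r : ℝ} (hr : 0 ≤ r)
    (hs : Summable fun n => ‖c n‖ * r ^ n) {F : ℂ → ℂ}
    (hF : ∀ z, ‖z‖ = r → HasSum (fun n => c n * z ^ n) (F z)) :
    circleMean r (fun z => ‖F z‖ₑ ^ 2) = ∑' n, ‖c n‖ₑ ^ 2 * ENNReal.ofReal r ^ (2 * n) := by
  set d : ℕ → ℂ := fun n => c n * (r : ℂ) ^ n with hd
  have hdn : ∀ n, ‖d n‖ = ‖c n‖ * r ^ n := fun n => by simp [hd, abs_of_nonneg hr]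
  have hsum : Summable fun n : ℕ => d n • (fourier (T := 2 * Real.pi) (n : ℤ)) := by
    refine Summable.of_norm ?_
    simpa only [norm_smul, fourier_norm, mul_one, hdn] using hs
  obtain ⟨G, hG⟩ := hsum
  have hGx : ∀ x, G x = F (r * AddCircle.toCircle x) := by
    intro x
    have h1 := (ContinuousMap.evalCLM ℂ x).hasSum hG
    have h2 := hF (r * AddCircle.toCircle x)
      (by rw [norm_mul, Circle.norm_coe, Complex.norm_real, Real.norm_of_nonneg hr, mul_one])
    have h3 : HasSum (fun n => d n * (AddCircle.toCircle x : ℂ) ^ n) (G x) := by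
      simpa [AddCircle.toCircle_nsmul] using h1
    refine h3.unique ?_
    convert h2 using 2 with n
    simp [hd, mul_pow, mul_assoc]
  have hL :=
    (ContinuousMap.toLp (E := ℂ) 2 (AddCircle.haarAddCircle (T := 2 * Real.pi)) ℂ).hasSum hG
  set g := ContinuousMap.toLp (E := ℂ) 2 (AddCircle.haarAddCircle (T := 2 * Real.pi)) ℂ G with hg
  simp only [map_smul] at hL
  have hL' : HasSum (fun n : ℕ => d n • fourierLp (T := 2 * Real.pi) 2 (n : ℤ)) g := hL
  have ho : Orthonormal ℂ (fun n : ℕ => fourierLp (T := 2 * Real.pi) 2 (n : ℤ)) :=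
    orthonormal_fourier.comp _ Nat.cast_injective
  have hin : ∀ n : ℕ, ⟪fourierLp (T := 2 * Real.pi) 2 (n : ℤ), g⟫_ℂ = d n := by
    intro n
    have h1 := (innerSL ℂ (fourierLp (T := 2 * Real.pi) 2 (n : ℤ))).hasSum hL'
    have h2 : (fun m : ℕ => innerSL ℂ (fourierLp (T := 2 * Real.pi) 2 (n : ℤ))
        (d m • fourierLp (T := 2 * Real.pi) 2 (m : ℤ))) = fun m => if m = n then d n else 0 := by
      ext m
      rw [map_smul, innerSL_apply_apply, smul_eq_mul, orthonormal_iff_ite.mp ho n m]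
      by_cases h : m = n
      · simp [h]
      · rw [if_neg h, if_neg (Ne.symm h), mul_zero]
    rw [h2] at h1
    exact h1.unique (hasSum_ite_eq n (d n))
  have hnorm : HasSum (fun n => ‖d n‖ ^ 2) (‖g‖ ^ 2) := by
    have h1 := (innerSL ℂ g).hasSum hL'
    simp only [map_smul, innerSL_apply_apply, smul_eq_mul] at h1
    have h2 := Complex.hasSum_re h1
    convert h2 using 1
    · ext n
      rw [← inner_conj_symm, hin, Complex.mul_conj, Complex.ofReal_re, Complex.normSq_eq_norm_sq]
    · rw [inner_self_eq_norm_sq_to_K]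
      norm_cast
  have h3 : circleMean r (fun z => ‖F z‖ₑ ^ 2) = ENNReal.ofReal (‖g‖ ^ 2) := by
    rw [circleMean_eq_haar]
    simp only [← hGx]
    rw [← eLpNorm_two_sq, ENNReal.ofReal_pow (norm_nonneg _), ofReal_norm, Lp.enorm_def]
    congr 1
    exact eLpNorm_congr_ae (ContinuousMap.coeFn_toLp _ G).symm
  rw [h3, ← hnorm.tsum_eq, ENNReal.ofReal_tsum_of_nonneg (fun _ => by positivity) hnorm.summable]
  congr 1
  ext n
  rw [hdn, mul_pow, ENNReal.ofReal_mul (by positivity), ENNReal.ofReal_pow (norm_nonneg _),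
    ofReal_norm, ← pow_mul, ENNReal.ofReal_pow hr, mul_comm n 2]

/-! ### Integration over the disc -/

/-- Integration in polar coordinates for the normalized area measure of the disc. -/
theorem lintegral_discArea {g : ℂ → ℝ≥0∞} (hg : Measurable g) :
    ∫⁻ z, g z ∂discArea =
      ∫⁻ r in Set.Ioo (0 : ℝ) 1, ENNReal.ofReal (2 * r) * circleMean r g := by
  have hb : MeasurableSet (Metric.ball (0 : ℂ) 1) := Metric.isOpen_ball.measurableSet
  have hm : Measurable ((Metric.ball (0 : ℂ) 1).indicator g) := hg.indicator hb
  have hpc : Measurable fun p : ℝ × ℝ => (p.1 : ℂ) * Complex.exp ((p.2 : ℂ) * I) := by fun_prop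
  have hpol : ∀ p : ℝ × ℝ, Complex.polarCoord.symm p = p.1 * Complex.exp (p.2 * I) := by
    intro p
    rw [Complex.polarCoord_symm_apply, Complex.exp_mul_I]
    push_cast
    rfl
  have h1 : ∫⁻ z, (Metric.ball (0 : ℂ) 1).indicator g z = ∫⁻ r in Set.Ioi (0 : ℝ),
      ∫⁻ t in Set.Ioo (-Real.pi) Real.pi, ENNReal.ofReal r *
        (Metric.ball (0 : ℂ) 1).indicator g (r * Complex.exp (t * I)) := by
    rw [← Complex.lintegral_comp_polarCoord_symm]
    simp only [hpol, smul_eq_mul]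
    rw [polarCoord_target, Measure.volume_eq_prod, ← Measure.prod_restrict, lintegral_prod]
    exact ((ENNReal.measurable_ofReal.comp measurable_fst).mul (hm.comp hpc)).aemeasurable
  have h2 : ∀ r ∈ Set.Ioi (0 : ℝ), ∫⁻ t in Set.Ioo (-Real.pi) Real.pi, ENNReal.ofReal r *
      (Metric.ball (0 : ℂ) 1).indicator g (r * Complex.exp (t * I)) =
      ENNReal.ofReal Real.pi *
        (Set.Iio (1 : ℝ)).indicator (fun r => ENNReal.ofReal (2 * r) * circleMean r g) r := by
    intro r hr
    rw [Set.mem_Ioi] at hr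
    have hmem : ∀ t : ℝ, ((r : ℂ) * Complex.exp (t * I) ∈ Metric.ball (0 : ℂ) 1) ↔ r < 1 := by
      intro t
      simp [Complex.norm_exp_ofReal_mul_I, abs_of_pos hr]
    by_cases h : r < 1
    · simp only [Set.indicator, hmem, h, if_true, Set.mem_Iio]
      rw [lintegral_const_mul _ (by
        exact hg.comp (hpc.comp (measurable_const.prodMk measurable_id))),
        Measure.restrict_congr_set Ioo_ae_eq_Ioc]
      have h3 := setLIntegral_Ioc_eq_haar (-Real.pi) r g
      rw [show -Real.pi + 2 * Real.pi = Real.pi by ring] at h3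
      rw [h3, circleMean_eq_haar, ENNReal.ofReal_mul zero_le_two, ENNReal.ofReal_mul zero_le_two]
      ring
    · simp [Set.indicator, hmem, h]
  rw [discArea, lintegral_smul_measure, ← lintegral_indicator hb, h1,
    setLIntegral_congr_fun measurableSet_Ioi h2, lintegral_const_mul' _ _ ENNReal.ofReal_ne_top,
    smul_eq_mul, ← mul_assoc, ENNReal.inv_mul_cancel (by simpa using Real.pi_pos)
      ENNReal.ofReal_ne_top, one_mul, setLIntegral_indicator measurableSet_Iio]
  congr 2
  ext x
  simp [and_comm]

/-! ### Power series on the disc and Dirichlet integrals -/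

theorem summable_norm_mul_pow {c : ℕ → ℂ} {F : ℂ → ℂ}
    (hF : ∀ z ∈ Metric.ball (0 : ℂ) 1, HasSum (fun n => c n * z ^ n) (F z)) {r : ℝ} (hr : 0 ≤ r)
    (hr1 : r < 1) : Summable fun n => ‖c n‖ * r ^ n := by
  have h := (hF r (by simpa [abs_of_nonneg hr] using hr1)).summable.norm
  simpa [abs_of_nonneg hr] using h

theorem differentiableOn_of_hasSum {c : ℕ → ℂ} {F : ℂ → ℂ}
    (hF : ∀ z ∈ Metric.ball (0 : ℂ) 1, HasSum (fun n => c n * z ^ n) (F z)) :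
    DifferentiableOn ℂ F (Metric.ball (0 : ℂ) 1) := by
  intro z hz
  rw [mem_ball_zero_iff] at hz
  obtain ⟨r, hzr, hr1⟩ := exists_between hz
  have hr : 0 ≤ r := (norm_nonneg z).trans hzr.le
  have hd : DifferentiableOn ℂ (fun w => ∑' n, c n * w ^ n) (Metric.ball (0 : ℂ) r) := by
    refine Complex.differentiableOn_tsum_of_summable_norm (summable_norm_mul_pow hF hr hr1)
      (fun n => by fun_prop) Metric.isOpen_ball fun n w hw => ?_
    rw [mem_ball_zero_iff] at hw
    rw [norm_mul, norm_pow]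
    gcongr
  have hzr' : z ∈ Metric.ball (0 : ℂ) r := by simpa using hzr
  have h1 : DifferentiableAt ℂ (fun w => ∑' n, c n * w ^ n) z :=
    hd.differentiableAt (Metric.isOpen_ball.mem_nhds hzr')
  refine (h1.congr_of_eventuallyEq ?_).differentiableWithinAt
  filter_upwards [Metric.isOpen_ball.mem_nhds hzr'] with w hw
  rw [mem_ball_zero_iff] at hw
  exact ((hF w (by simpa using hw.trans hr1)).tsum_eq).symm

theorem aemeasurable_discArea_of_continuousOn {F : ℂ → ℂ}
    (hF : ContinuousOn F (Metric.ball (0 : ℂ) 1)) : AEMeasurable F discArea :=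
  (hF.aemeasurable Metric.isOpen_ball.measurableSet).smul_measure _

theorem lintegral_discArea_congr {f g : ℂ → ℝ≥0∞}
    (h : ∀ z ∈ Metric.ball (0 : ℂ) 1, f z = g z) :
    ∫⁻ z, f z ∂discArea = ∫⁻ z, g z ∂discArea := by
  rw [discArea, lintegral_smul_measure, lintegral_smul_measure,
    setLIntegral_congr_fun Metric.isOpen_ball.measurableSet h]

theorem lintegral_Ioo_weight (N : ℕ) :
    ∫⁻ r in Set.Ioo (0 : ℝ) 1, ENNReal.ofReal (2 * r) * ENNReal.ofReal (1 - r ^ 2) *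
      ENNReal.ofReal r ^ (2 * N) = ENNReal.ofReal (1 / ((N + 1) * (N + 2))) := by
  have h1 : ∀ r ∈ Set.Ioo (0 : ℝ) 1, ENNReal.ofReal (2 * r) * ENNReal.ofReal (1 - r ^ 2) *
      ENNReal.ofReal r ^ (2 * N) = ENNReal.ofReal (2 * r ^ (2 * N + 1) - 2 * r ^ (2 * N + 3)) := by
    intro r hr
    have h0 : 0 ≤ 1 - r ^ 2 := by nlinarith [hr.1, hr.2]
    rw [← ENNReal.ofReal_pow hr.1.le, ← ENNReal.ofReal_mul (by linarith [hr.1]),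
      ← ENNReal.ofReal_mul (mul_nonneg (by linarith [hr.1]) h0)]
    congr 1
    ring
  rw [setLIntegral_congr_fun measurableSet_Ioo h1, ← ofReal_integral_eq_lintegral_ofReal]
  · congr 1
    rw [← integral_Ioc_eq_integral_Ioo, ← intervalIntegral.integral_of_le zero_le_one,
      intervalIntegral.integral_sub (by simp) (by simp), intervalIntegral.integral_const_mul,
      intervalIntegral.integral_const_mul, integral_pow, integral_pow]
    push_cast
    field_simp
    ring
  · refine (Continuous.integrableOn_Icc (by fun_prop)).mono_set Set.Ioo_subset_Icc_self
  · filter_upwards [ae_restrict_mem measurableSet_Ioo] with r hr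
    have h2 : r ^ (2 * N + 3) ≤ r ^ (2 * N + 1) :=
      pow_le_pow_of_le_one hr.1.le hr.2.le (by omega)
    simp only [Pi.zero_apply]
    linarith

/-- The local Dirichlet-type integral at a point `ξ` of the circle in terms of Taylor
coefficients: expand `F(z) / (ξ - z)` as a Cauchy product, and apply Parseval's identity on every
circle. -/
theorem lintegral_local {c : ℕ → ℂ} {F : ℂ → ℂ}
    (hF : ∀ z ∈ Metric.ball (0 : ℂ) 1, HasSum (fun n => c n * z ^ n) (F z))
    {ξ : ℂ} (hξ : ‖ξ‖ = 1) :
    ∫⁻ z, ‖F z‖ₑ ^ 2 * ENNReal.ofReal ((1 - ‖z‖ ^ 2) / ‖ξ - z‖ ^ 2) ∂discArea =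
      ∑' N : ℕ, ‖∑ j ∈ Finset.range (N + 1), c j * ξ ^ j‖ₑ ^ 2 *
        ENNReal.ofReal (1 / ((N + 1) * (N + 2))) := by
  have hξ0 : ξ ≠ 0 := by rintro rfl; simp at hξ
  -- the Taylor coefficients of `F(z) / (ξ - z)`
  set d : ℕ → ℂ := fun N => ∑ j ∈ Finset.range (N + 1), c j * ξ⁻¹ ^ (N - j + 1) with hd
  have hdn : ∀ N, ‖d N‖ₑ = ‖∑ j ∈ Finset.range (N + 1), c j * ξ ^ j‖ₑ := by
    intro N
    have h1 : d N * ξ ^ (N + 1) = ∑ j ∈ Finset.range (N + 1), c j * ξ ^ j := by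
      rw [hd, Finset.sum_mul]
      refine Finset.sum_congr rfl fun j hj => ?_
      have hj : j ≤ N := by simpa [Nat.lt_succ_iff] using hj
      rw [mul_assoc, inv_pow]
      congr 1
      rw [inv_mul_eq_iff_eq_mul₀ (pow_ne_zero _ hξ0), ← pow_add]
      congr 1
      omega
    rw [← h1, enorm_mul, enorm_pow]
    have : ‖ξ‖ₑ = 1 := by rw [← ofReal_norm, hξ, ENNReal.ofReal_one]
    rw [this, one_pow, mul_one]
  have hne : ∀ z ∈ Metric.ball (0 : ℂ) 1, ξ - z ≠ 0 := by
    intro z hz h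
    rw [sub_eq_zero] at h
    rw [mem_ball_zero_iff, ← h, hξ] at hz
    exact lt_irrefl _ hz
  have hgeo : ∀ z ∈ Metric.ball (0 : ℂ) 1,
      HasSum (fun n => ξ⁻¹ ^ (n + 1) * z ^ n) (ξ - z)⁻¹ := by
    intro z hz
    have hz' : ‖z / ξ‖ < 1 := by rw [norm_div, hξ, div_one]; simpa using hz
    have h1 := (hasSum_geometric_of_norm_lt_one hz').mul_left ξ⁻¹
    have e1 : (fun n => ξ⁻¹ * (z / ξ) ^ n) = fun n => ξ⁻¹ ^ (n + 1) * z ^ n := by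
      ext n; rw [div_eq_mul_inv, mul_pow]; ring
    have e2 : ξ⁻¹ * (1 - z / ξ)⁻¹ = (ξ - z)⁻¹ := by
      rw [← mul_inv]; congr 1; field_simp
    rwa [e1, e2] at h1
  have hcauchy : ∀ z ∈ Metric.ball (0 : ℂ) 1,
      Summable (fun n => ‖d n * z ^ n‖) ∧ HasSum (fun n => d n * z ^ n) (F z * (ξ - z)⁻¹) := by
    intro z hz
    have e : ∀ n, ∑ k ∈ Finset.range (n + 1), c k * z ^ k * (ξ⁻¹ ^ (n - k + 1) * z ^ (n - k)) =
        d n * z ^ n := by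
      intro n
      rw [hd, Finset.sum_mul]
      refine Finset.sum_congr rfl fun j hj => ?_
      have hj : j ≤ n := by simpa [Nat.lt_succ_iff] using hj
      rw [show z ^ n = z ^ j * z ^ (n - j) by rw [← pow_add]; congr 1; omega]
      ring
    have h1 := summable_norm_sum_mul_range_of_summable_norm (hF z hz).summable.norm
      (hgeo z hz).summable.norm
    have h2 := hasSum_sum_range_mul_of_summable_norm (hF z hz).summable.norm
      (hgeo z hz).summable.norm
    simp only [e] at h1 h2
    rw [(hF z hz).tsum_eq, (hgeo z hz).tsum_eq] at h2
    exact ⟨h1, h2⟩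
  set g : ℂ → ℝ≥0∞ := (Metric.ball (0 : ℂ) 1).indicator
    (fun z => ‖F z‖ₑ ^ 2 * ENNReal.ofReal ((1 - ‖z‖ ^ 2) / ‖ξ - z‖ ^ 2)) with hg
  have hgm : Measurable g := by
    have hFm : Measurable ((Metric.ball (0 : ℂ) 1).indicator F) := by
      classical
      rw [← Set.piecewise_eq_indicator]
      exact (differentiableOn_of_hasSum hF).continuousOn.measurable_piecewise continuousOn_const
        Metric.isOpen_ball.measurableSet
    have : g = fun z => ‖(Metric.ball (0 : ℂ) 1).indicator F z‖ₑ ^ 2 *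
        ENNReal.ofReal ((1 - ‖z‖ ^ 2) / ‖ξ - z‖ ^ 2) := by
      ext z
      by_cases hz : z ∈ Metric.ball (0 : ℂ) 1 <;> simp [hg, hz]
    rw [this]
    have h2 : Measurable fun z : ℂ => (1 - ‖z‖ ^ 2) / ‖ξ - z‖ ^ 2 := by fun_prop
    exact (hFm.enorm.pow_const 2).mul (ENNReal.measurable_ofReal.comp h2)
  have hcm : ∀ r ∈ Set.Ioo (0 : ℝ) 1, ENNReal.ofReal (2 * r) * circleMean r g =
      ∑' N, ‖d N‖ₑ ^ 2 * (ENNReal.ofReal (2 * r) * ENNReal.ofReal (1 - r ^ 2) *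
        ENNReal.ofReal r ^ (2 * N)) := by
    intro r hr
    have hball : ∀ z : ℂ, ‖z‖ = r → z ∈ Metric.ball (0 : ℂ) 1 := by
      intro z hz; rw [mem_ball_zero_iff, hz]; exact hr.2
    have hpar := circleMean_sq_of_hasSum (c := d) (F := fun z => F z * (ξ - z)⁻¹) hr.1.le ?_ ?_
    · have h1 : circleMean r g = ENNReal.ofReal (1 - r ^ 2) *
          circleMean r fun z => ‖F z * (ξ - z)⁻¹‖ₑ ^ 2 := by
        rw [circleMean_eq_haar, circleMean_eq_haar, ← lintegral_const_mul' _ _ ENNReal.ofReal_ne_top]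
        congr 1
        ext x
        set z : ℂ := r * AddCircle.toCircle x with hz
        have hzn : ‖z‖ = r := by
          rw [hz, norm_mul, Circle.norm_coe, Complex.norm_real, Real.norm_of_nonneg hr.1.le, mul_one]
        rw [hg, Set.indicator_of_mem (hball z hzn), hzn, enorm_mul, mul_pow, div_eq_mul_inv,
          ENNReal.ofReal_mul (by nlinarith [hr.1, hr.2])]
        have : ENNReal.ofReal (‖ξ - z‖ ^ 2)⁻¹ = ‖(ξ - z)⁻¹‖ₑ ^ 2 := by
          rw [← inv_pow, ← norm_inv, ENNReal.ofReal_pow (norm_nonneg _), ofReal_norm]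
        rw [this]
        ring
      rw [h1, hpar, ← mul_assoc, ← ENNReal.tsum_mul_left]
      congr 1
      ext N
      ring
    · have h1 := (hcauchy r (hball r (by simp [abs_of_pos hr.1]))).1
      simpa [abs_of_pos hr.1] using h1
    · exact fun z hz => (hcauchy z (hball z hz)).2
  have hg' : ∫⁻ z, ‖F z‖ₑ ^ 2 * ENNReal.ofReal ((1 - ‖z‖ ^ 2) / ‖ξ - z‖ ^ 2) ∂discArea =
      ∫⁻ z, g z ∂discArea :=
    lintegral_discArea_congr fun z hz => by rw [hg, Set.indicator_of_mem hz]
  rw [hg', lintegral_discArea hgm, setLIntegral_congr_fun measurableSet_Ioo hcm, lintegral_tsum]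
  · congr 1
    ext N
    rw [lintegral_const_mul' _ _ (by simp), lintegral_Ioo_weight, hdn]
  · intro N
    exact (by fun_prop : Measurable _).aemeasurable

/-- The weights `1 / (2π (N + 1) (N + 2))` of the coefficient formula for Dirichlet integrals. -/
def dirWeight (N : ℕ) : ℝ := 1 / (2 * Real.pi * ((N + 1) * (N + 2)))

theorem dirWeight_pos (N : ℕ) : 0 < dirWeight N := by
  have := Real.pi_pos
  unfold dirWeight
  positivity

theorem measurable_poissonKernel : Measurable fun p : ℂ × unitCirc =>
    ENNReal.ofReal ((1 - ‖p.1‖ ^ 2) / ‖(p.2 : ℂ) - p.1‖ ^ 2) := by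
  refine ENNReal.measurable_ofReal.comp ?_
  fun_prop

theorem measurable_poissonIntegral (μ : Measure unitCirc) [SFinite μ] :
    Measurable (poissonIntegral μ) :=
  (measurable_poissonKernel.lintegral_prod_right').const_mul _

instance : SFinite discArea := by unfold discArea; infer_instance

/-- The weighted Dirichlet-type integral of a power series in terms of its coefficients. -/
theorem lintegral_mul_poissonIntegral (μ : Measure unitCirc) [SFinite μ] {c : ℕ → ℂ} {F : ℂ → ℂ}
    (hF : ∀ z ∈ Metric.ball (0 : ℂ) 1, HasSum (fun n => c n * z ^ n) (F z)) :
    ∫⁻ z, ‖F z‖ₑ ^ 2 * poissonIntegral μ z ∂discArea =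
      ∫⁻ ξ : unitCirc, ∑' N : ℕ, ENNReal.ofReal (dirWeight N) *
        ‖∑ j ∈ Finset.range (N + 1), c j * (ξ : ℂ) ^ j‖ₑ ^ 2 ∂μ := by
  have hFm := aemeasurable_discArea_of_continuousOn (differentiableOn_of_hasSum hF).continuousOn
  have htop : (ENNReal.ofReal (2 * Real.pi))⁻¹ ≠ ∞ := by
    simp [Real.pi_pos]
  have h1 : ∀ z, ‖F z‖ₑ ^ 2 * poissonIntegral μ z = (ENNReal.ofReal (2 * Real.pi))⁻¹ *
      ∫⁻ ξ : unitCirc, ‖F z‖ₑ ^ 2 * ENNReal.ofReal ((1 - ‖z‖ ^ 2) / ‖(ξ : ℂ) - z‖ ^ 2) ∂μ := by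
    intro z
    rw [poissonIntegral, lintegral_const_mul' _ _ (by simp)]
    ring
  simp only [h1]
  rw [lintegral_const_mul' _ _ htop, lintegral_lintegral_swap, ← lintegral_const_mul' _ _ htop]
  · refine lintegral_congr fun ξ => ?_
    rw [lintegral_local hF (by simp), ← ENNReal.tsum_mul_left]
    refine tsum_congr fun N => ?_
    have hw : ENNReal.ofReal (dirWeight N) = (ENNReal.ofReal (2 * Real.pi))⁻¹ *
        ENNReal.ofReal (1 / ((N + 1) * (N + 2))) := by
      rw [← ENNReal.ofReal_inv_of_pos Real.two_pi_pos, ← ENNReal.ofReal_mul (by positivity),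
        dirWeight]
      congr 1
      field_simp
    rw [hw]
    ring
  · exact ((hFm.enorm.pow_const 2).comp_fst).mul measurable_poissonKernel.aemeasurable

/-! ### The one-variable norm as an `L²` norm of coefficient functionals -/

/-- The parameter space of the coefficient functionals. The parameters `n : ℕ` account for the norm
of the Hardy space, the parameters `(N, ξ)` for the Dirichlet integral. -/
abbrev EvalSpace : Type := ℕ ⊕ (ℕ × unitCirc)

/-- The matrix of the coefficient functionals: the functional with parameter `n` is the `n`-th
coefficient, the one with parameter `(N, ξ)` is a multiple of the partial sum at `ξ`, up to degree
`N`, of the derivative. -/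
def ell : EvalSpace → ℕ → ℂ
  | .inl n, m => if m = n then 1 else 0
  | .inr (N, ξ), m => if m ≤ N + 1 then (√(dirWeight N) : ℂ) * (m * (ξ : ℂ) ^ (m - 1)) else 0

/-- A bound for the number of nonzero entries of `ell ω`. -/
def evalDeg : EvalSpace → ℕ
  | .inl n => n + 1
  | .inr (N, _) => N + 2

/-- The part of the parameter measure which carries the norm of the Hardy space. -/
def hardyMeasure : Measure EvalSpace := Measure.map Sum.inl (Measure.count : Measure ℕ)

/-- The part of the parameter measure which carries the Dirichlet integral. -/
def dirMeasure (μ : Measure unitCirc) : Measure EvalSpace :=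
  Measure.map Sum.inr ((Measure.count : Measure ℕ).prod μ)

/-- The measure on the parameter space for which the one-variable norm is the `L²` norm of the
coefficient functionals. -/
def evalMeasure (μ : Measure unitCirc) : Measure EvalSpace := hardyMeasure + dirMeasure μ

/-- The coefficient functional with parameter `ω`, applied to a sequence of Taylor coefficients. -/
def ev (ω : EvalSpace) (b : ℕ → ℂ) : ℂ := ∑ m ∈ Finset.range (evalDeg ω), ell ω m * b m

instance : SFinite hardyMeasure := by unfold hardyMeasure; infer_instance

instance (μ : Measure unitCirc) [SFinite μ] : SFinite (dirMeasure μ) := by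
  unfold dirMeasure; infer_instance

instance (μ : Measure unitCirc) [SFinite μ] : SFinite (evalMeasure μ) := by
  unfold evalMeasure; infer_instance

theorem ell_eq_zero {ω : EvalSpace} {m : ℕ} (h : evalDeg ω ≤ m) : ell ω m = 0 := by
  rcases ω with n | ⟨N, ξ⟩
  · have : m ≠ n := by simp [evalDeg] at h; omega
    simp [ell, this]
  · have : ¬ m ≤ N + 1 := by simp [evalDeg] at h; omega
    simp [ell, this]

theorem ev_eq_sum_range {ω : EvalSpace} {K : ℕ} (h : evalDeg ω ≤ K) (b : ℕ → ℂ) :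
    ev ω b = ∑ m ∈ Finset.range K, ell ω m * b m := by
  refine Finset.sum_subset (Finset.range_mono h) fun m _ hm => ?_
  rw [ell_eq_zero (by simpa using hm), zero_mul]

theorem ev_inl (n : ℕ) (b : ℕ → ℂ) : ev (.inl n) b = b n := by
  rw [ev, Finset.sum_eq_single n]
  · simp [ell]
  · intro m _ h; simp [ell, h]
  · intro h; simp [evalDeg] at h

theorem ev_inr (N : ℕ) (ξ : unitCirc) (b : ℕ → ℂ) :
    ev (.inr (N, ξ)) b = (√(dirWeight N) : ℂ) *
      ∑ j ∈ Finset.range (N + 1), ((j + 1 : ℂ) * b (j + 1)) * (ξ : ℂ) ^ j := by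
  rw [ev, evalDeg, Finset.sum_range_succ', Finset.mul_sum]
  have h0 : ell (.inr (N, ξ)) 0 = 0 := by simp [ell]
  rw [h0, zero_mul, add_zero]
  refine Finset.sum_congr rfl fun j hj => ?_
  have hj : j + 1 ≤ N + 1 := by simpa using hj
  simp only [ell, hj, if_true, Nat.add_sub_cancel]
  push_cast
  ring

theorem enorm_sq_ev_inr (N : ℕ) (ξ : unitCirc) (b : ℕ → ℂ) :
    ‖ev (.inr (N, ξ)) b‖ₑ ^ 2 = ENNReal.ofReal (dirWeight N) *
      ‖∑ j ∈ Finset.range (N + 1), ((j + 1 : ℂ) * b (j + 1)) * (ξ : ℂ) ^ j‖ₑ ^ 2 := by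
  rw [ev_inr, enorm_mul, mul_pow]
  congr 1
  rw [← ofReal_norm, ← ENNReal.ofReal_pow (norm_nonneg _), Complex.norm_real, Real.norm_eq_abs,
    sq_abs, Real.sq_sqrt (dirWeight_pos N).le]

theorem ev_add (ω : EvalSpace) (b c : ℕ → ℂ) : ev ω (fun m => b m + c m) = ev ω b + ev ω c := by
  simp only [ev, mul_add, Finset.sum_add_distrib]

theorem ev_const_mul (ω : EvalSpace) (c : ℂ) (b : ℕ → ℂ) :
    ev ω (fun m => c * b m) = c * ev ω b := by
  simp only [ev, Finset.mul_sum]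
  exact Finset.sum_congr rfl fun _ _ => by ring

theorem measurable_ell (m : ℕ) : Measurable fun ω => ell ω m := by
  refine measurable_fun_sum (measurable_of_countable _) ?_
  refine measurable_from_prod_countable_right fun N => ?_
  change Measurable fun ξ : unitCirc => ell (.inr (N, ξ)) m
  by_cases h : m ≤ N + 1
  · simp only [ell, h, if_true]; fun_prop
  · simp only [ell, h, if_false]; fun_prop

theorem measurable_ev (b : ℕ → ℂ) : Measurable fun ω => ev ω b := by
  refine measurable_of_tendsto_metrizable
    (f := fun K ω => ∑ m ∈ Finset.range K, ell ω m * b m) (fun K => ?_) ?_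
  · exact Finset.measurable_fun_sum _ fun m _ => (measurable_ell m).mul_const _
  · rw [tendsto_pi_nhds]
    intro ω
    refine tendsto_const_nhds.congr' ?_
    filter_upwards [eventually_ge_atTop (evalDeg ω)] with K hK
    exact ev_eq_sum_range hK b

theorem lintegral_hardyMeasure {F : EvalSpace → ℝ≥0∞} (hF : Measurable F) :
    ∫⁻ ω, F ω ∂hardyMeasure = ∑' n, F (.inl n) := by
  rw [hardyMeasure, lintegral_map hF measurable_inl, lintegral_count]

theorem lintegral_dirMeasure (μ : Measure unitCirc) [SFinite μ] {F : EvalSpace → ℝ≥0∞}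
    (hF : Measurable F) : ∫⁻ ω, F ω ∂dirMeasure μ = ∫⁻ ξ, ∑' N, F (.inr (N, ξ)) ∂μ := by
  rw [dirMeasure, lintegral_map hF measurable_inr, lintegral_prod_symm]
  · simp only [lintegral_count]
  · exact (hF.comp measurable_inr).aemeasurable

theorem lintegral_evalMeasure (μ : Measure unitCirc) [SFinite μ] {F : EvalSpace → ℝ≥0∞}
    (hF : Measurable F) : ∫⁻ ω, F ω ∂evalMeasure μ =
      ∑' n, F (.inl n) + ∫⁻ ξ, ∑' N, F (.inr (N, ξ)) ∂μ := by
  rw [evalMeasure, lintegral_add_measure, lintegral_hardyMeasure hF, lintegral_dirMeasure μ hF]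

/-! ### Fejér means -/

/-- The inductive step of Jensen's inequality for squares: a point `s` with weight `d` is added to a
weighted sum `r` with total weight `p` and weighted sum of squares `q`. -/
theorem sq_add_mul_le {p d q r : ℝ} (s : ℝ) (hp : 0 ≤ p) (hd : 0 ≤ d) (hq : 0 ≤ q)
    (h : r ^ 2 ≤ p * q) : (r + d * s) ^ 2 ≤ (p + d) * (q + d * s ^ 2) := by
  have h1 : 2 * (r * s) ≤ q + p * s ^ 2 := by
    refine abs_le_of_sq_le_sq' ?_ (by positivity) |>.2
    nlinarith [sq_nonneg (q - p * s ^ 2), mul_le_mul_of_nonneg_right h (sq_nonneg s)]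
  nlinarith [mul_le_mul_of_nonneg_left h1 hd]

/-- Multipliers `v` which are decreasing and satisfy `v_j + (j + 1) (v_j - v_{j+1}) ≤ 1` contract
the weighted `ℓ²` norm of partial sums. The sums on the left are expanded by summation by parts,
and Jensen's inequality is applied. -/
theorem sum_multiplier_le {v : ℕ → ℝ} (hv0 : ∀ j, 0 ≤ v j) (hv1 : ∀ j, v j ≤ 1)
    (hv : ∀ j, v (j + 1) ≤ v j) (hvj : ∀ j : ℕ, v j + (j + 1) * (v j - v (j + 1)) ≤ 1)
    (x : ℕ → ℂ) (M : ℕ) :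
    ∑ N ∈ Finset.range M, dirWeight N * ‖∑ j ∈ Finset.range (N + 1), v j * x j‖ ^ 2 ≤
      ∑ N ∈ Finset.range M, dirWeight N * ‖∑ j ∈ Finset.range (N + 1), x j‖ ^ 2 := by
  -- summation by parts gives `∑_{j ≤ N} v_j x_j = R N + v_N s_N`, and `Q` bounds `R` by Jensen's
  -- inequality
  set s : ℕ → ℂ := fun N => ∑ j ∈ Finset.range (N + 1), x j with hs
  set R : ℕ → ℂ := fun M => ∑ j ∈ Finset.range M, ((v j - v (j + 1) : ℝ) : ℂ) * s j with hR
  set Q : ℕ → ℝ := fun M => ∑ j ∈ Finset.range M, (v j - v (j + 1)) * ‖s j‖ ^ 2 with hQ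
  have hQ0 : ∀ M, 0 ≤ Q M := fun M =>
    Finset.sum_nonneg fun j _ => mul_nonneg (sub_nonneg.2 (hv j)) (sq_nonneg _)
  have ht : ∀ N, ∑ j ∈ Finset.range (N + 1), (v j : ℂ) * x j = R N + v N * s N := by
    intro N
    induction N with
    | zero => simp [hR, hs]
    | succ N ih =>
      rw [Finset.sum_range_succ, ih]
      have e1 : R (N + 1) = R N + ((v N - v (N + 1) : ℝ) : ℂ) * s N := Finset.sum_range_succ _ _
      have e2 : s (N + 1) = s N + x (N + 1) := Finset.sum_range_succ _ _
      rw [e1, e2]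
      push_cast
      ring
  have hRQ : ∀ M, ‖R M‖ ^ 2 ≤ (1 - v M) * Q M := by
    intro M
    induction M with
    | zero => simp [hR, hQ]
    | succ M ih =>
      have e1 : R (M + 1) = R M + ((v M - v (M + 1) : ℝ) : ℂ) * s M := Finset.sum_range_succ _ _
      have e2 : Q (M + 1) = Q M + (v M - v (M + 1)) * ‖s M‖ ^ 2 := Finset.sum_range_succ _ _
      have hd : 0 ≤ v M - v (M + 1) := sub_nonneg.2 (hv M)
      have h1 := sq_add_mul_le ‖s M‖ (sub_nonneg.2 (hv1 M)) hd (hQ0 M) ih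
      have h2 : ‖R (M + 1)‖ ≤ ‖R M‖ + (v M - v (M + 1)) * ‖s M‖ := by
        rw [e1]
        refine (norm_add_le _ _).trans_eq ?_
        rw [norm_mul, Complex.norm_real, Real.norm_of_nonneg hd]
      calc ‖R (M + 1)‖ ^ 2 ≤ (‖R M‖ + (v M - v (M + 1)) * ‖s M‖) ^ 2 := by gcongr
        _ ≤ _ := h1
        _ = (1 - v (M + 1)) * Q (M + 1) := by rw [e2]; ring
  have htN : ∀ N, ‖∑ j ∈ Finset.range (N + 1), (v j : ℂ) * x j‖ ^ 2 ≤ Q N + v N * ‖s N‖ ^ 2 := by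
    intro N
    have h1 := sq_add_mul_le ‖s N‖ (sub_nonneg.2 (hv1 N)) (hv0 N) (hQ0 N) (hRQ N)
    rw [ht]
    calc ‖R N + v N * s N‖ ^ 2 ≤ (‖R N‖ + v N * ‖s N‖) ^ 2 := by
          gcongr
          refine (norm_add_le _ _).trans_eq ?_
          rw [norm_mul, Complex.norm_real, Real.norm_of_nonneg (hv0 N)]
      _ ≤ _ := h1
      _ = _ := by ring
  -- the tail `∑_{N ≥ M}` of the weights equals `1 / (2π (M + 1))`
  have key : ∀ M : ℕ, ∑ N ∈ Finset.range M,
      dirWeight N * ‖∑ j ∈ Finset.range (N + 1), (v j : ℂ) * x j‖ ^ 2 +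
        1 / (2 * Real.pi * (M + 1)) * Q M ≤ ∑ N ∈ Finset.range M, dirWeight N * ‖s N‖ ^ 2 := by
    intro M
    induction M with
    | zero => simp [hQ]
    | succ M ih =>
      rw [Finset.sum_range_succ, Finset.sum_range_succ (fun N => dirWeight N * ‖s N‖ ^ 2) M]
      have e2 : Q (M + 1) = Q M + (v M - v (M + 1)) * ‖s M‖ ^ 2 := Finset.sum_range_succ _ _
      have h1 := mul_le_mul_of_nonneg_left (htN M) (dirWeight_pos M).le
      have hpi := Real.pi_pos
      have h2 : dirWeight M * (Q M + v M * ‖s M‖ ^ 2) +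
          1 / (2 * Real.pi * ((M + 1 : ℕ) + 1)) * Q (M + 1) =
          1 / (2 * Real.pi * (M + 1)) * Q M +
          dirWeight M * ((v M + (M + 1) * (v M - v (M + 1))) * ‖s M‖ ^ 2) := by
        rw [e2, dirWeight]
        push_cast
        field_simp
        ring
      have h3 : dirWeight M * ((v M + (M + 1) * (v M - v (M + 1))) * ‖s M‖ ^ 2) ≤
          dirWeight M * ‖s M‖ ^ 2 := by
        refine mul_le_mul_of_nonneg_left ?_ (dirWeight_pos M).le
        exact mul_le_of_le_one_left (sq_nonneg _) (hvj M)
      linarith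
  have := Real.pi_pos
  exact (le_add_of_nonneg_right (mul_nonneg (by positivity) (hQ0 M))).trans (key M)

/-- The weights of the Fejér means. -/
def fejerWeight (K m : ℕ) : ℝ := max 0 (1 - m / (K + 1))

theorem fejerWeight_nonneg (K m : ℕ) : 0 ≤ fejerWeight K m := le_max_left _ _

theorem fejerWeight_le_one (K m : ℕ) : fejerWeight K m ≤ 1 :=
  max_le zero_le_one (by simp; positivity)

theorem fejerWeight_eq_zero {K m : ℕ} (h : K < m) : fejerWeight K m = 0 := by
  have h1 : ((K : ℝ) + 1) ≤ m := by exact_mod_cast h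
  refine max_eq_left ?_
  rw [sub_nonpos, le_div_iff₀ (by positivity)]
  linarith

theorem fejerWeight_succ_le (K m : ℕ) : fejerWeight K (m + 1) ≤ fejerWeight K m := by
  unfold fejerWeight
  gcongr
  linarith

theorem fejerWeight_step (K m : ℕ) :
    fejerWeight K (m + 1) + (m + 1) * (fejerWeight K (m + 1) - fejerWeight K (m + 2)) ≤ 1 := by
  rcases le_or_gt (K + 1) (m + 1) with h | h
  · rw [fejerWeight_eq_zero (by omega : K < m + 1), fejerWeight_eq_zero (by omega : K < m + 2)]
    simp
  · have h1 : fejerWeight K (m + 1) = 1 - (m + 1 : ℕ) / ((K : ℝ) + 1) := by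
      refine max_eq_right ?_
      have : ((m + 1 : ℕ) : ℝ) ≤ K + 1 := by exact_mod_cast h.le
      rw [sub_nonneg, div_le_one (by positivity)]
      exact this
    have h2 : 1 - (m + 2 : ℕ) / ((K : ℝ) + 1) ≤ fejerWeight K (m + 2) := le_max_right _ _
    have h3 : fejerWeight K (m + 1) - fejerWeight K (m + 2) ≤ 1 / ((K : ℝ) + 1) := by
      rw [h1]
      push_cast at h2 ⊢
      have : ((m : ℝ) + 2) / (K + 1) - (m + 1) / (K + 1) = 1 / (K + 1) := by ring
      linarith
    have h4 := mul_le_mul_of_nonneg_left h3 (by positivity : (0 : ℝ) ≤ m + 1)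
    rw [h1] at h4 ⊢
    have : ((m + 1 : ℕ) : ℝ) / (K + 1) = (m + 1) * (1 / (K + 1)) := by push_cast; ring
    linarith

theorem tendsto_fejerWeight (m : ℕ) : Tendsto (fun K => fejerWeight K m) atTop (𝓝 1) := by
  have h1 : Tendsto (fun K : ℕ => 1 - (m : ℝ) / (K + 1)) atTop (𝓝 (1 - 0)) := by
    refine tendsto_const_nhds.sub ?_
    exact tendsto_const_nhds.div_atTop
      (tendsto_atTop_add_const_right _ _ tendsto_natCast_atTop_atTop)
  have h2 := (tendsto_const_nhds (x := (0 : ℝ))).max h1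
  simpa [fejerWeight] using h2

/-- Fejér means contract the one-variable norm. -/
theorem lintegral_fejer_le (μ : Measure unitCirc) [SFinite μ] (K : ℕ) (b : ℕ → ℂ) :
    ∫⁻ ω, ‖ev ω (fun m => fejerWeight K m * b m)‖ₑ ^ 2 ∂evalMeasure μ ≤
      ∫⁻ ω, ‖ev ω b‖ₑ ^ 2 ∂evalMeasure μ := by
  rw [lintegral_evalMeasure μ ((measurable_ev _).enorm.pow_const 2),
    lintegral_evalMeasure μ ((measurable_ev _).enorm.pow_const 2)]
  refine add_le_add (ENNReal.tsum_le_tsum fun n => ?_) (lintegral_mono fun ξ => ?_)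
  · rw [ev_inl, ev_inl, enorm_mul]
    refine pow_le_pow_left₀ zero_le (mul_le_of_le_one_left zero_le ?_) 2
    rw [← ofReal_norm, Complex.norm_real, Real.norm_of_nonneg (fejerWeight_nonneg K n)]
    exact ENNReal.ofReal_le_one.2 (fejerWeight_le_one K n)
  · simp only [enorm_sq_ev_inr]
    refine ENNReal.tsum_le_of_sum_range_le fun M => le_trans ?_ (ENNReal.sum_le_tsum (Finset.range M))
    have h := sum_multiplier_le (v := fun j => fejerWeight K (j + 1))
      (fun j => fejerWeight_nonneg _ _) (fun j => fejerWeight_le_one _ _)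
      (fun j => fejerWeight_succ_le _ _) (fun j => fejerWeight_step K j)
      (fun j => ((j + 1 : ℂ) * b (j + 1)) * (ξ : ℂ) ^ j) M
    have e : ∀ y : ℕ → ℂ, ∑ N ∈ Finset.range M, ENNReal.ofReal (dirWeight N) * ‖y N‖ₑ ^ 2 =
        ENNReal.ofReal (∑ N ∈ Finset.range M, dirWeight N * ‖y N‖ ^ 2) := by
      intro y
      rw [ENNReal.ofReal_sum_of_nonneg
        (fun N _ => mul_nonneg (dirWeight_pos N).le (sq_nonneg _))]
      refine Finset.sum_congr rfl fun N _ => ?_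
      rw [ENNReal.ofReal_mul (dirWeight_pos N).le, ENNReal.ofReal_pow (norm_nonneg _), ofReal_norm]
    rw [e, e]
    refine ENNReal.ofReal_le_ofReal (le_of_eq_of_le ?_ h)
    refine Finset.sum_congr rfl fun N _ => ?_
    congr 3
    exact Finset.sum_congr rfl fun j _ => by ring

/-! ### Gram matrices of the monomials -/

/-- The moments `(1 / 2π) ∫ ξᵐ ξ̄ᵖ dμ`. -/
def moment (μ : Measure unitCirc) (m p : ℕ) : ℂ :=
  (2 * Real.pi : ℂ)⁻¹ * ∫ ξ : unitCirc, conj (ξ : ℂ) ^ p * (ξ : ℂ) ^ m ∂μ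

/-- The inner product of the monomials of degrees `m` and `p` in the one-variable space. -/
def gram (μ : Measure unitCirc) (m p : ℕ) : ℂ :=
  (if m = p then 1 else 0) + (min m p : ℕ) * moment μ (m - 1) (p - 1)

theorem hasSum_dirWeight_tail (M : ℕ) :
    HasSum (fun N => if M ≤ N then dirWeight N else 0) (1 / (2 * Real.pi * (M + 1))) := by
  have hpi := Real.pi_pos
  rw [hasSum_iff_tendsto_nat_of_nonneg (fun N => by
    split_ifs; exacts [(dirWeight_pos N).le, le_rfl])]
  have h : ∀ n, M ≤ n → ∑ N ∈ Finset.range n, (if M ≤ N then dirWeight N else 0) =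
      1 / (2 * Real.pi * (M + 1)) - 1 / (2 * Real.pi) * (1 / ((n : ℝ) + 1)) := by
    intro n hn
    induction n, hn using Nat.le_induction with
    | base =>
      rw [Finset.sum_eq_zero]
      · field_simp; ring
      · intro N hN
        have : ¬ M ≤ N := by simpa using hN
        simp [this]
    | succ n hn ih =>
      rw [Finset.sum_range_succ, ih, if_pos hn, dirWeight]
      push_cast
      field_simp
      ring
  have h2 : Tendsto (fun n : ℕ => 1 / (2 * Real.pi * ((M : ℝ) + 1)) -
      1 / (2 * Real.pi) * (1 / ((n : ℝ) + 1))) atTop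
      (𝓝 (1 / (2 * Real.pi * ((M : ℝ) + 1)) - 1 / (2 * Real.pi) * 0)) :=
    tendsto_const_nhds.sub (tendsto_const_nhds.mul tendsto_one_div_add_atTop_nhds_zero_nat)
  rw [mul_zero, sub_zero] at h2
  refine h2.congr' ?_
  filter_upwards [eventually_ge_atTop M] with n hn
  exact (h n hn).symm

theorem integrable_monomials (μ : Measure unitCirc) [IsFiniteMeasure μ] (m p : ℕ) :
    Integrable (fun ξ : unitCirc => conj (ξ : ℂ) ^ p * (ξ : ℂ) ^ m) μ := by
  refine Integrable.of_bound (C := 1) ?_ ?_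
  · exact (by fun_prop : Continuous fun ξ : unitCirc =>
      conj (ξ : ℂ) ^ p * (ξ : ℂ) ^ m).aestronglyMeasurable
  · refine Eventually.of_forall fun ξ => ?_
    simp

/-- The Gram matrix of the monomials, as functions of the parameter `ω`. The weights `dirWeight N`
with `N + 1 ≥ max m p` add up to `1 / (2π max m p)`, which turns the factor `m p` into `min m p`. -/
theorem integrable_and_integral_ell (μ : Measure unitCirc) [IsFiniteMeasure μ] (m p : ℕ) :
    Integrable (fun ω => conj (ell ω p) * ell ω m) (evalMeasure μ) ∧
      ∫ ω, conj (ell ω p) * ell ω m ∂evalMeasure μ = gram μ m p := by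
  have hmeas : Measurable fun ω => conj (ell ω p) * ell ω m :=
    (Complex.continuous_conj.measurable.comp (measurable_ell p)).mul (measurable_ell m)
  have hl : ∀ n : ℕ, conj (ell (.inl n) p) * ell (.inl n) m =
      if n = m then (if m = p then 1 else 0) else 0 := by
    intro n
    simp only [ell]
    by_cases h1 : p = n <;> by_cases h2 : m = n <;> by_cases h3 : m = p <;> simp_all
    all_goals (intro h; omega)
  have hls : HasSum (fun n : ℕ => conj (ell (.inl n) p) * ell (.inl n) m)
      (if m = p then (1 : ℂ) else 0) := by
    simp only [hl]
    exact hasSum_ite_eq m _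
  set g : unitCirc → ℂ := fun ξ => ((m : ℂ) * p) * (conj (ξ : ℂ) ^ (p - 1) * (ξ : ℂ) ^ (m - 1))
    with hg
  set h : ℕ → ℂ := fun N => (((if max m p - 1 ≤ N then dirWeight N else 0) : ℝ) : ℂ) with hh
  have hr : ∀ x : ℕ × unitCirc, conj (ell (.inr x) p) * ell (.inr x) m = h x.1 * g x.2 := by
    rintro ⟨N, ξ⟩
    have hw : ((√(dirWeight N) : ℝ) : ℂ) * (√(dirWeight N) : ℝ) = (dirWeight N : ℝ) := by
      rw [← Complex.ofReal_mul, Real.mul_self_sqrt (dirWeight_pos N).le]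
    simp only [ell, hh, hg]
    by_cases h1 : m ≤ N + 1
    · by_cases h2 : p ≤ N + 1
      · rw [if_pos h1, if_pos h2, if_pos (by omega), ← hw]
        simp only [map_mul, map_pow, Complex.conj_ofReal, Complex.conj_natCast]
        ring
      · have h3 : ¬ max m p - 1 ≤ N := by omega
        simp only [if_neg h2, if_neg h3]; simp
    · have h3 : ¬ max m p - 1 ≤ N := by omega
      simp only [if_neg h1, if_neg h3]; simp
  have hhs : HasSum h ((1 / (2 * Real.pi * (((max m p - 1 : ℕ) : ℝ) + 1)) : ℝ) : ℂ) :=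
    Complex.hasSum_ofReal.2 (hasSum_dirWeight_tail _)
  have hhi : Integrable h Measure.count := integrable_count_iff.2 hhs.summable.norm
  have hgi : Integrable g μ := (integrable_monomials μ _ _).const_mul _
  have i1 : Integrable (fun ω => conj (ell ω p) * ell ω m)
      (Measure.map Sum.inl (Measure.count : Measure ℕ)) := by
    rw [integrable_map_measure hmeas.aestronglyMeasurable measurable_inl.aemeasurable]
    exact integrable_count_iff.2 hls.summable.norm
  have i2 : Integrable (fun ω => conj (ell ω p) * ell ω m)
      (Measure.map Sum.inr ((Measure.count : Measure ℕ).prod μ)) := by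
    rw [integrable_map_measure hmeas.aestronglyMeasurable measurable_inr.aemeasurable]
    refine (hhi.mul_prod hgi).congr (Eventually.of_forall fun x => ?_)
    exact (hr x).symm
  refine ⟨i1.add_measure i2, ?_⟩
  rw [evalMeasure, hardyMeasure, dirMeasure, integral_add_measure i1 i2,
    integral_map measurable_inl.aemeasurable hmeas.aestronglyMeasurable,
    integral_map measurable_inr.aemeasurable hmeas.aestronglyMeasurable]
  simp only [hr]
  have hcount : ∀ (f : ℕ → ℂ) (s : ℂ), HasSum f s → ∫ n, f n ∂Measure.count = s := by
    intro f s hf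
    rw [integral_countable (integrable_count_iff.2 hf.summable.norm)]
    simpa using hf.tsum_eq
  rw [integral_prod_mul, hcount _ _ hls, hcount _ _ hhs, gram, moment, hg, integral_const_mul]
  congr 1
  rcases Nat.eq_zero_or_pos m with rfl | hm
  · simp
  rcases Nat.eq_zero_or_pos p with rfl | hp
  · simp
  have e1 : (((max m p - 1 : ℕ) : ℝ) + 1) = (max m p : ℕ) := by
    rw [← Nat.cast_succ]; congr 1; omega
  have e2 : (m : ℂ) * p = (max m p : ℕ) * (min m p : ℕ) := by
    rw [← Nat.cast_mul, ← Nat.cast_mul, max_mul_min]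
  have e3 : ((max m p : ℕ) : ℂ) ≠ 0 := by
    rw [Nat.cast_ne_zero]; omega
  have e4 : (Real.pi : ℂ) ≠ 0 := by exact_mod_cast Real.pi_ne_zero
  rw [e1, e2]
  simp only [Complex.ofReal_div, Complex.ofReal_one, Complex.ofReal_mul, Complex.ofReal_ofNat,
    Complex.ofReal_natCast]
  field_simp

/-! ### The two-variable norm -/

/-- The tensor products of the one-variable coefficient functionals. -/
def ev₂ (a : ℕ × ℕ → ℂ) (p : EvalSpace × EvalSpace) : ℂ :=
  ev p.1 fun m => ev p.2 fun n => a (m, n)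

/-- The squared norm of a function on the bidisc with Taylor coefficients `a`, see
`HasTaylor.dirichletNormSq_eq`. -/
def coefNorm (μ₁ μ₂ : Measure unitCirc) (a : ℕ × ℕ → ℂ) : ℝ≥0∞ :=
  ∫⁻ p, ‖ev₂ a p‖ₑ ^ 2 ∂(evalMeasure μ₁).prod (evalMeasure μ₂)

theorem ev₂_eq_sum {p : EvalSpace × EvalSpace} {K : ℕ} (h₁ : evalDeg p.1 ≤ K)
    (h₂ : evalDeg p.2 ≤ K) (a : ℕ × ℕ → ℂ) :
    ev₂ a p = ∑ x ∈ Finset.range K ×ˢ Finset.range K, ell p.1 x.1 * ell p.2 x.2 * a x := by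
  rw [ev₂, ev_eq_sum_range h₁, Finset.sum_product]
  refine Finset.sum_congr rfl fun m _ => ?_
  rw [ev_eq_sum_range h₂, Finset.mul_sum]
  exact Finset.sum_congr rfl fun n _ => by ring

theorem ev₂_swap (a : ℕ × ℕ → ℂ) (p : EvalSpace × EvalSpace) :
    ev₂ a p = ev p.2 fun n => ev p.1 fun m => a (m, n) := by
  simp only [ev₂, ev, Finset.mul_sum]
  rw [Finset.sum_comm]
  exact Finset.sum_congr rfl fun _ _ => Finset.sum_congr rfl fun _ _ => by ring

theorem ev₂_add (a b : ℕ × ℕ → ℂ) (p : EvalSpace × EvalSpace) :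
    ev₂ (a + b) p = ev₂ a p + ev₂ b p := by
  simp only [ev₂, Pi.add_apply, ev_add]

theorem ev₂_smul (c : ℂ) (a : ℕ × ℕ → ℂ) (p : EvalSpace × EvalSpace) :
    ev₂ (c • a) p = c * ev₂ a p := by
  simp only [ev₂, Pi.smul_apply, smul_eq_mul, ev_const_mul]

theorem ev₂_sub (a b : ℕ × ℕ → ℂ) (p : EvalSpace × EvalSpace) :
    ev₂ (a - b) p = ev₂ a p - ev₂ b p := by
  rw [sub_eq_add_neg, ← neg_one_smul ℂ b, ev₂_add, ev₂_smul]
  ring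

theorem measurable_ev₂ (a : ℕ × ℕ → ℂ) : Measurable (ev₂ a) := by
  refine measurable_of_tendsto_metrizable (f := fun K p =>
    ∑ x ∈ Finset.range K ×ˢ Finset.range K, ell p.1 x.1 * ell p.2 x.2 * a x) (fun K => ?_) ?_
  · exact Finset.measurable_fun_sum _ fun x _ => (((measurable_ell x.1).comp measurable_fst).mul
      ((measurable_ell x.2).comp measurable_snd)).mul_const _
  · rw [tendsto_pi_nhds]
    intro p
    refine tendsto_const_nhds.congr' ?_
    filter_upwards [eventually_ge_atTop (evalDeg p.1), eventually_ge_atTop (evalDeg p.2)]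
      with K h₁ h₂
    exact ev₂_eq_sum h₁ h₂ a

theorem tendsto_ev₂ {ι : Type*} {l : Filter ι} {a : ι → ℕ × ℕ → ℂ} {b : ℕ × ℕ → ℂ}
    (h : ∀ x, Tendsto (fun i => a i x) l (𝓝 (b x))) (p : EvalSpace × EvalSpace) :
    Tendsto (fun i => ev₂ (a i) p) l (𝓝 (ev₂ b p)) := by
  simp only [ev₂_eq_sum (le_max_left (evalDeg p.1) (evalDeg p.2)) (le_max_right _ _)]
  exact tendsto_finsetSum _ fun x _ => (h x).const_mul _

/-- Fatou's lemma. It applies because every `ev₂ a p` involves finitely many coefficients. -/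
theorem coefNorm_le_liminf (μ₁ μ₂ : Measure unitCirc) {a : ℕ → ℕ × ℕ → ℂ} {b : ℕ × ℕ → ℂ}
    (h : ∀ x, Tendsto (fun i => a i x) atTop (𝓝 (b x))) :
    coefNorm μ₁ μ₂ b ≤ liminf (fun i => coefNorm μ₁ μ₂ (a i)) atTop := by
  have h1 : ∀ p, ‖ev₂ b p‖ₑ ^ 2 = liminf (fun i => ‖ev₂ (a i) p‖ₑ ^ 2) atTop := fun p =>
    (((ENNReal.continuous_pow 2).comp continuous_enorm).tendsto _ |>.comp
      (tendsto_ev₂ h p)).liminf_eq.symm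
  simp only [coefNorm, h1]
  exact lintegral_liminf_le fun i => (measurable_ev₂ _).enorm.pow_const 2

theorem coefNorm_smul (μ₁ μ₂ : Measure unitCirc) (c : ℂ) (a : ℕ × ℕ → ℂ) :
    coefNorm μ₁ μ₂ (c • a) = ‖c‖ₑ ^ 2 * coefNorm μ₁ μ₂ a := by
  simp only [coefNorm, ev₂_smul, enorm_mul, mul_pow]
  exact lintegral_const_mul' _ _ (by simp)

theorem coefNorm_parallelogram (μ₁ μ₂ : Measure unitCirc) (a b : ℕ × ℕ → ℂ) :
    coefNorm μ₁ μ₂ (a - b) + coefNorm μ₁ μ₂ (a + b) =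
      2 * coefNorm μ₁ μ₂ a + 2 * coefNorm μ₁ μ₂ b := by
  have hm : ∀ a : ℕ × ℕ → ℂ, Measurable fun p => ‖ev₂ a p‖ₑ ^ 2 := fun a =>
    (measurable_ev₂ a).enorm.pow_const 2
  simp only [coefNorm]
  rw [← lintegral_add_left (hm _), ← lintegral_const_mul _ (hm _), ← lintegral_const_mul _ (hm _),
    ← lintegral_add_left ((hm _).const_mul _)]
  refine lintegral_congr fun p => ?_
  rw [ev₂_add, ev₂_sub]
  have e : ∀ z : ℂ, ‖z‖ₑ ^ 2 = ENNReal.ofReal (‖z‖ ^ 2) := fun z => by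
    rw [ENNReal.ofReal_pow (norm_nonneg _), ofReal_norm]
  simp only [e]
  rw [← ENNReal.ofReal_add (by positivity) (by positivity), ← mul_add,
    ← ENNReal.ofReal_add (by positivity) (by positivity),
    show (2 : ℝ≥0∞) = ENNReal.ofReal 2 by simp, ← ENNReal.ofReal_mul (by positivity)]
  congr 1
  have := parallelogram_law_with_norm ℂ (ev₂ a p) (ev₂ b p)
  nlinarith

theorem coefNorm_eq_lintegral (μ₁ μ₂ : Measure unitCirc) [SFinite μ₁] [SFinite μ₂]
    (a : ℕ × ℕ → ℂ) : coefNorm μ₁ μ₂ a =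
      ∫⁻ ω₁, ∫⁻ ω₂, ‖ev₂ a (ω₁, ω₂)‖ₑ ^ 2 ∂evalMeasure μ₂ ∂evalMeasure μ₁ :=
  lintegral_prod _ ((measurable_ev₂ a).enorm.pow_const 2).aemeasurable

theorem coefNorm_eq_lintegral_symm (μ₁ μ₂ : Measure unitCirc) [SFinite μ₁] [SFinite μ₂]
    (a : ℕ × ℕ → ℂ) : coefNorm μ₁ μ₂ a =
      ∫⁻ ω₂, ∫⁻ ω₁, ‖ev₂ a (ω₁, ω₂)‖ₑ ^ 2 ∂evalMeasure μ₁ ∂evalMeasure μ₂ :=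
  lintegral_prod_symm _ ((measurable_ev₂ a).enorm.pow_const 2).aemeasurable

/-- The Fejér means of a double power series. -/
def fejer (K : ℕ) (a : ℕ × ℕ → ℂ) : ℕ × ℕ →₀ ℂ :=
  Finsupp.onFinset (Finset.range (K + 1) ×ˢ Finset.range (K + 1))
    (fun x => fejerWeight K x.1 * (fejerWeight K x.2 * a x)) (by
      intro x hx
      simp only [Finset.mem_product, Finset.mem_range]
      by_contra h
      refine hx ?_
      rw [not_and_or] at h
      rcases h with h | h
      · rw [fejerWeight_eq_zero (by omega)]; simp
      · rw [fejerWeight_eq_zero (m := x.2) (by omega)]; simp)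

theorem fejer_apply (K : ℕ) (a : ℕ × ℕ → ℂ) (x : ℕ × ℕ) :
    fejer K a x = fejerWeight K x.1 * (fejerWeight K x.2 * a x) := rfl

theorem tendsto_fejer (a : ℕ × ℕ → ℂ) (x : ℕ × ℕ) :
    Tendsto (fun K => fejer K a x) atTop (𝓝 (a x)) := by
  have h : ∀ m, Tendsto (fun K => (fejerWeight K m : ℂ)) atTop (𝓝 1) := fun m => by
    have := (Complex.continuous_ofReal.tendsto 1).comp (tendsto_fejerWeight m)
    simpa [Function.comp_def] using this
  have := (h x.1).mul ((h x.2).mul_const (a x))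
  simpa [fejer_apply] using this

theorem coefNorm_fejer_le (μ₁ μ₂ : Measure unitCirc) [SFinite μ₁] [SFinite μ₂] (K : ℕ)
    (a : ℕ × ℕ → ℂ) : coefNorm μ₁ μ₂ (fejer K a) ≤ coefNorm μ₁ μ₂ a := by
  have h1 : coefNorm μ₁ μ₂ (fejer K a) ≤
      coefNorm μ₁ μ₂ (fun x => fejerWeight K x.2 * a x) := by
    rw [coefNorm_eq_lintegral_symm, coefNorm_eq_lintegral_symm]
    refine lintegral_mono fun ω₂ => ?_
    have := lintegral_fejer_le μ₁ K fun m => ev ω₂ fun n => fejerWeight K n * a (m, n)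
    simpa only [ev₂, fejer_apply, ev_const_mul] using this
  refine h1.trans ?_
  rw [coefNorm_eq_lintegral, coefNorm_eq_lintegral]
  refine lintegral_mono fun ω₁ => ?_
  have := lintegral_fejer_le μ₂ K fun n => ev ω₁ fun m => a (m, n)
  simpa only [ev₂_swap, ev_const_mul] using this

/-- Fejér means converge in norm: they do not increase the norm, so that the parallelogram
identity and Fatou's lemma upgrade coefficientwise convergence. -/
theorem tendsto_coefNorm_fejer_sub (μ₁ μ₂ : Measure unitCirc) [SFinite μ₁] [SFinite μ₂]
    {a : ℕ × ℕ → ℂ} (ha : coefNorm μ₁ μ₂ a < ∞) :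
    Tendsto (fun K => coefNorm μ₁ μ₂ (fejer K a - a)) atTop (𝓝 0) := by
  set A := coefNorm μ₁ μ₂ a with hA
  have hsum : ∀ K, coefNorm μ₁ μ₂ (fejer K a - a) + coefNorm μ₁ μ₂ (fejer K a + a) ≤ 4 * A := by
    intro K
    rw [coefNorm_parallelogram]
    calc _ ≤ 2 * A + 2 * A := by gcongr; exact coefNorm_fejer_le μ₁ μ₂ K a
      _ = 4 * A := by ring
  have hlim : 4 * A ≤ liminf (fun K => coefNorm μ₁ μ₂ (fejer K a + a)) atTop := by
    have h2 : coefNorm μ₁ μ₂ ((2 : ℂ) • a) = 4 * A := by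
      rw [coefNorm_smul]
      congr 1
      rw [← ofReal_norm, ← ENNReal.ofReal_pow (norm_nonneg _)]
      norm_num
    rw [← h2]
    refine coefNorm_le_liminf μ₁ μ₂ fun x => ?_
    have := (tendsto_fejer a x).add_const (a x)
    simpa [two_mul] using this
  rw [ENNReal.tendsto_nhds_zero]
  intro ε hε
  rcases eq_or_ne A 0 with h0 | h0
  · refine Eventually.of_forall fun K => ?_
    have := (le_self_add).trans (hsum K)
    rw [h0, mul_zero] at this
    exact this.trans zero_le
  have h4 : 4 * A ≠ ∞ := ENNReal.mul_ne_top (by simp) ha.ne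
  have hlt : 4 * A - ε < 4 * A := ENNReal.sub_lt_self h4 (by simpa using h0) hε.ne'
  filter_upwards [eventually_lt_of_lt_liminf (hlt.trans_le hlim)] with K hK
  by_contra! hcon
  have h5 := ENNReal.add_lt_add hcon hK
  have h6 : 4 * A ≤ ε + (4 * A - ε) := le_add_tsub
  exact absurd ((h6.trans_lt h5).trans_le (hsum K)) (lt_irrefl _)

theorem enorm_sq_le_coefNorm (μ₁ μ₂ : Measure unitCirc) [SFinite μ₁] [SFinite μ₂]
    (a : ℕ × ℕ → ℂ) (x : ℕ × ℕ) : ‖a x‖ₑ ^ 2 ≤ coefNorm μ₁ μ₂ a := by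
  have hm : Measurable fun p => ‖ev₂ a p‖ₑ ^ 2 := (measurable_ev₂ a).enorm.pow_const 2
  rw [coefNorm_eq_lintegral, lintegral_evalMeasure μ₁ hm.lintegral_prod_right']
  refine le_trans ?_ le_self_add
  refine le_trans ?_ (ENNReal.le_tsum x.1)
  rw [lintegral_evalMeasure μ₂ (F := fun y => ‖ev₂ a (Sum.inl x.1, y)‖ₑ ^ 2)
    (hm.comp measurable_prodMk_left)]
  refine le_trans ?_ le_self_add
  refine le_trans ?_ (ENNReal.le_tsum x.2)
  simp [ev₂, ev_inl]

/-! ### Polynomials as elements of an `L²` space -/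

section PolyLp

variable (μ₁ μ₂ : Measure unitCirc) [IsFiniteMeasure μ₁] [IsFiniteMeasure μ₂]

theorem ev₂_single (x : ℕ × ℕ) (c : ℂ) (p : EvalSpace × EvalSpace) :
    ev₂ (Finsupp.single x c) p = c * (ell p.1 x.1 * ell p.2 x.2) := by
  classical
  obtain ⟨K, hK⟩ : ∃ K, evalDeg p.1 ≤ K ∧ evalDeg p.2 ≤ K ∧ x.1 < K ∧ x.2 < K :=
    ⟨evalDeg p.1 + evalDeg p.2 + x.1 + x.2 + 1, by omega, by omega, by omega, by omega⟩
  rw [ev₂_eq_sum hK.1 hK.2.1, Finset.sum_eq_single x]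
  · rw [Finsupp.single_eq_same]; ring
  · intro y _ h
    rw [Finsupp.single_eq_of_ne h, mul_zero]
  · intro h
    simp [hK.2.2.1, hK.2.2.2] at h

theorem memLp_ell (μ : Measure unitCirc) [IsFiniteMeasure μ] (m : ℕ) :
    MemLp (fun ω => ell ω m) 2 (evalMeasure μ) := by
  rw [memLp_two_iff_integrable_sq_norm (measurable_ell m).aestronglyMeasurable]
  refine (integrable_and_integral_ell μ m m).1.norm.congr (Eventually.of_forall fun ω => ?_)
  simp [sq]

theorem memLp_ev₂ (c : ℕ × ℕ →₀ ℂ) :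
    MemLp (ev₂ c) 2 ((evalMeasure μ₁).prod (evalMeasure μ₂)) := by
  induction c using Finsupp.induction_linear with
  | zero =>
    have : ev₂ ((0 : ℕ × ℕ →₀ ℂ) : ℕ × ℕ → ℂ) = 0 := by
      ext p; simp [ev₂, ev]
    rw [this]
    exact MemLp.zero
  | add f g hf hg =>
    have : ev₂ ((f + g : ℕ × ℕ →₀ ℂ) : ℕ × ℕ → ℂ) = ev₂ f + ev₂ g := by
      ext p; rw [Finsupp.coe_add, ev₂_add]; rfl
    rw [this]
    exact hf.add hg
  | single x c =>
    rw [memLp_two_iff_integrable_sq_norm (measurable_ev₂ _).aestronglyMeasurable]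
    have h1 := (memLp_two_iff_integrable_sq_norm
      (measurable_ell x.1).aestronglyMeasurable).1 (memLp_ell μ₁ x.1)
    have h2 := (memLp_two_iff_integrable_sq_norm
      (measurable_ell x.2).aestronglyMeasurable).1 (memLp_ell μ₂ x.2)
    refine ((h1.mul_prod h2).const_mul (‖c‖ ^ 2)).congr (Eventually.of_forall fun p => ?_)
    simp only [ev₂_single, norm_mul]
    ring

/-- A polynomial, given by its coefficients, as an element of the `L²` space which carries the
norm `coefNorm`. -/
def polyLp : (ℕ × ℕ →₀ ℂ) →ₗ[ℂ] Lp ℂ 2 ((evalMeasure μ₁).prod (evalMeasure μ₂)) where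
  toFun c := (memLp_ev₂ μ₁ μ₂ c).toLp
  map_add' f g := by
    rw [← MemLp.toLp_add]
    refine MemLp.toLp_congr _ _ (Eventually.of_forall fun p => ?_)
    rw [Finsupp.coe_add, ev₂_add]; rfl
  map_smul' r f := by
    rw [RingHom.id_apply, ← MemLp.toLp_const_smul]
    refine MemLp.toLp_congr _ _ (Eventually.of_forall fun p => ?_)
    rw [Finsupp.coe_smul, ev₂_smul]; rfl

theorem enorm_sq_polyLp (c : ℕ × ℕ →₀ ℂ) : ‖polyLp μ₁ μ₂ c‖ₑ ^ 2 = coefNorm μ₁ μ₂ c := by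
  rw [coefNorm, ← eLpNorm_two_sq]
  congr 1
  exact Lp.enorm_toLp (memLp_ev₂ μ₁ μ₂ c)

theorem inner_polyLp_single (x y : ℕ × ℕ) :
    ⟪polyLp μ₁ μ₂ (Finsupp.single x 1), polyLp μ₁ μ₂ (Finsupp.single y 1)⟫_ℂ =
      gram μ₁ y.1 x.1 * gram μ₂ y.2 x.2 := by
  rw [L2.inner_def, ← (integrable_and_integral_ell μ₁ y.1 x.1).2,
    ← (integrable_and_integral_ell μ₂ y.2 x.2).2, ← integral_prod_mul]
  refine integral_congr_ae ?_
  filter_upwards [(memLp_ev₂ μ₁ μ₂ (Finsupp.single x 1)).coeFn_toLp,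
    (memLp_ev₂ μ₁ μ₂ (Finsupp.single y 1)).coeFn_toLp] with p h1 h2
  have h1' : (polyLp μ₁ μ₂ (Finsupp.single x 1) : EvalSpace × EvalSpace → ℂ) p = _ := h1
  have h2' : (polyLp μ₁ μ₂ (Finsupp.single y 1) : EvalSpace × EvalSpace → ℂ) p = _ := h2
  rw [h1', h2', ev₂_single, ev₂_single, RCLike.inner_apply]
  simp only [map_mul, one_mul]
  ring

end PolyLp

theorem inner_eq_of_norm_eq {V E F : Type*} [AddCommGroup V] [Module ℂ V] [NormedAddCommGroup E]
    [InnerProductSpace ℂ E] [NormedAddCommGroup F] [InnerProductSpace ℂ F] (A : V →ₗ[ℂ] E)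
    (B : V →ₗ[ℂ] F) (h : ∀ v, ‖A v‖ = ‖B v‖) (v w : V) : ⟪A v, A w⟫_ℂ = ⟪B v, B w⟫_ℂ := by
  rw [inner_eq_sum_norm_sq_div_four, inner_eq_sum_norm_sq_div_four]
  simp only [← map_add, ← map_sub, ← map_smul, h]

theorem norm_eq_of_inner_basis_eq {ι E F : Type*} [NormedAddCommGroup E]
    [InnerProductSpace ℂ E] [NormedAddCommGroup F] [InnerProductSpace ℂ F] (A : (ι →₀ ℂ) →ₗ[ℂ] E)
    (B : (ι →₀ ℂ) →ₗ[ℂ] F) (h : ∀ i j, ⟪A (Finsupp.single i 1), A (Finsupp.single j 1)⟫_ℂ =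
      ⟪B (Finsupp.single i 1), B (Finsupp.single j 1)⟫_ℂ) (v : ι →₀ ℂ) : ‖A v‖ = ‖B v‖ := by
  have hv : v = ∑ i ∈ v.support, v i • Finsupp.single i (1 : ℂ) := by
    conv_lhs => rw [← Finsupp.sum_single v]
    simp [Finsupp.sum]
  have key : ⟪A v, A v⟫_ℂ = ⟪B v, B v⟫_ℂ := by
    rw [hv]
    simp only [map_sum, map_smul, sum_inner, inner_sum, inner_smul_left, inner_smul_right, h]
  rw [inner_self_eq_norm_sq_to_K, inner_self_eq_norm_sq_to_K] at key
  have : ‖A v‖ ^ 2 = ‖B v‖ ^ 2 := by exact_mod_cast key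
  exact (sq_eq_sq₀ (norm_nonneg _) (norm_nonneg _)).1 this

/-! ### The trigonometric moment problem -/

theorem card_diagonal_le (a b N : ℕ) :
    ((Finset.range N ×ˢ Finset.range N).filter fun x : ℕ × ℕ => a + x.2 = b + x.1).card ≤ N := by
  conv_rhs => rw [← Finset.card_range N]
  refine Finset.card_le_card_of_injOn Prod.fst ?_ ?_
  · intro x hx
    simp only [Finset.coe_filter, Finset.mem_product, Set.mem_ofPred_eq] at hx
    exact hx.1.1
  · intro x hx y hy h
    simp only [Finset.coe_filter, Set.mem_ofPred_eq] at hx hy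
    exact Prod.ext h (by have := hx.2; have := hy.2; omega)

theorem le_card_diagonal (a b N : ℕ) :
    N ≤ ((Finset.range N ×ˢ Finset.range N).filter
      fun x : ℕ × ℕ => a + x.2 = b + x.1).card + (a + b) := by
  have h : (Finset.range (N - (a + b))).card ≤ ((Finset.range N ×ˢ Finset.range N).filter
      fun x : ℕ × ℕ => a + x.2 = b + x.1).card := by
    refine Finset.card_le_card_of_injOn (fun t => (a + t, b + t)) ?_ ?_
    · intro t ht
      simp only [Finset.coe_range, Set.mem_Iio] at ht
      simp only [Finset.coe_filter, Finset.mem_product, Finset.mem_range, Set.mem_ofPred_eq]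
      omega
    · intro s _ t _ h
      simpa using h
  rw [Finset.card_range] at h
  omega

/-- The weights of the Fejér means of a Toeplitz matrix tend to `1`. -/
theorem tendsto_card_diagonal (a b : ℕ) :
    Tendsto (fun N : ℕ => (((Finset.range N ×ˢ Finset.range N).filter
      fun x : ℕ × ℕ => a + x.2 = b + x.1).card : ℝ) / N) atTop (𝓝 1) := by
  have h1 : Tendsto (fun N : ℕ => 1 - ((a + b : ℕ) : ℝ) / N) atTop (𝓝 (1 - 0)) :=
    tendsto_const_nhds.sub (tendsto_const_nhds.div_atTop tendsto_natCast_atTop_atTop)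
  rw [sub_zero] at h1
  refine tendsto_of_tendsto_of_tendsto_of_le_of_le' h1 tendsto_const_nhds ?_ ?_
  · filter_upwards [eventually_gt_atTop 0] with N hN
    have hN' : (0 : ℝ) < N := by exact_mod_cast hN
    have := le_card_diagonal a b N
    rw [sub_le_iff_le_add, ← add_div, one_le_div hN']
    exact_mod_cast this
  · filter_upwards [eventually_gt_atTop 0] with N hN
    have hN' : (0 : ℝ) < N := by exact_mod_cast hN
    rw [div_le_one hN']
    exact_mod_cast card_diagonal_le a b N

/-- The parametrization of the unit circle by `ℝ / 2πℤ`. -/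
def circleParam (x : AddCircle (2 * Real.pi)) : unitCirc :=
  ⟨AddCircle.toCircle x, by rw [mem_sphere_zero_iff_norm, Circle.norm_coe]⟩

theorem continuous_circleParam : Continuous circleParam :=
  Continuous.subtype_mk (continuous_subtype_val.comp AddCircle.continuous_toCircle) _

theorem integral_fourier (n : ℤ) :
    ∫ x : AddCircle (2 * Real.pi), fourier n x ∂AddCircle.haarAddCircle =
      if n = 0 then 1 else 0 := by
  have h := congrFun (fourierCoeff_fourier (T := 2 * Real.pi) n) 0
  rw [fourierCoeff] at h
  simp only [neg_zero, fourier_zero, one_smul] at h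
  rw [h]
  by_cases hn : n = 0
  · simp [hn]
  · rw [Pi.single_eq_of_ne (Ne.symm hn), if_neg hn]

/-- The Fejér means of a positive definite Toeplitz matrix are densities of measures on the circle,
whose moments are given explicitly. -/
theorem exists_fejer_measure {c : ℕ → ℕ → ℂ} (hT : ∀ m p, c (m + 1) (p + 1) = c m p)
    (hpos : ∀ (N : ℕ) (v : ℕ → ℂ), ∃ r : ℝ, 0 ≤ r ∧
      ∑ m ∈ Finset.range N, ∑ p ∈ Finset.range N, v m * conj (v p) * c m p = r) (N : ℕ) :
    ∃ σ : Measure unitCirc, IsFiniteMeasure σ ∧ ∀ a b : ℕ,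
      ∫ ξ : unitCirc, conj (ξ : ℂ) ^ b * (ξ : ℂ) ^ a ∂σ =
        (((((Finset.range N ×ˢ Finset.range N).filter
          fun x : ℕ × ℕ => a + x.2 = b + x.1).card : ℝ) / N : ℝ) : ℂ) * c a b := by
  have hT' : ∀ k m p, c (m + k) (p + k) = c m p := by
    intro k m p
    induction k with
    | zero => rfl
    | succ k ih => rw [← add_assoc, ← add_assoc, hT, ih]
  choose r hr0 hr using fun x : AddCircle (2 * Real.pi) => hpos N fun m => fourier (-(m : ℤ)) x
  have hform : ∀ x, (r x : ℂ) = ∑ y ∈ Finset.range N ×ˢ Finset.range N,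
      fourier (-(y.1 : ℤ) + y.2) x * c y.1 y.2 := by
    intro x
    rw [← hr, Finset.sum_product]
    refine Finset.sum_congr rfl fun m _ => Finset.sum_congr rfl fun p _ => ?_
    rw [← fourier_neg, neg_neg, ← fourier_add]
  have hcont : Continuous r := by
    have h1 : Continuous fun x => (r x : ℂ) := by
      simp only [hform]
      fun_prop
    simpa [Function.comp_def] using Complex.continuous_re.comp h1
  -- the density of the measure: the quadratic form at the vector `(ξ⁻ᵐ)`, divided by `N`
  set d : AddCircle (2 * Real.pi) → ℝ := fun x => r x / N with hd
  have hdc : Continuous d := hcont.div_const _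
  have hd0 : ∀ x, 0 ≤ d x := fun x => div_nonneg (hr0 x) (Nat.cast_nonneg _)
  have hdi : Integrable d AddCircle.haarAddCircle :=
    hdc.integrable_of_hasCompactSupport (HasCompactSupport.of_compactSpace d)
  set τ : Measure (AddCircle (2 * Real.pi)) :=
    AddCircle.haarAddCircle.withDensity fun x => ENNReal.ofReal (d x) with hτ
  have : IsFiniteMeasure τ := isFiniteMeasure_withDensity_ofReal hdi.2
  refine ⟨τ.map circleParam, inferInstance, fun a b => ?_⟩
  rw [integral_map continuous_circleParam.aemeasurable (by
    exact (by fun_prop : Continuous fun ξ : unitCirc =>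
      conj (ξ : ℂ) ^ b * (ξ : ℂ) ^ a).aestronglyMeasurable), hτ,
    integral_withDensity_eq_integral_toReal_smul (f := fun x => ENNReal.ofReal (d x))
      (ENNReal.measurable_ofReal.comp hdc.measurable) (Eventually.of_forall fun x => by simp)]
  have e1 : ∀ x : AddCircle (2 * Real.pi), (ENNReal.ofReal (d x)).toReal •
      (conj (circleParam x : ℂ) ^ b * (circleParam x : ℂ) ^ a) =
      ∑ y ∈ Finset.range N ×ˢ Finset.range N,
        ((N : ℂ)⁻¹ * c y.1 y.2) * fourier ((a + y.2 : ℤ) - (b + y.1)) x := by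
    intro x
    have hpow : ∀ k : ℕ, (circleParam x : ℂ) ^ k = fourier (k : ℤ) x := by
      intro k
      rw [fourier_apply, natCast_zsmul, AddCircle.toCircle_nsmul]
      simp [circleParam]
    rw [ENNReal.toReal_ofReal (hd0 x), ← map_pow, hpow, hpow, ← fourier_neg, ← fourier_add,
      Complex.real_smul, hd, Complex.ofReal_div, hform, Complex.ofReal_natCast, div_eq_inv_mul,
      Finset.mul_sum, Finset.sum_mul]
    refine Finset.sum_congr rfl fun y _ => ?_
    have : fourier ((a + y.2 : ℤ) - (b + y.1)) x =
        fourier (-(y.1 : ℤ) + y.2) x * fourier (-(b : ℤ) + a) x := by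
      rw [← fourier_add, show (a + y.2 : ℤ) - (b + y.1) = -(y.1 : ℤ) + y.2 + (-(b : ℤ) + a) by ring]
    rw [this]
    ring
  simp only [e1]
  rw [integral_finsetSum _ fun y _ => by
    exact ((fourier _).continuous.integrable_of_hasCompactSupport
      (HasCompactSupport.of_compactSpace _)).const_mul _]
  simp only [integral_const_mul, integral_fourier]
  have e2 : ∀ y ∈ Finset.range N ×ˢ Finset.range N,
      ((N : ℂ)⁻¹ * c y.1 y.2) * (if (a + y.2 : ℤ) - (b + y.1) = 0 then (1 : ℂ) else 0) =
      if a + y.2 = b + y.1 then (N : ℂ)⁻¹ * c a b else 0 := by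
    intro y _
    by_cases h : a + y.2 = b + y.1
    · rw [if_pos h, if_pos (by rw [sub_eq_zero]; exact_mod_cast h), mul_one, ← hT' b y.1 y.2,
        ← hT' y.2 a b]
      congr 2 <;> omega
    · rw [if_neg h, if_neg (by rw [sub_eq_zero]; exact_mod_cast h), mul_zero]
  rw [Finset.sum_congr rfl e2, ← Finset.sum_filter, Finset.sum_const, nsmul_eq_mul]
  push_cast
  ring

/-- The trigonometric moment problem: a positive definite Toeplitz matrix is the matrix of moments
of a measure. -/
theorem exists_measure_moment_eq {c : ℕ → ℕ → ℂ} (hT : ∀ m p, c (m + 1) (p + 1) = c m p)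
    (hpos : ∀ (N : ℕ) (v : ℕ → ℂ), ∃ r : ℝ, 0 ≤ r ∧
      ∑ m ∈ Finset.range N, ∑ p ∈ Finset.range N, v m * conj (v p) * c m p = r) :
    ∃ μ : Measure unitCirc, IsFiniteMeasure μ ∧ ∀ m p, moment μ m p = c m p := by
  obtain ⟨s, hs0, hs⟩ : ∃ s : ℝ, 0 ≤ s ∧ c 0 0 = s := by
    obtain ⟨s, h0, h⟩ := hpos 1 fun _ => 1
    exact ⟨s, h0, by simpa using h⟩
  choose σ hσf hσ using exists_fejer_measure hT hpos
  have hlim : ∀ a b, Tendsto (fun N => ∫ ξ : unitCirc, conj (ξ : ℂ) ^ b * (ξ : ℂ) ^ a ∂σ N) atTop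
      (𝓝 (c a b)) := by
    intro a b
    simp only [hσ]
    have := ((Complex.continuous_ofReal.tendsto 1).comp (tendsto_card_diagonal a b)).mul_const
      (c a b)
    simpa [Function.comp_def] using this
  have hmass : ∀ N, N ≠ 0 → (σ N).real Set.univ = s := by
    intro N hN
    have h1 := hσ N 0 0
    have h2 : ((Finset.range N ×ˢ Finset.range N).filter
        fun x : ℕ × ℕ => 0 + x.2 = 0 + x.1).card = N :=
      le_antisymm (card_diagonal_le 0 0 N) (by simpa using le_card_diagonal 0 0 N)
    rw [h2, hs, div_self (by exact_mod_cast hN)] at h1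
    simp only [pow_zero, mul_one, integral_const, Complex.ofReal_one, one_mul] at h1
    rw [Complex.real_smul, mul_one] at h1
    exact_mod_cast h1
  rcases hs0.eq_or_lt with h0 | hspos
  · refine ⟨0, inferInstance, fun m p => ?_⟩
    have hz : ∀ᶠ N in atTop, ∫ ξ : unitCirc, conj (ξ : ℂ) ^ p * (ξ : ℂ) ^ m ∂σ N = 0 := by
      filter_upwards [eventually_ne_atTop 0] with N hN
      have h1 := hmass N hN
      rw [← h0, measureReal_eq_zero_iff, Measure.measure_univ_eq_zero] at h1
      rw [h1, integral_zero_measure]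
    have := tendsto_nhds_unique (hlim m p)
      (tendsto_const_nhds.congr' (hz.mono fun _ h => h.symm))
    simp [moment, this]
  -- normalized to mass one, the measures have a limit point by compactness
  have hprob : ∀ N, IsProbabilityMeasure (ENNReal.ofReal s⁻¹ • σ (N + 1)) := by
    intro N
    refine ⟨?_⟩
    rw [Measure.smul_apply, smul_eq_mul, ← ofReal_measureReal, hmass _ (Nat.succ_ne_zero N),
      ← ENNReal.ofReal_mul (by positivity), inv_mul_cancel₀ hspos.ne', ENNReal.ofReal_one]
  set P : ℕ → ProbabilityMeasure unitCirc := fun N => ⟨_, hprob N⟩ with hP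
  obtain ⟨Q, -, hQ⟩ := isCompact_univ.ultrafilter_le_nhds ((hyperfilter ℕ).map P) (by simp)
  have hQ' : Tendsto P (hyperfilter ℕ) (𝓝 Q) := hQ
  rw [ProbabilityMeasure.tendsto_iff_forall_integral_rclike_tendsto ℂ] at hQ'
  refine ⟨ENNReal.ofReal (2 * Real.pi * s) • (Q : Measure unitCirc),
    Measure.smul_finite _ ENNReal.ofReal_ne_top, fun m p => ?_⟩
  have h1 := hQ' (BoundedContinuousFunction.mkOfCompact
    ⟨fun ξ : unitCirc => conj (ξ : ℂ) ^ p * (ξ : ℂ) ^ m, by fun_prop⟩)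
  have h2 : Tendsto (fun N => ∫ ξ : unitCirc, conj (ξ : ℂ) ^ p * (ξ : ℂ) ^ m
      ∂(P N : Measure unitCirc)) (hyperfilter ℕ) (𝓝 ((s⁻¹ : ℝ) • c m p)) := by
    have h3 := (((hlim m p).comp (tendsto_add_atTop_nat 1)).const_smul (s⁻¹ : ℝ)).mono_left
      (Nat.hyperfilter_le_atTop)
    refine h3.congr fun N => ?_
    change _ = ∫ ξ : unitCirc, _ ∂(ENNReal.ofReal s⁻¹ • σ (N + 1))
    rw [integral_smul_measure, ENNReal.toReal_ofReal (by positivity)]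
    rfl
  have h4 := tendsto_nhds_unique h1 h2
  simp only [BoundedContinuousFunction.mkOfCompact_apply, ContinuousMap.coe_mk] at h4
  rw [moment, integral_smul_measure, h4, ENNReal.toReal_ofReal (by positivity), smul_smul,
    Complex.real_smul]
  have hpi : (Real.pi : ℂ) ≠ 0 := by exact_mod_cast Real.pi_ne_zero
  have hs' : (s : ℂ) ≠ 0 := by exact_mod_cast hspos.ne'
  push_cast
  field_simp

/-! ### Double power series -/

/-- `F` is the sum of the double power series with coefficients `a` on the bidisc. -/
def HasTaylor (a : ℕ × ℕ → ℂ) (F : ℂ × ℂ → ℂ) : Prop :=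
  ∀ z ∈ Metric.ball (0 : ℂ) 1, ∀ w ∈ Metric.ball (0 : ℂ) 1,
    HasSum (fun x : ℕ × ℕ => a x * (z ^ x.1 * w ^ x.2)) (F (z, w))

/-- The coefficient of `wⁿ` in a double power series, as a function of `z`. -/
def colSum (a : ℕ × ℕ → ℂ) (n : ℕ) (z : ℂ) : ℂ := ∑' m, a (m, n) * z ^ m

namespace HasTaylor

variable {a : ℕ × ℕ → ℂ} {F : ℂ × ℂ → ℂ}

theorem swap (h : HasTaylor a F) : HasTaylor (a ∘ Prod.swap) (F ∘ Prod.swap) := by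
  intro z hz w hw
  have h1 := (Equiv.prodComm ℕ ℕ).hasSum_iff.2 (h w hw z hz)
  change HasSum _ (F (w, z))
  convert! h1 using 2 with x
  simp [mul_comm]

theorem hasSum_colSum (h : HasTaylor a F) (n : ℕ) :
    ∀ z ∈ Metric.ball (0 : ℂ) 1, HasSum (fun m => a (m, n) * z ^ m) (colSum a n z) := by
  intro z hz
  refine Summable.hasSum ?_
  have h1 := (h z hz (1 / 2) (by simp; norm_num)).summable
  have h2 : Summable fun m : ℕ => a (m, n) * (z ^ m * (1 / 2) ^ n) :=
    h1.comp_injective (i := fun m : ℕ => (m, n)) fun m m' hm => by simpa using hm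
  have h3 := h2.mul_right (2 ^ n)
  refine h3.congr fun m => ?_
  rw [mul_assoc, mul_assoc, ← mul_pow]
  norm_num

theorem hasSum_colSum_mul (h : HasTaylor a F) {z : ℂ} (hz : z ∈ Metric.ball (0 : ℂ) 1) :
    ∀ w ∈ Metric.ball (0 : ℂ) 1, HasSum (fun n => colSum a n z * w ^ n) (F (z, w)) := by
  intro w hw
  have h1 := (Equiv.prodComm ℕ ℕ).hasSum_iff.2 (h z hz w hw)
  refine h1.prod_fiberwise fun n => ?_
  have h2 := (h.hasSum_colSum n z hz).mul_right (w ^ n)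
  convert! h2 using 2 with m
  simp [mul_assoc]

theorem partial₁ (h : HasTaylor a F) :
    HasTaylor (fun x => (x.1 + 1 : ℂ) * a (x.1 + 1, x.2)) (partial₁ F) := by
  intro z hz w hw
  have hz' : ‖z‖ < 1 := by simpa using hz
  obtain ⟨r, hzr, hr1⟩ := exists_between hz'
  have hr : 0 ≤ r := (norm_nonneg z).trans hzr.le
  have hu : Summable fun x : ℕ × ℕ => ‖a x‖ * (r ^ x.1 * ‖w‖ ^ x.2) := by
    have := (h r (by simpa [abs_of_nonneg hr] using hr1) w hw).summable.norm
    simpa [abs_of_nonneg hr] using this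
  have h1 := Complex.hasSum_deriv_of_summable_norm (U := Metric.ball (0 : ℂ) r)
    (F := fun (x : ℕ × ℕ) (y : ℂ) => a x * (y ^ x.1 * w ^ x.2)) hu
    (fun x => by fun_prop) Metric.isOpen_ball (fun x y hy => by
      rw [mem_ball_zero_iff] at hy
      rw [norm_mul, norm_mul, norm_pow, norm_pow]
      gcongr) (show z ∈ Metric.ball (0 : ℂ) r by simpa using hzr)
  have h2 : deriv (fun y => ∑' x : ℕ × ℕ, a x * (y ^ x.1 * w ^ x.2)) z =
      BidiscDirichlet.partial₁ F (z, w) := by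
    refine Filter.EventuallyEq.deriv_eq ?_
    filter_upwards [Metric.isOpen_ball.mem_nhds hz] with y hy
    exact (h y hy w hw).tsum_eq
  have h3 : ∀ x : ℕ × ℕ, deriv (fun y : ℂ => a x * (y ^ x.1 * w ^ x.2)) z =
      a x * (x.1 * z ^ (x.1 - 1) * w ^ x.2) := by
    intro x
    exact (((hasDerivAt_pow x.1 z).mul_const (w ^ x.2)).const_mul (a x)).deriv
  rw [h2] at h1
  simp only [h3] at h1
  have hinj : Function.Injective fun x : ℕ × ℕ => (x.1 + 1, x.2) := by
    intro x y hxy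
    simp only [Prod.mk.injEq, Nat.add_right_cancel_iff] at hxy
    exact Prod.ext hxy.1 hxy.2
  rw [← hinj.hasSum_iff] at h1
  · convert! h1 using 2 with x
    simp only [Function.comp_apply, Nat.add_sub_cancel]
    push_cast
    ring
  · rintro ⟨m, n⟩ hx
    have : m = 0 := by
      by_contra hm
      exact hx ⟨(m - 1, n), by simp; omega⟩
    simp [this]

theorem partial₂ (h : HasTaylor a F) :
    HasTaylor (fun x => (x.2 + 1 : ℂ) * a (x.1, x.2 + 1)) (partial₂ F) :=
  h.swap.partial₁.swap

end HasTaylor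

/-! ### The norm in terms of Taylor coefficients -/

theorem circleMean_congr {r : ℝ} (hr : 0 ≤ r) {g h : ℂ → ℝ≥0∞} (H : ∀ z, ‖z‖ = r → g z = h z) :
    circleMean r g = circleMean r h := by
  rw [circleMean_eq_haar, circleMean_eq_haar]
  refine lintegral_congr fun x => H _ ?_
  rw [norm_mul, Circle.norm_coe, Complex.norm_real, Real.norm_of_nonneg hr, mul_one]

theorem measurable_circle_of_continuousOn {r : ℝ} (hr : 0 ≤ r) (hr1 : r < 1) {F : ℂ → ℂ}
    (hF : ContinuousOn F (Metric.ball (0 : ℂ) 1)) :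
    Measurable fun x : AddCircle (2 * Real.pi) => F (r * AddCircle.toCircle x) := by
  refine (hF.comp_continuous (f := fun x : AddCircle (2 * Real.pi) =>
    (r : ℂ) * (AddCircle.toCircle x : ℂ)) ?_ fun x => ?_).measurable
  · exact continuous_const.mul (continuous_subtype_val.comp AddCircle.continuous_toCircle)
  · rw [mem_ball_zero_iff, norm_mul, Circle.norm_coe, Complex.norm_real, Real.norm_of_nonneg hr,
      mul_one]
    exact hr1

theorem circleMean_mul_const {r : ℝ} (hr : 0 ≤ r) (hr1 : r < 1) {F : ℂ → ℂ}
    (hF : ContinuousOn F (Metric.ball (0 : ℂ) 1)) (p : ℝ≥0∞) :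
    circleMean r (fun z => ‖F z‖ₑ ^ 2 * p) = circleMean r (fun z => ‖F z‖ₑ ^ 2) * p := by
  rw [circleMean_eq_haar, circleMean_eq_haar,
    lintegral_mul_const _ ((measurable_circle_of_continuousOn hr hr1 hF).enorm.pow_const 2)]

/-- Parseval's identity in the second variable. -/
theorem HasTaylor.circleMean_snd {a : ℕ × ℕ → ℂ} {F : ℂ × ℂ → ℂ} (h : HasTaylor a F) {z : ℂ}
    (hz : z ∈ Metric.ball (0 : ℂ) 1) {r : ℝ} (hr : 0 ≤ r) (hr1 : r < 1) :
    circleMean r (fun w => ‖F (z, w)‖ₑ ^ 2) =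
      ∑' n, ‖colSum a n z‖ₑ ^ 2 * ENNReal.ofReal r ^ (2 * n) := by
  refine circleMean_sq_of_hasSum hr (summable_norm_mul_pow (h.hasSum_colSum_mul hz) hr hr1)
    fun w hw => h.hasSum_colSum_mul hz w ?_
  rw [mem_ball_zero_iff, hw]
  exact hr1

/-- Monotone convergence of a power series with nonnegative coefficients at the radius `1`. -/
theorem tendsto_tsum_mul_ofReal_pow {ι : Type*} (c : ι → ℝ≥0∞) (k : ι → ℕ) :
    Tendsto (fun r : ℝ => ∑' i, c i * ENNReal.ofReal r ^ k i) (𝓝[<] 1) (𝓝 (∑' i, c i)) := by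
  have hle : ∀ r : ℝ, r < 1 → ∑' i, c i * ENNReal.ofReal r ^ k i ≤ ∑' i, c i := by
    intro r hr
    refine ENNReal.tsum_le_tsum fun i => mul_le_of_le_one_right' ?_
    exact pow_le_one₀ zero_le (ENNReal.ofReal_le_one.2 hr.le)
  rw [tendsto_order]
  constructor
  · intro s hs
    rw [ENNReal.tsum_eq_iSup_sum, lt_iSup_iff] at hs
    obtain ⟨S, hS⟩ := hs
    have h1 : Tendsto (fun r : ℝ => ∑ i ∈ S, c i * ENNReal.ofReal r ^ k i) (𝓝[<] 1)
        (𝓝 (∑ i ∈ S, c i)) := by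
      refine tendsto_finsetSum _ fun i _ => ?_
      have h2 : Tendsto (fun r : ℝ => ENNReal.ofReal r ^ k i) (𝓝[<] 1) (𝓝 1) := by
        have := ((ENNReal.continuous_pow (k i)).comp ENNReal.continuous_ofReal).tendsto (1 : ℝ)
        simp only [Function.comp_apply, ENNReal.ofReal_one, one_pow] at this
        exact this.mono_left nhdsWithin_le_nhds
      simpa using ENNReal.Tendsto.const_mul h2 (Or.inl one_ne_zero) (a := c i)
    filter_upwards [h1.eventually (lt_mem_nhds hS)] with r hr
    exact hr.trans_le (ENNReal.sum_le_tsum S)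
  · intro s hs
    filter_upwards [self_mem_nhdsWithin] with r hr
    exact (hle r hr).trans_lt hs

theorem HasTaylor.circleMean_circleMean {a : ℕ × ℕ → ℂ} {F : ℂ × ℂ → ℂ} (h : HasTaylor a F)
    {r : ℝ} (hr : 0 ≤ r) (hr1 : r < 1) :
    circleMean r (fun z => circleMean r fun w => ‖F (z, w)‖ₑ ^ 2) =
      ∑' x : ℕ × ℕ, ‖a x‖ₑ ^ 2 * ENNReal.ofReal r ^ (2 * x.1 + 2 * x.2) := by
  have hball : ∀ z : ℂ, ‖z‖ = r → z ∈ Metric.ball (0 : ℂ) 1 := by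
    intro z hz; rw [mem_ball_zero_iff, hz]; exact hr1
  rw [circleMean_congr hr fun z hz => h.circleMean_snd (hball z hz) hr hr1, circleMean_eq_haar,
    lintegral_tsum]
  · rw [ENNReal.tsum_prod', ENNReal.tsum_comm]
    refine tsum_congr fun n => ?_
    have hc := h.hasSum_colSum n
    rw [← circleMean_eq_haar r fun z => ‖colSum a n z‖ₑ ^ 2 * ENNReal.ofReal r ^ (2 * n),
      circleMean_mul_const hr hr1 (differentiableOn_of_hasSum hc).continuousOn,
      circleMean_sq_of_hasSum hr (summable_norm_mul_pow hc hr hr1) fun z hz => hc z (hball z hz),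
      ← ENNReal.tsum_mul_right]
    refine tsum_congr fun m => ?_
    rw [pow_add, mul_assoc]
  · intro n
    exact (((measurable_circle_of_continuousOn hr hr1 (differentiableOn_of_hasSum
      (h.hasSum_colSum n)).continuousOn).enorm.pow_const 2).mul_const _).aemeasurable

theorem HasTaylor.hardyNormSq_eq {a : ℕ × ℕ → ℂ} {f : bidisc → ℂ}
    (h : HasTaylor a (extendZero f)) : hardyNormSq f = ∑' x, ‖a x‖ₑ ^ 2 := by
  have h1 := tendsto_tsum_mul_ofReal_pow (fun x : ℕ × ℕ => ‖a x‖ₑ ^ 2) fun x => 2 * x.1 + 2 * x.2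
  rw [hardyNormSq]
  refine le_antisymm (iSup₂_le fun r hr => ?_) (le_of_tendsto h1 ?_)
  · rw [h.circleMean_circleMean hr.1.le hr.2]
    refine ENNReal.tsum_le_tsum fun x => mul_le_of_le_one_right' ?_
    exact pow_le_one₀ zero_le (ENNReal.ofReal_le_one.2 hr.2.le)
  · filter_upwards [Ioo_mem_nhdsLT zero_lt_one] with r hr
    rw [← h.circleMean_circleMean hr.1.le hr.2]
    exact le_iSup₂ (f := fun (r : ℝ) (_ : r ∈ Set.Ioo (0 : ℝ) 1) =>
      circleMean r fun z₁ => circleMean r fun z₂ => ‖extendZero f (z₁, z₂)‖ₑ ^ 2) r hr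

/-- The Dirichlet integral of a function with Taylor coefficients `b`, in terms of its
derivative. -/
theorem lintegral_deriv_mul_poissonIntegral (μ : Measure unitCirc) [SFinite μ] {b : ℕ → ℂ}
    {G : ℂ → ℂ}
    (hG : ∀ z ∈ Metric.ball (0 : ℂ) 1,
      HasSum (fun n : ℕ => ((n + 1 : ℂ) * b (n + 1)) * z ^ n) (G z)) :
    ∫⁻ z, ‖G z‖ₑ ^ 2 * poissonIntegral μ z ∂discArea = ∫⁻ ω, ‖ev ω b‖ₑ ^ 2 ∂dirMeasure μ := by
  rw [lintegral_mul_poissonIntegral μ hG,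
    lintegral_dirMeasure μ ((measurable_ev b).enorm.pow_const 2)]
  simp only [enorm_sq_ev_inr]

/-- The Dirichlet integral in the first variable is the sum of the one-variable Dirichlet integrals
of the coefficients of `wⁿ`; the limit in the radius is a monotone one. -/
theorem HasTaylor.limsup_dirichlet (μ : Measure unitCirc) [SFinite μ] {a : ℕ × ℕ → ℂ}
    {F : ℂ × ℂ → ℂ} (h : HasTaylor a F) :
    limsup (fun r : ℝ => ∫⁻ z, circleMean r (fun w =>
      ‖BidiscDirichlet.partial₁ F (z, w)‖ₑ ^ 2 * poissonIntegral μ z) ∂discArea) (𝓝[<] 1) =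
      ∑' n, ∫⁻ ω, ‖ev ω fun m => a (m, n)‖ₑ ^ 2 ∂dirMeasure μ := by
  refine Tendsto.limsup_eq ?_
  refine (tendsto_tsum_mul_ofReal_pow _ fun n => 2 * n).congr' ?_
  filter_upwards [Ioo_mem_nhdsLT zero_lt_one] with r hr
  have hd := h.partial₁
  have h1 : ∀ z ∈ Metric.ball (0 : ℂ) 1, circleMean r (fun w =>
      ‖BidiscDirichlet.partial₁ F (z, w)‖ₑ ^ 2 * poissonIntegral μ z) =
      ∑' n, ‖colSum (fun x : ℕ × ℕ => (x.1 + 1 : ℂ) * a (x.1 + 1, x.2)) n z‖ₑ ^ 2 *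
        poissonIntegral μ z * ENNReal.ofReal r ^ (2 * n) := by
    intro z hz
    rw [circleMean_mul_const (F := fun w => BidiscDirichlet.partial₁ F (z, w)) hr.1.le hr.2
      (differentiableOn_of_hasSum (hd.hasSum_colSum_mul hz)).continuousOn,
      hd.circleMean_snd hz hr.1.le hr.2, ← ENNReal.tsum_mul_right]
    exact tsum_congr fun n => by ring
  rw [lintegral_discArea_congr h1, lintegral_tsum]
  · refine tsum_congr fun n => ?_
    rw [lintegral_mul_const' _ _ (by simp),
      lintegral_deriv_mul_poissonIntegral μ (b := fun m => a (m, n)) (hd.hasSum_colSum n)]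
  · intro n
    exact (((aemeasurable_discArea_of_continuousOn (differentiableOn_of_hasSum
      (hd.hasSum_colSum n)).continuousOn).enorm.pow_const 2).mul
      (measurable_poissonIntegral μ).aemeasurable).mul_const _

theorem hasSum_ev {ι : Type*} {u : ℕ → ι → ℂ} {s : ℕ → ℂ} (h : ∀ n, HasSum (u n) (s n))
    (ω : EvalSpace) : HasSum (fun i => ev ω fun n => u n i) (ev ω s) :=
  hasSum_sum fun n _ => (h n).mul_left _

/-- The one-variable formula is applied in `w` for fixed `z`, and then in `z` for every functional
`ev ω₂`, which is a finite combination of the coefficients in `w`. -/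
theorem HasTaylor.dirichlet_mixed (μ₁ μ₂ : Measure unitCirc) [SFinite μ₁] [SFinite μ₂]
    {a : ℕ × ℕ → ℂ} {F : ℂ × ℂ → ℂ} (h : HasTaylor a F) :
    ∫⁻ z, ∫⁻ w, ‖BidiscDirichlet.partial₁ (BidiscDirichlet.partial₂ F) (z, w)‖ₑ ^ 2 *
      (poissonIntegral μ₁ z * poissonIntegral μ₂ w) ∂discArea ∂discArea =
      ∫⁻ ω₂, ∫⁻ ω₁, ‖ev₂ a (ω₁, ω₂)‖ₑ ^ 2 ∂dirMeasure μ₁ ∂dirMeasure μ₂ := by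
  -- the coefficients of `∂₁ F`
  set b : ℕ × ℕ → ℂ := fun x => (x.1 + 1 : ℂ) * a (x.1 + 1, x.2) with hb
  have hcol : ∀ n, ∀ z ∈ Metric.ball (0 : ℂ) 1,
      HasSum (fun m => b (m, n) * z ^ m) (colSum b n z) := h.partial₁.hasSum_colSum
  have hd := h.partial₂.partial₁
  have h1 : ∀ z ∈ Metric.ball (0 : ℂ) 1,
      ∫⁻ w, ‖BidiscDirichlet.partial₁ (BidiscDirichlet.partial₂ F) (z, w)‖ₑ ^ 2 *
        (poissonIntegral μ₁ z * poissonIntegral μ₂ w) ∂discArea =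
      ∫⁻ ω₂, ‖ev ω₂ fun n => colSum b n z‖ₑ ^ 2 * poissonIntegral μ₁ z ∂dirMeasure μ₂ := by
    intro z hz
    have hs := hd.hasSum_colSum_mul hz
    have h2 := lintegral_deriv_mul_poissonIntegral μ₂ (b := fun n => colSum b n z)
      (G := fun w => BidiscDirichlet.partial₁ (BidiscDirichlet.partial₂ F) (z, w)) (by
        intro w hw
        convert! hs w hw using 2 with n
        congr 1
        rw [colSum, colSum, ← tsum_mul_left]
        exact tsum_congr fun m => by simp only [hb]; ring)
    have hmw : AEMeasurable (fun w =>
        ‖BidiscDirichlet.partial₁ (BidiscDirichlet.partial₂ F) (z, w)‖ₑ ^ 2 *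
          poissonIntegral μ₂ w) discArea :=
      ((aemeasurable_discArea_of_continuousOn
        (differentiableOn_of_hasSum hs).continuousOn).enorm.pow_const 2).mul
        (measurable_poissonIntegral μ₂).aemeasurable
    rw [lintegral_mul_const _ ((measurable_ev fun n => colSum b n z).enorm.pow_const 2), ← h2,
      ← lintegral_mul_const'' _ hmw]
    exact lintegral_congr fun w => by ring
  rw [lintegral_discArea_congr h1, lintegral_lintegral_swap]
  · refine lintegral_congr fun ω₂ => ?_
    refine lintegral_deriv_mul_poissonIntegral μ₁ (b := fun m => ev ω₂ fun n => a (m, n))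
      fun z hz => ?_
    convert! hasSum_ev (fun n => hcol n z hz) ω₂ using 2 with m
    rw [← ev_const_mul, mul_comm, ← ev_const_mul]
    simp only [hb, mul_comm]
  · have hm : AEMeasurable (fun p : ℂ × EvalSpace => ev p.2 fun n => colSum b n p.1)
        (discArea.prod (dirMeasure μ₂)) := by
      refine aemeasurable_of_tendsto_metrizable_ae atTop
        (f := fun K p => ∑ n ∈ Finset.range K, ell p.2 n * colSum b n p.1) (fun K => ?_) ?_
      · refine Finset.aemeasurable_fun_sum _ fun n _ => ?_
        exact ((measurable_ell n).comp measurable_snd).aemeasurable.mul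
          (aemeasurable_discArea_of_continuousOn
            (differentiableOn_of_hasSum (hcol n)).continuousOn).comp_fst
      · refine Eventually.of_forall fun p => tendsto_const_nhds.congr' ?_
        filter_upwards [eventually_ge_atTop (evalDeg p.2)] with K hK
        exact ev_eq_sum_range hK _
    exact (hm.enorm.pow_const 2).mul
      ((measurable_poissonIntegral μ₁).comp measurable_fst).aemeasurable

/-- The norm of the Dirichlet-type space is the `L²` norm of the coefficient functionals. -/
theorem HasTaylor.dirichletNormSq_eq (μ₁ μ₂ : Measure unitCirc) [SFinite μ₁] [SFinite μ₂]
    {a : ℕ × ℕ → ℂ} {f : bidisc → ℂ} (h : HasTaylor a (extendZero f)) :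
    dirichletNormSq μ₁ μ₂ f = coefNorm μ₁ μ₂ a := by
  have hm : Measurable fun p => ‖ev₂ a p‖ₑ ^ 2 := (measurable_ev₂ a).enorm.pow_const 2
  have e1 : dirichletIntegral₁ μ₁ f =
      ∫⁻ p, ‖ev₂ a p‖ₑ ^ 2 ∂(dirMeasure μ₁).prod hardyMeasure := by
    rw [dirichletIntegral₁, h.limsup_dirichlet μ₁, lintegral_prod_symm _ hm.aemeasurable,
      lintegral_hardyMeasure hm.lintegral_prod_left']
    simp only [ev₂, ev_inl]
  have e2 : dirichletIntegral₂ μ₂ f =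
      ∫⁻ p, ‖ev₂ a p‖ₑ ^ 2 ∂hardyMeasure.prod (dirMeasure μ₂) := by
    rw [lintegral_prod _ hm.aemeasurable, lintegral_hardyMeasure hm.lintegral_prod_right']
    simp only [ev₂, ev_inl]
    exact h.swap.limsup_dirichlet μ₂
  have e3 : dirichletIntegral₃ μ₁ μ₂ f =
      ∫⁻ p, ‖ev₂ a p‖ₑ ^ 2 ∂(dirMeasure μ₁).prod (dirMeasure μ₂) := by
    rw [dirichletIntegral₃, h.dirichlet_mixed μ₁ μ₂, lintegral_prod_symm _ hm.aemeasurable]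
  have e0 : hardyNormSq f = ∫⁻ p, ‖ev₂ a p‖ₑ ^ 2 ∂hardyMeasure.prod hardyMeasure := by
    rw [h.hardyNormSq_eq, lintegral_prod _ hm.aemeasurable,
      lintegral_hardyMeasure hm.lintegral_prod_right', ENNReal.tsum_prod']
    refine tsum_congr fun m => ?_
    rw [lintegral_hardyMeasure (F := fun y => ‖ev₂ a (Sum.inl m, y)‖ₑ ^ 2)
      (hm.comp measurable_prodMk_left)]
    simp only [ev₂, ev_inl]
  rw [dirichletNormSq, e0, e1, e2, e3, coefNorm, evalMeasure, evalMeasure, Measure.prod_add,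
    Measure.add_prod, Measure.add_prod, lintegral_add_measure, lintegral_add_measure,
    lintegral_add_measure]
  ring

/-! ### Taylor series of holomorphic functions on the bidisc -/

/-- The Taylor coefficients at the origin. -/
def taylorCoef (f : ℂ → ℂ) (n : ℕ) : ℂ := (n.factorial : ℂ)⁻¹ * iteratedDeriv n f 0

theorem hasSum_taylorCoef {f : ℂ → ℂ} (hf : DifferentiableOn ℂ f (Metric.ball 0 1)) :
    ∀ z ∈ Metric.ball (0 : ℂ) 1, HasSum (fun n => taylorCoef f n * z ^ n) (f z) := by
  intro z hz
  have h := Complex.hasSum_taylorSeries_on_ball hf hz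
  convert! h using 2 with n
  simp only [taylorCoef, sub_zero, smul_eq_mul]
  ring

theorem norm_taylorCoef_le {f : ℂ → ℂ} (hf : DifferentiableOn ℂ f (Metric.ball 0 1)) {r C : ℝ}
    (hr : 0 < r) (hr1 : r < 1) (hC : ∀ z ∈ Metric.sphere (0 : ℂ) r, ‖f z‖ ≤ C) (n : ℕ) :
    ‖taylorCoef f n‖ ≤ C / r ^ n := by
  have hd : DiffContOnCl ℂ f (Metric.ball 0 r) := by
    refine DifferentiableOn.diffContOnCl (hf.mono ?_)
    rw [closure_ball _ hr.ne']
    exact Metric.closedBall_subset_ball hr1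
  have h := Complex.norm_iteratedDeriv_le_of_forall_mem_sphere_norm_le n hr hd hC
  rw [taylorCoef, norm_mul, norm_inv, Complex.norm_natCast, inv_mul_le_iff₀ (by positivity)]
  exact h.trans_eq (by ring)

theorem differentiableOn_section {F : ℂ × ℂ → ℂ} (hF : DifferentiableOn ℂ F bidisc)
    {z : ℂ} (hz : z ∈ Metric.ball (0 : ℂ) 1) :
    DifferentiableOn ℂ (fun w => F (z, w)) (Metric.ball 0 1) :=
  hF.comp (by fun_prop) fun w hw => ⟨hz, hw⟩

theorem exists_bound_bidisc {F : ℂ × ℂ → ℂ} (hF : DifferentiableOn ℂ F bidisc)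
    {r : ℝ} (hr1 : r < 1) :
    ∃ C, 0 ≤ C ∧ ∀ z ∈ Metric.closedBall (0 : ℂ) r, ∀ w ∈ Metric.closedBall (0 : ℂ) r,
      ‖F (z, w)‖ ≤ C := by
  have hK : IsCompact (Metric.closedBall (0 : ℂ) r ×ˢ Metric.closedBall (0 : ℂ) r) :=
    (isCompact_closedBall _ _).prod (isCompact_closedBall _ _)
  obtain ⟨C, hC⟩ := hK.exists_bound_of_continuousOn (hF.continuousOn.mono
    (Set.prod_mono (Metric.closedBall_subset_ball hr1) (Metric.closedBall_subset_ball hr1)))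
  exact ⟨max C 0, le_max_right _ _, fun z hz w hw => (hC (z, w) ⟨hz, hw⟩).trans (le_max_left _ _)⟩

theorem exists_bound_taylorCoef_section {F : ℂ × ℂ → ℂ} (hF : DifferentiableOn ℂ F bidisc)
    {r : ℝ} (hr : 0 < r) (hr1 : r < 1) :
    ∃ C, 0 ≤ C ∧ ∀ z ∈ Metric.closedBall (0 : ℂ) r, ∀ n,
      ‖taylorCoef (fun w => F (z, w)) n‖ ≤ C / r ^ n := by
  obtain ⟨C, hC0, hC⟩ := exists_bound_bidisc hF hr1
  refine ⟨C, hC0, fun z hz n => ?_⟩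
  exact norm_taylorCoef_le
    (differentiableOn_section hF (Metric.closedBall_subset_ball hr1 hz)) hr hr1
    (fun w hw => hC z hz w (Metric.sphere_subset_closedBall hw)) n

/-- The Taylor coefficients with respect to `w` depend holomorphically on `z`: the `k`-th one is
the locally uniform limit of `(F(z, w) - ∑_{j < k} c_j(z) wʲ) / wᵏ` as `w → 0`. -/
theorem differentiableOn_taylorCoef_section {F : ℂ × ℂ → ℂ} (hF : DifferentiableOn ℂ F bidisc)
    (k : ℕ) :
    DifferentiableOn ℂ (fun z => taylorCoef (fun w => F (z, w)) k) (Metric.ball 0 1) := by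
  induction k using Nat.strong_induction_on with
  | _ k ih =>
  set c : ℕ → ℂ → ℂ := fun n z => taylorCoef (fun w => F (z, w)) n with hc
  intro z₀ hz₀
  obtain ⟨r, hr₀, hr1⟩ := exists_between (mem_ball_zero_iff.1 hz₀)
  have hr : 0 < r := (norm_nonneg z₀).trans_lt hr₀
  obtain ⟨C, hC0, hC⟩ := exists_bound_taylorCoef_section hF hr hr1
  have hsub : Metric.ball (0 : ℂ) r ⊆ Metric.ball 0 1 := Metric.ball_subset_ball hr1.le
  set q : ℕ → ℝ := fun N => (1 / 2) * (1 / ((N : ℝ) + 1)) with hq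
  have hq0 : ∀ N, 0 < q N := fun N => by positivity
  have hq1 : ∀ N, q N ≤ 1 / 2 := fun N => by
    have : 1 / ((N : ℝ) + 1) ≤ 1 := by
      rw [div_le_one (by positivity)]; linarith [(Nat.cast_nonneg N : (0 : ℝ) ≤ N)]
    simp only [hq]; linarith
  have hqlim : Tendsto q atTop (𝓝 0) := by
    have := tendsto_one_div_add_atTop_nhds_zero_nat (𝕜 := ℝ) |>.const_mul (1 / 2)
    simpa [hq] using this
  set w : ℕ → ℂ := fun N => ((r * q N : ℝ) : ℂ) with hw
  have hwn : ∀ N, ‖w N‖ = r * q N := fun N => by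
    rw [hw, Complex.norm_real, Real.norm_of_nonneg (mul_pos hr (hq0 N)).le]
  have hw0 : ∀ N, w N ≠ 0 := fun N => by
    rw [← norm_pos_iff, hwn]; exact mul_pos hr (hq0 N)
  have hwb : ∀ N, w N ∈ Metric.ball (0 : ℂ) 1 := fun N => by
    rw [mem_ball_zero_iff, hwn]; nlinarith [hq1 N, hq0 N]
  set G : ℕ → ℂ → ℂ := fun N z =>
    (F (z, w N) - ∑ j ∈ Finset.range k, c j z * w N ^ j) / w N ^ k with hG
  have hGd : ∀ N, DifferentiableOn ℂ (G N) (Metric.ball 0 r) := by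
    intro N
    refine DifferentiableOn.div_const (DifferentiableOn.sub ?_ ?_) _
    · exact hF.comp (by fun_prop) fun z hz => ⟨hsub hz, hwb N⟩
    · refine DifferentiableOn.fun_sum fun j hj => ?_
      exact ((ih j (Finset.mem_range.1 hj)).mono hsub).mul_const _
  have hbound : ∀ N, ∀ z ∈ Metric.ball (0 : ℂ) r, ‖c k z - G N z‖ ≤ 2 * (C / r ^ k) * q N := by
    intro N z hz
    have hz1 : z ∈ Metric.closedBall (0 : ℂ) r := Metric.ball_subset_closedBall hz
    have h1 := hasSum_taylorCoef (differentiableOn_section hF (hsub hz)) (w N) (hwb N)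
    have h2 := ((hasSum_nat_add_iff' (k + 1)).2 h1).div_const (w N ^ k)
    have h3 : G N z - c k z = (F (z, w N) - ∑ i ∈ Finset.range (k + 1),
        taylorCoef (fun w => F (z, w)) i * w N ^ i) / w N ^ k := by
      rw [Finset.sum_range_succ]
      simp only [hG, hc]
      field_simp [hw0 N]
      ring
    rw [← h3] at h2
    have h4 : ∀ n, ‖taylorCoef (fun w => F (z, w)) (n + (k + 1)) * w N ^ (n + (k + 1)) /
        w N ^ k‖ ≤ C / r ^ k * q N * (1 / 2) ^ n := by
      intro n
      rw [norm_div, norm_mul, norm_pow, norm_pow, hwn]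
      have h5 := hC z hz1 (n + (k + 1))
      have h6 : C / r ^ (n + (k + 1)) * (r * q N) ^ (n + (k + 1)) / (r * q N) ^ k =
          C / r ^ k * q N * q N ^ n := by
        have := hq0 N
        rw [mul_pow, mul_pow]
        field_simp
        ring
      calc _ ≤ C / r ^ (n + (k + 1)) * (r * q N) ^ (n + (k + 1)) / (r * q N) ^ k := by
            have := hq0 N
            gcongr
        _ = _ := h6
        _ ≤ _ := by
            have := hq0 N
            gcongr
            exact hq1 N
    rw [norm_sub_rev, ← h2.tsum_eq]
    refine (tsum_of_norm_bounded
      (hasSum_geometric_two.mul_left (C / r ^ k * q N)) h4).trans_eq ?_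
    ring
  have hunif : TendstoUniformlyOn G (c k) atTop (Metric.ball 0 r) := by
    rw [Metric.tendstoUniformlyOn_iff]
    intro ε hε
    have hlim : Tendsto (fun N => 2 * (C / r ^ k) * q N) atTop (𝓝 0) := by
      simpa using hqlim.const_mul (2 * (C / r ^ k))
    filter_upwards [hlim.eventually (gt_mem_nhds hε)] with N hN z hz
    rw [dist_eq_norm]
    exact (hbound N z hz).trans_lt hN
  have hd := hunif.tendstoLocallyUniformlyOn.differentiableOn (Eventually.of_forall hGd)
    Metric.isOpen_ball
  exact (hd.differentiableAt (Metric.isOpen_ball.mem_nhds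
    (by simpa using hr₀))).differentiableWithinAt

/-- A holomorphic function on the bidisc is the sum of its double Taylor series. -/
theorem exists_hasTaylor {F : ℂ × ℂ → ℂ} (hF : DifferentiableOn ℂ F bidisc) :
    ∃ a, HasTaylor a F := by
  set c : ℕ → ℂ → ℂ := fun n z => taylorCoef (fun w => F (z, w)) n with hc
  refine ⟨fun x => taylorCoef (c x.2) x.1, fun z hz w hw => ?_⟩
  rw [mem_ball_zero_iff] at hz hw
  obtain ⟨r, hmr, hr1⟩ := exists_between (max_lt hz hw)
  have hzr : ‖z‖ < r := (le_max_left _ _).trans_lt hmr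
  have hwr : ‖w‖ < r := (le_max_right _ _).trans_lt hmr
  have hr : 0 < r := (norm_nonneg z).trans_lt hzr
  obtain ⟨C, hC0, hC⟩ := exists_bound_taylorCoef_section hF hr hr1
  have hcd := differentiableOn_taylorCoef_section hF
  have hsum : Summable fun x : ℕ × ℕ => taylorCoef (c x.2) x.1 * (z ^ x.1 * w ^ x.2) := by
    have hg : ∀ y : ℂ, ‖y‖ < r → Summable fun n : ℕ => (‖y‖ / r) ^ n := fun y hy =>
      summable_geometric_of_lt_one (by positivity) ((div_lt_one hr).2 hy)
    have hs := ((hg z hzr).mul_of_nonneg (hg w hwr) (fun n => by positivity)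
      (fun n => by positivity)).mul_left C
    refine Summable.of_norm_bounded hs fun x => ?_
    have h1 := norm_taylorCoef_le (hcd x.2) hr hr1 (C := C / r ^ x.2)
      (fun y hy => hC y (Metric.sphere_subset_closedBall hy) x.2) x.1
    rw [norm_mul, norm_mul, norm_pow, norm_pow]
    calc _ ≤ C / r ^ x.2 / r ^ x.1 * (‖z‖ ^ x.1 * ‖w‖ ^ x.2) := by gcongr
      _ = _ := by rw [div_pow, div_pow]; field_simp
  have h1 := (Equiv.prodComm ℕ ℕ).hasSum_iff.2 hsum.hasSum
  have hz' : z ∈ Metric.ball (0 : ℂ) 1 := by simpa using hz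
  have h2 := h1.prod_fiberwise (g := fun n => c n z * w ^ n) fun n => by
    have h3 := (hasSum_taylorCoef (hcd n) z hz').mul_right (w ^ n)
    convert! h3 using 2 with m
    simp [mul_assoc, hc]
  have h3 := hasSum_taylorCoef (differentiableOn_section hF hz') w (by simpa using hw)
  rw [← h2.unique h3]
  exact hsum.hasSum

/-- A double power series with bounded coefficients has a holomorphic sum. -/
theorem HasTaylor.differentiableOn {a : ℕ × ℕ → ℂ} {F : ℂ × ℂ → ℂ} (h : HasTaylor a F) {C : ℝ}
    (hC : ∀ x, ‖a x‖ ≤ C) : DifferentiableOn ℂ F bidisc := by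
  rintro ⟨z, w⟩ ⟨hz, hw⟩
  have hz' : ‖z‖ < 1 := by simpa using hz
  have hw' : ‖w‖ < 1 := by simpa using hw
  obtain ⟨r, hmr, hr1⟩ := exists_between (max_lt hz' hw')
  have hzr : ‖z‖ < r := (le_max_left _ _).trans_lt hmr
  have hwr : ‖w‖ < r := (le_max_right _ _).trans_lt hmr
  have hr : 0 < r := (norm_nonneg z).trans_lt hzr
  have hC0 : 0 ≤ C := (norm_nonneg _).trans (hC 0)
  set s : Set (ℂ × ℂ) := Metric.ball (0 : ℂ) r ×ˢ Metric.ball (0 : ℂ) r with hs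
  have hso : IsOpen s := Metric.isOpen_ball.prod Metric.isOpen_ball
  have hsc : IsPreconnected s :=
    ((convex_ball (0 : ℂ) r).prod (convex_ball (0 : ℂ) r)).isPreconnected
  have hmem : (z, w) ∈ s := ⟨by simpa using hzr, by simpa using hwr⟩
  have hg1 : Summable fun n : ℕ => r ^ n := summable_geometric_of_lt_one hr.le hr1
  have hg2 : Summable fun n : ℕ => (n : ℝ) * r ^ (n - 1) := by
    have h1 := (summable_pow_mul_geometric_of_norm_lt_one (R := ℝ) 1
      (by rwa [Real.norm_of_nonneg hr.le])).mul_right r⁻¹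
    refine h1.congr fun n => ?_
    rcases n with _ | n
    · simp
    · rw [Nat.add_sub_cancel, pow_one, pow_succ, mul_assoc, mul_assoc, mul_inv_cancel₀ hr.ne',
        mul_one]
  have hu : Summable fun x : ℕ × ℕ => C * ((x.1 * r ^ (x.1 - 1)) * r ^ x.2 +
      r ^ x.1 * (x.2 * r ^ (x.2 - 1))) :=
    ((hg2.mul_of_nonneg hg1 (fun n => by positivity) (fun n => by positivity)).add
      (hg1.mul_of_nonneg hg2 (fun n => by positivity) (fun n => by positivity))).mul_left C
  have hmain := hasFDerivAt_tsum_of_isPreconnected (𝕜 := ℂ) hu hso hsc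
    (f := fun (x : ℕ × ℕ) (p : ℂ × ℂ) => a x * (p.1 ^ x.1 * p.2 ^ x.2))
    (f' := fun x p => a x • ((p.1 ^ x.1) • ((x.2 * p.2 ^ (x.2 - 1)) •
      ContinuousLinearMap.snd ℂ ℂ ℂ) + (p.2 ^ x.2) • ((x.1 * p.1 ^ (x.1 - 1)) •
      ContinuousLinearMap.fst ℂ ℂ ℂ)))
    (fun x p _ => by
      have h1 : HasFDerivAt (fun p : ℂ × ℂ => p.1 ^ x.1)
          ((x.1 * p.1 ^ (x.1 - 1)) • ContinuousLinearMap.fst ℂ ℂ ℂ) p :=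
        (hasDerivAt_pow x.1 p.1).comp_hasFDerivAt p hasFDerivAt_fst
      have h2 : HasFDerivAt (fun p : ℂ × ℂ => p.2 ^ x.2)
          ((x.2 * p.2 ^ (x.2 - 1)) • ContinuousLinearMap.snd ℂ ℂ ℂ) p :=
        (hasDerivAt_pow x.2 p.2).comp_hasFDerivAt p hasFDerivAt_snd
      exact (h1.mul h2).const_mul (a x))
    (fun x p hp => by
      have hp1 : ‖p.1‖ ≤ r := (mem_ball_zero_iff.1 hp.1).le
      have hp2 : ‖p.2‖ ≤ r := (mem_ball_zero_iff.1 hp.2).le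
      rw [norm_smul]
      refine mul_le_mul (hC x) ?_ (norm_nonneg _) hC0
      rw [add_comm]
      refine (norm_add_le _ _).trans (add_le_add ?_ ?_)
      · rw [norm_smul, norm_smul, norm_mul, norm_pow, norm_pow, Complex.norm_natCast]
        calc _ ≤ ‖p.2‖ ^ x.2 * (x.1 * ‖p.1‖ ^ (x.1 - 1) * 1) := by
              gcongr; exact ContinuousLinearMap.norm_fst_le ..
          _ ≤ r ^ x.2 * (x.1 * r ^ (x.1 - 1) * 1) := by gcongr
          _ = _ := by ring
      · rw [norm_smul, norm_smul, norm_mul, norm_pow, norm_pow, Complex.norm_natCast]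
        calc _ ≤ ‖p.1‖ ^ x.1 * (x.2 * ‖p.2‖ ^ (x.2 - 1) * 1) := by
              gcongr; exact ContinuousLinearMap.norm_snd_le ..
          _ ≤ r ^ x.1 * (x.2 * r ^ (x.2 - 1) * 1) := by gcongr
          _ = _ := by ring)
    hmem (h z hz w hw).summable hmem
  refine (hmain.differentiableAt.congr_of_eventuallyEq ?_).differentiableWithinAt
  filter_upwards [hso.mem_nhds hmem] with p hp
  refine ((h p.1 ?_ p.2 ?_).tsum_eq).symm
  · exact Metric.ball_subset_ball hr1.le hp.1
  · exact Metric.ball_subset_ball hr1.le hp.2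

/-! ### 2-isometries -/

section TwoIsometry

variable {H : Type*} [NormedAddCommGroup H] [InnerProductSpace ℂ H]

theorem IsTwoIsometry.norm_sq_pow {T : H →L[ℂ] H} (h : IsTwoIsometry T) (x : H) (n : ℕ) :
    ‖(T ^ n) x‖ ^ 2 = ‖x‖ ^ 2 + n * (‖T x‖ ^ 2 - ‖x‖ ^ 2) := by
  have key : ∀ n : ℕ, ‖(T ^ n) x‖ ^ 2 = ‖x‖ ^ 2 + n * (‖T x‖ ^ 2 - ‖x‖ ^ 2) ∧
      ‖(T ^ (n + 1)) x‖ ^ 2 = ‖x‖ ^ 2 + (n + 1) * (‖T x‖ ^ 2 - ‖x‖ ^ 2) := by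
    intro n
    induction n with
    | zero => simp
    | succ n ih =>
      have h1 := h ((T ^ n) x)
      have e1 : T ((T ^ n) x) = (T ^ (n + 1)) x := by rw [pow_succ']; rfl
      have e2 : T ((T ^ (n + 1)) x) = (T ^ (n + 1 + 1)) x := by rw [pow_succ' T (n + 1)]; rfl
      rw [e1, e2] at h1
      refine ⟨by rw [ih.2]; push_cast; ring, ?_⟩
      rw [ih.1, ih.2] at h1
      rw [Nat.cast_succ]
      linarith
  exact (key n).1

/-- A 2-isometry is expansive, because `‖Tⁿ x‖²` is affine in `n` and nonnegative. -/
theorem IsTwoIsometry.norm_le {T : H →L[ℂ] H} (h : IsTwoIsometry T) (x : H) : ‖x‖ ≤ ‖T x‖ := by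
  by_contra! hlt
  have h1 : 0 < ‖x‖ ^ 2 - ‖T x‖ ^ 2 := by nlinarith [norm_nonneg (T x)]
  obtain ⟨n, hn⟩ := exists_nat_gt (‖x‖ ^ 2 / (‖x‖ ^ 2 - ‖T x‖ ^ 2))
  rw [div_lt_iff₀ h1] at hn
  have h2 := h.norm_sq_pow x n
  nlinarith [sq_nonneg ‖(T ^ n) x‖]

theorem IsTwoIsometry.inner_eq {T : H →L[ℂ] H} (h : IsTwoIsometry T) (x y : H) :
    ⟪T (T x), T (T y)⟫_ℂ = 2 * ⟪T x, T y⟫_ℂ - ⟪x, y⟫_ℂ := by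
  have h' : ∀ v : H, ((‖T (T v)‖ : ℝ) : ℂ) ^ 2 =
      2 * ((‖T v‖ : ℝ) : ℂ) ^ 2 - ((‖v‖ : ℝ) : ℂ) ^ 2 := by
    intro v
    have := h v
    have h2 : ‖T (T v)‖ ^ 2 = 2 * ‖T v‖ ^ 2 - ‖v‖ ^ 2 := by linarith
    exact_mod_cast h2
  rw [inner_eq_sum_norm_sq_div_four, inner_eq_sum_norm_sq_div_four,
    inner_eq_sum_norm_sq_div_four x y]
  simp only [← map_add, ← map_sub, ← map_smul, RCLike.ofReal_eq_complex_ofReal, h']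
  ring

theorem IsTwoIsometry.inner_pow_add_two {T : H →L[ℂ] H} (h : IsTwoIsometry T) (x y : H)
    (m p : ℕ) : ⟪(T ^ (p + 2)) x, (T ^ (m + 2)) y⟫_ℂ =
      2 * ⟪(T ^ (p + 1)) x, (T ^ (m + 1)) y⟫_ℂ - ⟪(T ^ p) x, (T ^ m) y⟫_ℂ := by
  have e1 : ∀ (k : ℕ) (z : H), (T ^ (k + 1)) z = T ((T ^ k) z) := fun k z => by
    rw [pow_succ']; rfl
  rw [e1, e1, e1, e1, h.inner_eq]

variable [CompleteSpace H]

theorem IsTwoIsometry.isUnit_adjoint_mul_self {T : H →L[ℂ] H} (h : IsTwoIsometry T) :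
    IsUnit (ContinuousLinearMap.adjoint T * T) := by
  refine ContinuousLinearMap.isUnit_of_forall_le_norm_inner_map _ (c := 1) one_pos fun x => ?_
  have e : ⟪(ContinuousLinearMap.adjoint T * T) x, x⟫_ℂ = ⟪T x, T x⟫_ℂ :=
    ContinuousLinearMap.adjoint_inner_left T x (T x)
  rw [e, inner_self_eq_norm_sq_to_K]
  simp only [NNReal.coe_one, mul_one, norm_pow, RCLike.norm_ofReal, abs_norm]
  exact pow_le_pow_left₀ (norm_nonneg _) (h.norm_le x) 2

theorem IsTwoIsometry.leftInv_apply {T : H →L[ℂ] H} (h : IsTwoIsometry T) (x : H) :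
    leftInv T (T x) = x := by
  have h1 : leftInv T * T = 1 := by
    rw [leftInv, mul_assoc, Ring.inverse_mul_cancel _ h.isUnit_adjoint_mul_self]
  exact congrArg (fun S : H →L[ℂ] H => S x) h1

theorem leftInv_eq_zero {T : H →L[ℂ] H} {x : H} (hx : ContinuousLinearMap.adjoint T x = 0) :
    leftInv T x = 0 := by
  change (Ring.inverse (ContinuousLinearMap.adjoint T * T) : H →L[ℂ] H)
    (ContinuousLinearMap.adjoint T x) = 0
  rw [hx, map_zero]

theorem IsTwoIsometry.adjoint_eq_zero {T : H →L[ℂ] H} (h : IsTwoIsometry T) {x : H}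
    (hx : leftInv T x = 0) : ContinuousLinearMap.adjoint T x = 0 := by
  have h1 : (ContinuousLinearMap.adjoint T * T) * leftInv T = ContinuousLinearMap.adjoint T := by
    rw [leftInv, ← mul_assoc, Ring.mul_inverse_cancel _ h.isUnit_adjoint_mul_self, one_mul]
  rw [← h1]
  change (ContinuousLinearMap.adjoint T * T) (leftInv T x) = 0
  rw [hx, map_zero]

theorem inner_apply_eq_zero {T : H →L[ℂ] H} {x : H} (hx : ContinuousLinearMap.adjoint T x = 0)
    (y : H) : ⟪x, T y⟫_ℂ = 0 := by
  rw [← ContinuousLinearMap.adjoint_inner_left, hx, inner_zero_left]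

theorem inner_apply_eq_zero' {T : H →L[ℂ] H} {x : H} (hx : ContinuousLinearMap.adjoint T x = 0)
    (y : H) : ⟪T y, x⟫_ℂ = 0 := by
  rw [← ContinuousLinearMap.adjoint_inner_right, hx, inner_zero_right]

/-! ### The measure of a 2-isometry -/

theorem conj_mul_self_unitCirc (ξ : unitCirc) : conj (ξ : ℂ) * (ξ : ℂ) = 1 := by
  rw [mul_comm, Complex.mul_conj, Complex.normSq_eq_norm_sq, mem_sphere_zero_iff_norm.1 ξ.2]
  simp

theorem moment_succ (μ : Measure unitCirc) (m p : ℕ) :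
    moment μ (m + 1) (p + 1) = moment μ m p := by
  rw [moment, moment]
  congr 2
  ext ξ
  rw [pow_succ, pow_succ]
  linear_combination (conj (ξ : ℂ) ^ p * (ξ : ℂ) ^ m) * conj_mul_self_unitCirc ξ

theorem gram_succ (μ : Measure unitCirc) (m p : ℕ) :
    gram μ (m + 1) (p + 1) = gram μ m p + moment μ m p := by
  have h : ((min m p : ℕ) : ℂ) * moment μ (m - 1) (p - 1) = (min m p : ℕ) * moment μ m p := by
    rcases m with _ | m
    · simp
    rcases p with _ | p
    · simp
    rw [Nat.add_sub_cancel, Nat.add_sub_cancel, moment_succ]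
  rw [gram, gram, h, Nat.succ_min_succ]
  simp only [Nat.add_right_cancel_iff, Nat.add_sub_cancel]
  push_cast
  ring

theorem gram_zero_right (μ : Measure unitCirc) (m : ℕ) :
    gram μ m 0 = if m = 0 then 1 else 0 := by simp [gram]

theorem gram_zero_left (μ : Measure unitCirc) (p : ℕ) :
    gram μ 0 p = if p = 0 then 1 else 0 := by simp [gram, eq_comm]

/-- The orbit of a unit vector `x ∈ ker T*` under a 2-isometry has the Gram matrix of the monomials
in a Dirichlet-type space of the disc: `⟨(T*T - 1) Tᵐ x, Tᵖ x⟩` is a positive definite Toeplitz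
matrix. -/
theorem IsTwoIsometry.exists_gram_eq {T : H →L[ℂ] H} (h : IsTwoIsometry T) {x : H}
    (hx : ‖x‖ = 1) (hk : ContinuousLinearMap.adjoint T x = 0) :
    ∃ μ : Measure unitCirc, IsFiniteMeasure μ ∧
      ∀ m p, ⟪(T ^ p) x, (T ^ m) x⟫_ℂ = gram μ m p := by
  have e1 : ∀ (k : ℕ) (z : H), (T ^ (k + 1)) z = T ((T ^ k) z) := fun k z => by
    rw [pow_succ']; rfl
  obtain ⟨μ, hμ, hm⟩ := exists_measure_moment_eq
    (c := fun m p => ⟪(T ^ (p + 1)) x, (T ^ (m + 1)) x⟫_ℂ - ⟪(T ^ p) x, (T ^ m) x⟫_ℂ)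
    (fun m p => by rw [h.inner_pow_add_two]; ring)
    (fun N v => by
      set y : H := ∑ m ∈ Finset.range N, v m • (T ^ m) x with hy
      refine ⟨‖T y‖ ^ 2 - ‖y‖ ^ 2, sub_nonneg.2 (pow_le_pow_left₀ (norm_nonneg _) (h.norm_le y) 2),
        ?_⟩
      have h1 : ((‖T y‖ ^ 2 - ‖y‖ ^ 2 : ℝ) : ℂ) = ⟪T y, T y⟫_ℂ - ⟪y, y⟫_ℂ := by
        rw [inner_self_eq_norm_sq_to_K, inner_self_eq_norm_sq_to_K]
        push_cast
        rfl
      rw [h1, hy]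
      simp only [map_sum, map_smul, sum_inner, inner_sum, inner_smul_left, inner_smul_right,
        Finset.mul_sum, ← Finset.sum_sub_distrib]
      refine Finset.sum_congr rfl fun m _ => Finset.sum_congr rfl fun p _ => ?_
      rw [e1, e1]
      ring)
  refine ⟨μ, hμ, fun m => ?_⟩
  induction m with
  | zero =>
    intro p
    rw [gram_zero_left]
    rcases p with _ | p
    · simp [hx]
    · rw [e1, pow_zero]
      simpa using inner_apply_eq_zero' hk ((T ^ p) x)
  | succ m ih =>
    intro p
    rcases p with _ | p
    · rw [gram_zero_right, e1, pow_zero]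
      simpa using inner_apply_eq_zero hk ((T ^ m) x)
    · rw [gram_succ, ← ih p, hm m p]
      ring

end TwoIsometry

/-! ### Completeness of the space of coefficients -/

/-- The norm whose square is `coefNorm`. -/
def coefSeminorm (μ₁ μ₂ : Measure unitCirc) (a : ℕ × ℕ → ℂ) : ℝ≥0∞ :=
  eLpNorm (ev₂ a) 2 ((evalMeasure μ₁).prod (evalMeasure μ₂))

theorem coefSeminorm_sq (μ₁ μ₂ : Measure unitCirc) (a : ℕ × ℕ → ℂ) :
    coefSeminorm μ₁ μ₂ a ^ 2 = coefNorm μ₁ μ₂ a := eLpNorm_two_sq _ _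

theorem sq_injective_ennreal : Function.Injective fun x : ℝ≥0∞ => x ^ 2 :=
  (ENNReal.pow_right_strictMono two_ne_zero).injective

theorem coefSeminorm_add_le (μ₁ μ₂ : Measure unitCirc) (a b : ℕ × ℕ → ℂ) :
    coefSeminorm μ₁ μ₂ (a + b) ≤ coefSeminorm μ₁ μ₂ a + coefSeminorm μ₁ μ₂ b := by
  have h : ev₂ (a + b) = ev₂ a + ev₂ b := funext (ev₂_add a b)
  rw [coefSeminorm, h]
  exact eLpNorm_add_le (measurable_ev₂ a).aestronglyMeasurable
    (measurable_ev₂ b).aestronglyMeasurable one_le_two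

theorem coefSeminorm_sub_comm (μ₁ μ₂ : Measure unitCirc) (a b : ℕ × ℕ → ℂ) :
    coefSeminorm μ₁ μ₂ (a - b) = coefSeminorm μ₁ μ₂ (b - a) := by
  apply sq_injective_ennreal
  change coefSeminorm _ _ _ ^ 2 = coefSeminorm _ _ _ ^ 2
  rw [coefSeminorm_sq, coefSeminorm_sq, ← neg_sub b a, ← neg_one_smul ℂ, coefNorm_smul]
  simp

theorem tendsto_coefSeminorm_fejer_sub (μ₁ μ₂ : Measure unitCirc) [SFinite μ₁] [SFinite μ₂]
    {a : ℕ × ℕ → ℂ} (ha : coefNorm μ₁ μ₂ a < ∞) :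
    Tendsto (fun K => coefSeminorm μ₁ μ₂ (fejer K a - a)) atTop (𝓝 0) := by
  have h := ((ENNReal.continuous_rpow_const (y := 1 / 2)).tendsto 0).comp
    (tendsto_coefNorm_fejer_sub μ₁ μ₂ ha)
  rw [ENNReal.zero_rpow_of_pos (by norm_num)] at h
  refine h.congr fun K => ?_
  rw [Function.comp, ← coefSeminorm_sq, ← ENNReal.rpow_natCast, ← ENNReal.rpow_mul]
  norm_num

section Coordinates

variable {H : Type*} [NormedAddCommGroup H] [InnerProductSpace ℂ H]
  {μ₁ μ₂ : Measure unitCirc} {V : (ℕ × ℕ →₀ ℂ) →ₗ[ℂ] H} {α : ℕ × ℕ → H →L[ℂ] ℂ}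

theorem enorm_eq_coefSeminorm (hV : ∀ c, ‖V c‖ₑ ^ 2 = coefNorm μ₁ μ₂ c) (c : ℕ × ℕ →₀ ℂ) :
    ‖V c‖ₑ = coefSeminorm μ₁ μ₂ c :=
  sq_injective_ennreal ((hV c).trans (coefSeminorm_sq _ _ _).symm)

/-- If the vectors `V c` with finitely many coordinates `c` are dense and have norm
`coefNorm c`, then every vector has the norm prescribed by its coordinates. -/
theorem coefNorm_coord (hV : ∀ c, ‖V c‖ₑ ^ 2 = coefNorm μ₁ μ₂ c) (hd : DenseRange V)
    (hα : ∀ x c, α x (V c) = c x) (h : H) :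
    coefNorm μ₁ μ₂ (fun x => α x h) = ‖h‖ₑ ^ 2 := by
  obtain ⟨y, hy, hlim⟩ := mem_closure_iff_seq_limit.1 (hd h)
  choose u hu using hy
  have hlim : Tendsto (fun k => V (u k)) atTop (𝓝 h) := by simpa only [hu] using hlim
  have hle : ∀ k, coefSeminorm μ₁ μ₂ ((fun x => α x h) - u k) ≤ ‖h - V (u k)‖ₑ := by
    intro k
    rw [← (ENNReal.pow_right_strictMono two_ne_zero).le_iff_le]
    rw [coefSeminorm_sq]
    have h1 : Tendsto (fun j => coefNorm μ₁ μ₂ (u j - u k : ℕ × ℕ →₀ ℂ)) atTop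
        (𝓝 (‖h - V (u k)‖ₑ ^ 2)) := by
      simp only [← hV, map_sub]
      exact ENNReal.Tendsto.pow (hlim.sub_const _).enorm
    rw [← h1.liminf_eq]
    refine coefNorm_le_liminf μ₁ μ₂ fun x => ?_
    have h2 : Tendsto (fun j => α x (V (u j))) atTop (𝓝 (α x h)) :=
      ((α x).continuous.tendsto h).comp hlim
    simp only [hα] at h2
    exact h2.sub_const _
  have h0 : Tendsto (fun k => ‖h - V (u k)‖ₑ) atTop (𝓝 0) := by
    simpa using (hlim.const_sub h).enorm
  rw [← coefSeminorm_sq]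
  congr 1
  apply le_antisymm
  · refine ge_of_tendsto' (by simpa using h0.add hlim.enorm) fun k => ?_
    calc coefSeminorm μ₁ μ₂ (fun x => α x h)
        = coefSeminorm μ₁ μ₂ (((fun x => α x h) - u k) + u k) := by rw [sub_add_cancel]
      _ ≤ _ := (coefSeminorm_add_le _ _ _ _).trans
          (add_le_add (hle k) (enorm_eq_coefSeminorm hV (u k)).ge)
  · refine le_of_tendsto_of_tendsto' hlim.enorm (by simpa using h0.add_const _) fun k => ?_
    calc ‖V (u k)‖ₑ = coefSeminorm μ₁ μ₂ (u k) := enorm_eq_coefSeminorm hV (u k)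
      _ = coefSeminorm μ₁ μ₂ ((u k - fun x => α x h) + fun x => α x h) := by rw [sub_add_cancel]
      _ ≤ _ := (coefSeminorm_add_le _ _ _ _).trans
          (add_le_add_left ((coefSeminorm_sub_comm _ _ _ _).trans_le (hle k)) _)

/-- Every sequence of coefficients of finite norm is attained: its Fejér means converge. -/
theorem exists_coord [CompleteSpace H] [SFinite μ₁] [SFinite μ₂]
    (hV : ∀ c, ‖V c‖ₑ ^ 2 = coefNorm μ₁ μ₂ c)
    (hα : ∀ x c, α x (V c) = c x) {a : ℕ × ℕ → ℂ} (ha : coefNorm μ₁ μ₂ a < ∞) :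
    ∃ h, ∀ x, α x h = a x := by
  have hlim := tendsto_coefSeminorm_fejer_sub μ₁ μ₂ ha
  have hc : CauchySeq fun K => V (fejer K a) := by
    rw [EMetric.cauchySeq_iff]
    intro ε hε
    obtain ⟨N, hN⟩ := eventually_atTop.1 (hlim.eventually_lt_const (ENNReal.half_pos hε.ne'))
    refine ⟨N, fun m hm n hn => ?_⟩
    rw [edist_eq_enorm_sub, ← map_sub, enorm_eq_coefSeminorm hV]
    have e : ((fejer m a - fejer n a : ℕ × ℕ →₀ ℂ) : ℕ × ℕ → ℂ) =
        (fejer m a - a) + (a - fejer n a) := by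
      rw [sub_add_sub_cancel]
      rfl
    rw [e]
    refine (coefSeminorm_add_le _ _ _ _).trans_lt ?_
    rw [coefSeminorm_sub_comm _ _ a, ← ENNReal.add_halves ε]
    exact ENNReal.add_lt_add (hN m hm) (hN n hn)
  obtain ⟨h, hh⟩ := cauchySeq_tendsto_of_complete hc
  refine ⟨h, fun x => tendsto_nhds_unique (((α x).continuous.tendsto h).comp hh) ?_⟩
  simp only [Function.comp_def, hα]
  exact tendsto_fejer a x

end Coordinates

/-! ### From coordinates to functions -/

theorem extendZero_apply (f : bidisc → ℂ) (z : bidisc) : extendZero f z = f z := by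
  rw [extendZero, dif_pos z.2]

theorem hasTaylor_extendZero_iff {a : ℕ × ℕ → ℂ} {f : bidisc → ℂ} :
    HasTaylor a (extendZero f) ↔
      ∀ z : bidisc, HasSum (fun x : ℕ × ℕ => a x * (z.1.1 ^ x.1 * z.1.2 ^ x.2)) (f z) := by
  constructor
  · intro h z
    rw [← extendZero_apply f z]
    exact h _ z.2.1 _ z.2.2
  · intro h z hz w hw
    rw [extendZero_apply f ⟨(z, w), hz, hw⟩]
    exact h ⟨(z, w), hz, hw⟩

theorem summable_taylor {a : ℕ × ℕ → ℂ} {C : ℝ} (ha : ∀ x, ‖a x‖ ≤ C) (z : bidisc) :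
    Summable fun x : ℕ × ℕ => a x * (z.1.1 ^ x.1 * z.1.2 ^ x.2) := by
  have h1 : ‖z.1.1‖ < 1 := by simpa using z.2.1
  have h2 : ‖z.1.2‖ < 1 := by simpa using z.2.2
  refine Summable.of_norm_bounded (g := fun x : ℕ × ℕ => C * (‖z.1.1‖ ^ x.1 * ‖z.1.2‖ ^ x.2)) ?_
    fun x => ?_
  · exact ((summable_geometric_of_lt_one (norm_nonneg _) h1).mul_of_nonneg
      (summable_geometric_of_lt_one (norm_nonneg _) h2) (fun _ => by positivity)
      fun _ => by positivity).mul_left C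
  · rw [norm_mul, norm_mul, norm_pow, norm_pow]
    exact mul_le_mul_of_nonneg_right (ha x) (by positivity)

theorem HasTaylor.mul_fst {a b : ℕ × ℕ → ℂ} {f g : bidisc → ℂ} (hf : HasTaylor a (extendZero f))
    (hg : HasTaylor b (extendZero g)) (h0 : ∀ n, b (0, n) = 0)
    (hs : ∀ m n, b (m + 1, n) = a (m, n)) (z : bidisc) : g z = z.1.1 * f z := by
  refine (hasTaylor_extendZero_iff.1 hg z).unique ?_
  have hi : Function.Injective fun x : ℕ × ℕ => (x.1 + 1, x.2) := fun x y h => by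
    simpa [Prod.ext_iff] using h
  rw [← hi.hasSum_iff]
  · refine ((hasTaylor_extendZero_iff.1 hf z).mul_left z.1.1).congr_fun fun x => ?_
    simp only [Function.comp, hs]
    ring
  · rintro ⟨_ | m, n⟩ hx
    · simp [h0]
    · exact absurd ⟨(m, n), rfl⟩ hx

theorem HasTaylor.mul_snd {a b : ℕ × ℕ → ℂ} {f g : bidisc → ℂ} (hf : HasTaylor a (extendZero f))
    (hg : HasTaylor b (extendZero g)) (h0 : ∀ m, b (m, 0) = 0)
    (hs : ∀ m n, b (m, n + 1) = a (m, n)) (z : bidisc) : g z = z.1.2 * f z := by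
  refine (hasTaylor_extendZero_iff.1 hg z).unique ?_
  have hi : Function.Injective fun x : ℕ × ℕ => (x.1, x.2 + 1) := fun x y h => by
    simpa [Prod.ext_iff] using h
  rw [← hi.hasSum_iff]
  · refine ((hasTaylor_extendZero_iff.1 hf z).mul_left z.1.2).congr_fun fun x => ?_
    simp only [Function.comp, hs]
    ring
  · rintro ⟨m, _ | n⟩ hx
    · simp [h0]
    · exact absurd ⟨(m, n), rfl⟩ hx

/-- Coordinates which describe the norm of `H`, exhaust the sequences of finite norm and are shifted
by `T₁` and `T₂` identify `H` with the Dirichlet-type space. -/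
theorem isUnitarilyEquivalentToShifts_of_coord {H : Type*} [NormedAddCommGroup H]
    [InnerProductSpace ℂ H] {T₁ T₂ : H →L[ℂ] H} {μ₁ μ₂ : Measure unitCirc} [SFinite μ₁]
    [SFinite μ₂] (α : ℕ × ℕ → H →L[ℂ] ℂ)
    (hnorm : ∀ h, coefNorm μ₁ μ₂ (fun x => α x h) = ‖h‖ₑ ^ 2)
    (hex : ∀ a, coefNorm μ₁ μ₂ a < ∞ → ∃ h, ∀ x, α x h = a x)
    (h10 : ∀ n h, α (0, n) (T₁ h) = 0) (h1s : ∀ m n h, α (m + 1, n) (T₁ h) = α (m, n) h)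
    (h20 : ∀ m h, α (m, 0) (T₂ h) = 0) (h2s : ∀ m n h, α (m, n + 1) (T₂ h) = α (m, n) h) :
    IsUnitarilyEquivalentToShifts T₁ T₂ μ₁ μ₂ := by
  have hb : ∀ h x, ‖α x h‖ ≤ ‖h‖ := fun h x => by
    have h1 := (enorm_sq_le_coefNorm μ₁ μ₂ (fun x => α x h) x).trans (hnorm h).le
    have h2 := (ENNReal.pow_right_strictMono two_ne_zero).le_iff_le.1 h1
    rwa [enorm_le_iff_norm_le] at h2
  have hs : ∀ h (z : bidisc), Summable fun x : ℕ × ℕ => α x h * (z.1.1 ^ x.1 * z.1.2 ^ x.2) :=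
    fun h => summable_taylor (hb h)
  let U : H →ₗ[ℂ] (bidisc → ℂ) :=
    { toFun := fun h z => ∑' x : ℕ × ℕ, α x h * (z.1.1 ^ x.1 * z.1.2 ^ x.2)
      map_add' := fun h k => by
        ext z
        simp only [map_add, add_mul, Pi.add_apply]
        exact (hs h z).tsum_add (hs k z)
      map_smul' := fun c h => by
        ext z
        simp only [map_smul, smul_eq_mul, mul_assoc, Pi.smul_apply, RingHom.id_apply]
        exact tsum_mul_left }
  have hU : ∀ h, HasTaylor (fun x => α x h) (extendZero (U h)) := fun h =>
    hasTaylor_extendZero_iff.2 fun z => (hs h z).hasSum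
  have hUn : ∀ h, dirichletNormSq μ₁ μ₂ (U h) = ‖h‖ₑ ^ 2 := fun h =>
    ((hU h).dirichletNormSq_eq μ₁ μ₂).trans (hnorm h)
  refine ⟨U, ⟨fun h _ => ⟨(hU h).differentiableOn (hb h), ?_⟩, fun h _ k _ hhk => ?_,
    fun f hf => ?_⟩, hUn, fun h z => ?_, fun h z => ?_⟩
  · rw [hUn]
    exact ENNReal.pow_lt_top enorm_lt_top
  · have h1 : U (h - k) = U 0 := by rw [map_sub, hhk, sub_self, map_zero]
    have h2 : ‖h - k‖ₑ ^ 2 = 0 := by rw [← hUn, h1, hUn]; simp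
    simpa [sub_eq_zero] using h2
  · obtain ⟨a, ha⟩ := exists_hasTaylor hf.1
    obtain ⟨h, hh⟩ := hex a (by rw [← ha.dirichletNormSq_eq μ₁ μ₂]; exact hf.2)
    refine ⟨h, trivial, funext fun z => ?_⟩
    refine (hasTaylor_extendZero_iff.1 (hU h) z).unique ?_
    simp only [hh]
    exact hasTaylor_extendZero_iff.1 ha z
  · exact (hU h).mul_fst (hU (T₁ h)) (fun n => h10 n h) (fun m n => h1s m n h) z
  · exact (hU h).mul_snd (hU (T₂ h)) (fun m => h20 m h) (fun m n => h2s m n h) z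

/-! ### From the operator identities to the function space -/

/-- A matrix whose diagonals are arithmetic progressions is determined by its first two rows and
columns. -/
theorem ext_diag {u v : ℕ → ℕ → ℂ}
    (hu : ∀ m p, u (m + 2) (p + 2) = 2 * u (m + 1) (p + 1) - u m p)
    (hv : ∀ m p, v (m + 2) (p + 2) = 2 * v (m + 1) (p + 1) - v m p)
    (hr : ∀ m, u m 0 = v m 0) (hl : ∀ p, u 0 p = v 0 p) (hr' : ∀ m, u (m + 1) 1 = v (m + 1) 1)
    (hl' : ∀ p, u 1 (p + 1) = v 1 (p + 1)) (m p : ℕ) : u m p = v m p := by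
  induction m using Nat.strong_induction_on generalizing p with
  | _ m ih =>
    match m, p with
    | 0, p => exact hl p
    | m, 0 => exact hr m
    | 1, p + 1 => exact hl' p
    | m + 1, 1 => exact hr' m
    | m + 2, p + 2 => rw [hu, hv, ih (m + 1) (by omega), ih m (by omega)]

section Operators

variable {H : Type*} [NormedAddCommGroup H] [InnerProductSpace ℂ H]

theorem pow_succ_apply' (T : H →L[ℂ] H) (n : ℕ) (x : H) : (T ^ (n + 1)) x = T ((T ^ n) x) := by
  rw [pow_succ']
  rfl

theorem pow_succ_apply (T : H →L[ℂ] H) (n : ℕ) (x : H) : (T ^ (n + 1)) x = (T ^ n) (T x) := by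
  rw [pow_succ]
  rfl

theorem commute_apply {S T : H →L[ℂ] H} (h : Commute S T) (x : H) : S (T x) = T (S x) :=
  congrArg (fun R : H →L[ℂ] H => R x) h

/-- The vectors `T₁ᵐ T₂ⁿ x`. -/
def orbit (T₁ T₂ : H →L[ℂ] H) (x : H) (k : ℕ × ℕ) : H := (T₁ ^ k.1) ((T₂ ^ k.2) x)

theorem apply_orbit_fst (T₁ T₂ : H →L[ℂ] H) (x : H) (m n : ℕ) :
    T₁ (orbit T₁ T₂ x (m, n)) = orbit T₁ T₂ x (m + 1, n) := (pow_succ_apply' _ _ _).symm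

theorem apply_orbit_snd {T₁ T₂ : H →L[ℂ] H} (h : Commute T₁ T₂) (x : H) (m n : ℕ) :
    T₂ (orbit T₁ T₂ x (m, n)) = orbit T₁ T₂ x (m, n + 1) := by
  rw [orbit, orbit, pow_succ_apply' T₂]
  exact (commute_apply (h.pow_left m) _).symm

theorem denseRange_of_isCyclicVector {T₁ T₂ : H →L[ℂ] H} {x : H} (h : IsCyclicVector T₁ T₂ x) :
    DenseRange (Finsupp.linearCombination ℂ (orbit T₁ T₂ x)) := by
  rw [DenseRange, ← LinearMap.coe_range, Finsupp.range_linearCombination, dense_iff_closure_eq]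
  exact h

/-- The functional `h ↦ ⟨L₁ᵐ L₂ⁿ h, x⟩`, which reads off the coefficient of `z₁ᵐ z₂ⁿ`. -/
def coordFunctional (L₁ L₂ : H →L[ℂ] H) (x : H) (k : ℕ × ℕ) : H →L[ℂ] ℂ :=
  innerSL ℂ x ∘L (L₁ ^ k.1 * L₂ ^ k.2)

theorem coordFunctional_apply (L₁ L₂ : H →L[ℂ] H) (x h : H) (k : ℕ × ℕ) :
    coordFunctional L₁ L₂ x k h = ⟪x, (L₁ ^ k.1) ((L₂ ^ k.2) h)⟫_ℂ := rfl

variable [CompleteSpace H]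

/-- The Gram matrix of the orbit of `x` factors: both sides are determined, through the 2-isometry
identities, by the entries in which the exponents of `T₁` and of `T₂` are small on one side. -/
theorem inner_orbit {T₁ T₂ : H →L[ℂ] H} (hcomm : Commute T₁ T₂) (h₁ : IsTwoIsometry T₁)
    (h₂ : IsTwoIsometry T₂) {x : H} (hx : ‖x‖ = 1)
    (hk₁ : ∀ n, ContinuousLinearMap.adjoint T₁ ((T₂ ^ n) x) = 0)
    (hk₂ : ∀ m, ContinuousLinearMap.adjoint T₂ ((T₁ ^ m) x) = 0)
    (hA : ∀ m n : ℕ, ⟪T₁ (T₂ x), (T₁ ^ (m + 1)) ((T₂ ^ (n + 1)) x)⟫_ℂ =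
      ⟪T₁ x, (T₁ ^ (m + 1)) x⟫_ℂ * ⟪T₂ x, (T₂ ^ (n + 1)) x⟫_ℂ)
    (hB : ∀ m n : ℕ, ⟪T₁ ((T₂ ^ (n + 1)) x), (T₁ ^ (m + 1)) (T₂ x)⟫_ℂ =
      ⟪T₁ x, (T₁ ^ (m + 1)) x⟫_ℂ * ⟪(T₂ ^ (n + 1)) x, T₂ x⟫_ℂ) (m n p q : ℕ) :
    ⟪(T₁ ^ p) ((T₂ ^ q) x), (T₁ ^ m) ((T₂ ^ n) x)⟫_ℂ =
      ⟪(T₁ ^ p) x, (T₁ ^ m) x⟫_ℂ * ⟪(T₂ ^ q) x, (T₂ ^ n) x⟫_ℂ := by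
  have hxx : ⟪x, x⟫_ℂ = 1 := by rw [inner_self_eq_norm_sq_to_K, hx]; simp
  have hc : ∀ (m n : ℕ), (T₁ ^ m) ((T₂ ^ n) x) = (T₂ ^ n) ((T₁ ^ m) x) := fun m n =>
    commute_apply (hcomm.pow_pow m n) x
  have key : ∀ m n q, ⟪T₁ ((T₂ ^ q) x), (T₁ ^ (m + 1)) ((T₂ ^ n) x)⟫_ℂ =
      ⟪T₁ x, (T₁ ^ (m + 1)) x⟫_ℂ * ⟪(T₂ ^ q) x, (T₂ ^ n) x⟫_ℂ := by
    intro m n q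
    have hc1 : ∀ q, T₁ ((T₂ ^ q) x) = (T₂ ^ q) (T₁ x) := fun q => by
      simpa using hc 1 q
    have hk21 : ContinuousLinearMap.adjoint T₂ (T₁ x) = 0 := by simpa using hk₂ 1
    refine ext_diag (u := fun n q => ⟪T₁ ((T₂ ^ q) x), (T₁ ^ (m + 1)) ((T₂ ^ n) x)⟫_ℂ)
      (v := fun n q => ⟪T₁ x, (T₁ ^ (m + 1)) x⟫_ℂ * ⟪(T₂ ^ q) x, (T₂ ^ n) x⟫_ℂ)
      (fun n q => ?_) (fun n q => ?_) (fun n => ?_) (fun q => ?_) (fun n => ?_) (fun q => ?_) n q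
    · simp only [hc, hc1]
      exact h₂.inner_pow_add_two _ _ _ _
    · rw [h₂.inner_pow_add_two]
      ring
    · rcases n with _ | n
      · simp [hx]
      · simp only [hc, pow_zero]
        rw [pow_succ_apply' T₂, pow_succ_apply' T₂]
        have e1 : ⟪T₁ x, T₂ ((T₂ ^ n) ((T₁ ^ (m + 1)) x))⟫_ℂ = 0 := inner_apply_eq_zero hk21 _
        have e2 : ⟪x, T₂ ((T₂ ^ n) x)⟫_ℂ = 0 := inner_apply_eq_zero (hk₂ 0) _
        change ⟪T₁ x, _⟫_ℂ = _ * ⟪x, _⟫_ℂ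
        rw [e1, e2, mul_zero]
    · rcases q with _ | q
      · simp [hx]
      · simp only [hc1, pow_zero]
        rw [pow_succ_apply' T₂, pow_succ_apply' T₂]
        have e1 : ⟪T₂ ((T₂ ^ q) (T₁ x)), (T₁ ^ (m + 1)) x⟫_ℂ = 0 :=
          inner_apply_eq_zero' (hk₂ (m + 1)) _
        have e2 : ⟪T₂ ((T₂ ^ q) x), x⟫_ℂ = 0 := inner_apply_eq_zero' (hk₂ 0) _
        change ⟪_, (T₁ ^ (m + 1)) x⟫_ℂ = _ * ⟪_, x⟫_ℂ
        rw [e1, e2, mul_zero]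
    · simpa only [pow_one] using hA m n
    · simpa only [pow_one] using hB m q
  refine ext_diag (u := fun m p => ⟪(T₁ ^ p) ((T₂ ^ q) x), (T₁ ^ m) ((T₂ ^ n) x)⟫_ℂ)
      (v := fun m p => ⟪(T₁ ^ p) x, (T₁ ^ m) x⟫_ℂ * ⟪(T₂ ^ q) x, (T₂ ^ n) x⟫_ℂ)
      (fun m p => ?_) (fun m p => ?_) (fun m => ?_) (fun p => ?_) (fun m => ?_) (fun p => ?_) m p
  · exact h₁.inner_pow_add_two _ _ _ _
  · rw [h₁.inner_pow_add_two]
    ring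
  · rcases m with _ | m
    · simp [hx]
    · rw [pow_succ_apply' T₁, pow_succ_apply' T₁, pow_zero]
      have e1 : ⟪(T₂ ^ q) x, T₁ ((T₁ ^ m) ((T₂ ^ n) x))⟫_ℂ = 0 := inner_apply_eq_zero (hk₁ q) _
      have e2 : ⟪x, T₁ ((T₁ ^ m) x)⟫_ℂ = 0 := inner_apply_eq_zero (hk₁ 0) _
      change ⟪(T₂ ^ q) x, _⟫_ℂ = ⟪x, _⟫_ℂ * _
      rw [e1, e2, zero_mul]
  · rcases p with _ | p
    · simp [hx]
    · rw [pow_succ_apply' T₁, pow_succ_apply' T₁, pow_zero]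
      have e1 : ⟪T₁ ((T₁ ^ p) ((T₂ ^ q) x)), (T₂ ^ n) x⟫_ℂ = 0 := inner_apply_eq_zero' (hk₁ n) _
      have e2 : ⟪T₁ ((T₁ ^ p) x), x⟫_ℂ = 0 := inner_apply_eq_zero' (hk₁ 0) _
      change ⟪_, (T₂ ^ n) x⟫_ℂ = ⟪_, x⟫_ℂ * _
      rw [e1, e2, zero_mul]
  · simpa only [pow_one] using key m n q
  · have h := congrArg conj (key p q n)
    rw [map_mul, inner_conj_symm, inner_conj_symm, inner_conj_symm] at h
    simpa only [pow_one] using h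

/-- The measures are those of the 2-isometries `T₁` and `T₂` at the vector `x`, and the coordinates
of `h` are the numbers `⟨L₁ᵐ L₂ⁿ h, x⟩`. -/
theorem isUnitarilyEquivalentToShifts_of_conditions {T₁ T₂ : H →L[ℂ] H} (hcomm : Commute T₁ T₂)
    (h₁ : IsTwoIsometry T₁) (h₂ : IsTwoIsometry T₂) {x : H} (hx : ‖x‖ = 1)
    (hcyc : IsCyclicVector T₁ T₂ x) (hk₁ : ContinuousLinearMap.adjoint T₁ x = 0)
    (hk₂ : ContinuousLinearMap.adjoint T₂ x = 0) (hL₁ : Commute (leftInv T₁) T₂)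
    (hL₂ : Commute (leftInv T₂) T₁)
    (hA : ∀ m n : ℕ, ⟪T₁ (T₂ x), (T₁ ^ (m + 1)) ((T₂ ^ (n + 1)) x)⟫_ℂ =
      ⟪T₁ x, (T₁ ^ (m + 1)) x⟫_ℂ * ⟪T₂ x, (T₂ ^ (n + 1)) x⟫_ℂ)
    (hB : ∀ m n : ℕ, ⟪T₁ ((T₂ ^ (n + 1)) x), (T₁ ^ (m + 1)) (T₂ x)⟫_ℂ =
      ⟪T₁ x, (T₁ ^ (m + 1)) x⟫_ℂ * ⟪(T₂ ^ (n + 1)) x, T₂ x⟫_ℂ) :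
    ∃ μ₁ μ₂ : Measure unitCirc, IsFiniteMeasure μ₁ ∧ IsFiniteMeasure μ₂ ∧
      IsUnitarilyEquivalentToShifts T₁ T₂ μ₁ μ₂ := by
  have hxx : ⟪x, x⟫_ℂ = 1 := by rw [inner_self_eq_norm_sq_to_K, hx]; simp
  obtain ⟨μ₁, hμ₁, hg₁⟩ := h₁.exists_gram_eq hx hk₁
  obtain ⟨μ₂, hμ₂, hg₂⟩ := h₂.exists_gram_eq hx hk₂
  refine ⟨μ₁, μ₂, hμ₁, hμ₂, ?_⟩
  have hk₁' : ∀ n, ContinuousLinearMap.adjoint T₁ ((T₂ ^ n) x) = 0 := fun n =>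
    h₁.adjoint_eq_zero (by rw [commute_apply (hL₁.pow_right n), leftInv_eq_zero hk₁, map_zero])
  have hk₂' : ∀ m, ContinuousLinearMap.adjoint T₂ ((T₁ ^ m) x) = 0 := fun m =>
    h₂.adjoint_eq_zero (by rw [commute_apply (hL₂.pow_right m), leftInv_eq_zero hk₂, map_zero])
  set V := Finsupp.linearCombination ℂ (orbit T₁ T₂ x) with hVdef
  have hVs : ∀ k, V (Finsupp.single k 1) = orbit T₁ T₂ x k := fun k => by
    rw [hVdef, Finsupp.linearCombination_single, one_smul]
  have hV : ∀ c, ‖V c‖ₑ ^ 2 = coefNorm μ₁ μ₂ c := fun c => by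
    rw [← enorm_sq_polyLp, ← ofReal_norm, ← ofReal_norm]
    congr 2
    refine norm_eq_of_inner_basis_eq V (polyLp μ₁ μ₂) (fun k l => ?_) c
    rw [hVs, hVs, inner_polyLp_single, ← hg₁, ← hg₂]
    exact inner_orbit hcomm h₁ h₂ hx hk₁' hk₂' hA hB _ _ _ _
  set α := coordFunctional (leftInv T₁) (leftInv T₂) x with hαdef
  have h10 : ∀ n h, α (0, n) (T₁ h) = 0 := fun n h => by
    rw [hαdef, coordFunctional_apply, commute_apply (hL₂.pow_left n)]
    exact inner_apply_eq_zero hk₁ _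
  have h1s : ∀ m n h, α (m + 1, n) (T₁ h) = α (m, n) h := fun m n h => by
    rw [hαdef, coordFunctional_apply, coordFunctional_apply, commute_apply (hL₂.pow_left n),
      pow_succ_apply, h₁.leftInv_apply]
  have h20 : ∀ m h, α (m, 0) (T₂ h) = 0 := fun m h => by
    rw [hαdef, coordFunctional_apply]
    change ⟪x, ((leftInv T₁) ^ m) (T₂ h)⟫_ℂ = 0
    rw [commute_apply (hL₁.pow_left m)]
    exact inner_apply_eq_zero hk₂ _
  have h2s : ∀ m n h, α (m, n + 1) (T₂ h) = α (m, n) h := fun m n h => by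
    rw [hαdef, coordFunctional_apply, coordFunctional_apply, pow_succ_apply, h₂.leftInv_apply]
  have hx0 : ∀ k, α k x = if k = (0, 0) then 1 else 0 := by
    rintro ⟨m, n⟩
    rw [hαdef, coordFunctional_apply]
    rcases n with _ | n
    · rcases m with _ | m
      · simp [hx]
      · simp [leftInv_eq_zero hk₁]
    · simp [leftInv_eq_zero hk₂]
  have horb : ∀ p q k, α k (orbit T₁ T₂ x (p, q)) = if k = (p, q) then 1 else 0 := by
    intro p
    induction p with
    | zero =>
      intro q
      induction q with
      | zero => exact hx0
      | succ q ih =>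
        rintro ⟨m, _ | n⟩
        · rw [← apply_orbit_snd hcomm, h20]
          simp
        · rw [← apply_orbit_snd hcomm, h2s, ih]
          simp
    | succ p ih =>
      rintro q ⟨_ | m, n⟩
      · rw [← apply_orbit_fst, h10]
        simp
      · rw [← apply_orbit_fst, h1s, ih]
        simp
  have hα : ∀ k c, α k (V c) = c k := by
    intro k c
    rw [hVdef, Finsupp.linearCombination_apply, Finsupp.sum, map_sum]
    simp only [map_smul, horb, smul_eq_mul, Prod.mk.eta, mul_ite, mul_one, mul_zero]
    simp [eq_comm]
  exact isUnitarilyEquivalentToShifts_of_coord α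
    (coefNorm_coord hV (denseRange_of_isCyclicVector hcyc) hα) (fun a ha => exists_coord hV hα ha)
    h10 h1s h20 h2s

end Operators

/-! ### From the function space to the operator identities -/

section Operators

variable {H : Type*} [NormedAddCommGroup H] [InnerProductSpace ℂ H]
  {V : (ℕ × ℕ →₀ ℂ) →ₗ[ℂ] H}

theorem eq_of_denseRange {F : Type*} [NormedAddCommGroup F] [NormedSpace ℂ F] (hd : DenseRange V)
    {A B : H →L[ℂ] F} (h : ∀ k, A (V (Finsupp.single k 1)) = B (V (Finsupp.single k 1))) :
    A = B := by
  have h1 : (A : H →ₗ[ℂ] F) ∘ₗ V = (B : H →ₗ[ℂ] F) ∘ₗ V :=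
    Finsupp.lhom_ext fun k c => by
      rw [← mul_one c, ← smul_eq_mul, ← Finsupp.smul_single, map_smul, map_smul]
      exact congrArg (c • ·) (h k)
  ext y
  exact congrFun (hd.equalizer A.continuous B.continuous (funext fun c => LinearMap.congr_fun h1 c)) y

theorem eq_zero_of_denseRange (hd : DenseRange V) {y : H}
    (h : ∀ k, ⟪y, V (Finsupp.single k 1)⟫_ℂ = 0) : y = 0 := by
  have h1 : innerSL ℂ y = 0 := eq_of_denseRange hd fun k => by simpa using h k
  have h2 : ⟪y, y⟫_ℂ = 0 := congrArg (fun A : H →L[ℂ] ℂ => A y) h1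
  exact inner_self_eq_zero.1 h2

theorem hasTaylor_one : HasTaylor (Finsupp.single (0, 0) 1 : ℕ × ℕ →₀ ℂ)
    (extendZero fun _ => 1) := by
  refine hasTaylor_extendZero_iff.2 fun z => ?_
  convert hasSum_single ((0, 0) : ℕ × ℕ) fun k hk => ?_ using 1
  · simp
  · rw [Finsupp.single_eq_of_ne hk, zero_mul]

variable [CompleteSpace H]

/-- The coordinate multiplications satisfy the commutation relations, and the Gram matrix of the
orbit of a unit vector in the joint kernel of the adjoints is a product. -/
theorem conditions_of_isUnitarilyEquivalentToShifts {T₁ T₂ : H →L[ℂ] H} (hcomm : Commute T₁ T₂)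
    (h₁ : IsTwoIsometry T₁) (h₂ : IsTwoIsometry T₂) {x : H} (hx : ‖x‖ = 1)
    (hk₁ : ContinuousLinearMap.adjoint T₁ x = 0) (hk₂ : ContinuousLinearMap.adjoint T₂ x = 0)
    {μ₁ μ₂ : Measure unitCirc} [IsFiniteMeasure μ₁] [IsFiniteMeasure μ₂]
    (hU : IsUnitarilyEquivalentToShifts T₁ T₂ μ₁ μ₂) :
    leftInv T₁ * T₂ = T₂ * leftInv T₁ ∧ leftInv T₂ * T₁ = T₁ * leftInv T₂ ∧
      ∀ m n p q : ℕ, ⟪(T₁ ^ p) ((T₂ ^ q) x), (T₁ ^ m) ((T₂ ^ n) x)⟫_ℂ =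
        ⟪(T₁ ^ p) x, (T₁ ^ m) x⟫_ℂ * ⟪(T₂ ^ q) x, (T₂ ^ n) x⟫_ℂ := by
  obtain ⟨U, hbij, hnorm, hU₁, hU₂⟩ := hU
  obtain ⟨e, -, he⟩ : (fun _ => 1 : bidisc → ℂ) ∈ U '' Set.univ := by
    refine hbij.surjOn ⟨hasTaylor_one.differentiableOn (C := 1) fun k => ?_, ?_⟩
    · rw [Finsupp.single_apply]
      split_ifs <;> simp
    · rw [hasTaylor_one.dirichletNormSq_eq μ₁ μ₂, ← enorm_sq_polyLp]
      exact ENNReal.pow_lt_top enorm_lt_top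
  set V := Finsupp.linearCombination ℂ (orbit T₁ T₂ e) with hVdef
  have hVs : ∀ k, V (Finsupp.single k 1) = orbit T₁ T₂ e k := fun k => by
    rw [hVdef, Finsupp.linearCombination_single, one_smul]
  have hUorb : ∀ m n (z : bidisc), U (orbit T₁ T₂ e (m, n)) z = z.1.1 ^ m * z.1.2 ^ n := by
    intro m n z
    induction m with
    | zero =>
      induction n with
      | zero => simp [orbit, he]
      | succ n ih =>
        rw [← apply_orbit_snd hcomm, hU₂, ih]
        ring
    | succ m ih =>
      rw [← apply_orbit_fst, hU₁, ih]
      ring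
  have hUV : ∀ c : ℕ × ℕ →₀ ℂ, HasTaylor c (extendZero (U (V c))) := by
    intro c
    refine hasTaylor_extendZero_iff.2 fun z => ?_
    have h1 : U (V c) z = ∑ k ∈ c.support, c k * (z.1.1 ^ k.1 * z.1.2 ^ k.2) := by
      rw [hVdef, Finsupp.linearCombination_apply, Finsupp.sum, map_sum, Finset.sum_apply]
      refine Finset.sum_congr rfl fun k _ => ?_
      rw [map_smul, Pi.smul_apply, smul_eq_mul, hUorb]
    rw [h1]
    refine hasSum_sum_of_ne_finset_zero fun k hk => ?_
    rw [Finsupp.notMem_support_iff.1 hk, zero_mul]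
  have hV : ∀ c, ‖V c‖ₑ ^ 2 = coefNorm μ₁ μ₂ c := fun c =>
    (hnorm _).symm.trans ((hUV c).dirichletNormSq_eq μ₁ μ₂)
  have hgram : ∀ k l, ⟪orbit T₁ T₂ e k, orbit T₁ T₂ e l⟫_ℂ =
      gram μ₁ l.1 k.1 * gram μ₂ l.2 k.2 := fun k l => by
    rw [← inner_polyLp_single, ← hVs, ← hVs]
    refine inner_eq_of_norm_eq V (polyLp μ₁ μ₂) (fun c => ?_) _ _
    have h1 := sq_injective_ennreal ((hV c).trans (enorm_sq_polyLp μ₁ μ₂ c).symm)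
    rw [← toReal_enorm, ← toReal_enorm, h1]
  have hd : DenseRange V := by
    intro h
    obtain ⟨a, ha⟩ := exists_hasTaylor (hbij.mapsTo (Set.mem_univ h)).1
    have hfin : coefNorm μ₁ μ₂ a < ∞ := by
      rw [← ha.dirichletNormSq_eq μ₁ μ₂]
      exact (hbij.mapsTo (Set.mem_univ h)).2
    refine mem_closure_of_tendsto (f := fun K => V (fejer K a)) (b := atTop) ?_
      (Eventually.of_forall fun K => ⟨_, rfl⟩)
    rw [tendsto_iff_edist_tendsto_0]
    refine (tendsto_coefSeminorm_fejer_sub μ₁ μ₂ hfin).congr fun K => ?_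
    apply sq_injective_ennreal
    change coefSeminorm _ _ _ ^ 2 = edist _ _ ^ 2
    rw [coefSeminorm_sq, edist_eq_enorm_sub, ← hnorm]
    refine (HasTaylor.dirichletNormSq_eq μ₁ μ₂ (hasTaylor_extendZero_iff.2 fun z => ?_)).symm
    rw [map_sub]
    simp only [Pi.sub_apply, sub_mul]
    exact (hasTaylor_extendZero_iff.1 (hUV (fejer K a)) z).sub (hasTaylor_extendZero_iff.1 ha z)
  have hker₁ : ∀ n, ContinuousLinearMap.adjoint T₁ (orbit T₁ T₂ e (0, n)) = 0 := fun n =>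
    eq_zero_of_denseRange hd fun ⟨k, l⟩ => by
      rw [ContinuousLinearMap.adjoint_inner_left, hVs, apply_orbit_fst, hgram, gram_zero_right]
      simp
  have hker₂ : ∀ m, ContinuousLinearMap.adjoint T₂ (orbit T₁ T₂ e (m, 0)) = 0 := fun m =>
    eq_zero_of_denseRange hd fun ⟨k, l⟩ => by
      rw [ContinuousLinearMap.adjoint_inner_left, hVs, apply_orbit_snd hcomm, hgram,
        gram_zero_right]
      simp
  have horb0 : orbit T₁ T₂ e (0, 0) = e := by simp [orbit]
  have hee : ⟪e, e⟫_ℂ = 1 := by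
    have h := hgram (0, 0) (0, 0)
    rwa [horb0, gram_zero_right, gram_zero_right, if_pos rfl, mul_one] at h
  -- the joint kernel of the adjoints is spanned by the preimage of the constant function `1`.
  obtain ⟨c, hc⟩ : ∃ c : ℂ, x = c • e := by
    refine ⟨⟪e, x⟫_ℂ, sub_eq_zero.1 (eq_zero_of_denseRange hd fun ⟨m, n⟩ => ?_)⟩
    have hy₁ : ContinuousLinearMap.adjoint T₁ (x - ⟪e, x⟫_ℂ • e) = 0 := by
      have h := hker₁ 0
      rw [horb0] at h
      rw [map_sub, map_smul, hk₁, h, smul_zero, sub_zero]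
    have hy₂ : ContinuousLinearMap.adjoint T₂ (x - ⟪e, x⟫_ℂ • e) = 0 := by
      have h := hker₂ 0
      rw [horb0] at h
      rw [map_sub, map_smul, hk₂, h, smul_zero, sub_zero]
    rw [hVs]
    rcases m with _ | m
    · rcases n with _ | n
      · rw [horb0, inner_sub_left, inner_smul_left, hee, inner_conj_symm, mul_one, sub_self]
      · rw [← apply_orbit_snd hcomm]
        exact inner_apply_eq_zero hy₂ _
    · rw [← apply_orbit_fst]
      exact inner_apply_eq_zero hy₁ _
  have hcc : conj c * c = 1 := by
    have h : ⟪x, x⟫_ℂ = 1 := by rw [inner_self_eq_norm_sq_to_K, hx]; simp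
    rwa [hc, inner_smul_left, inner_smul_right, hee, mul_one] at h
  have hxorb : ∀ m n, (T₁ ^ m) ((T₂ ^ n) x) = c • orbit T₁ T₂ e (m, n) := fun m n => by
    rw [hc, map_smul, map_smul]
    rfl
  have hgx : ∀ m n p q, ⟪(T₁ ^ p) ((T₂ ^ q) x), (T₁ ^ m) ((T₂ ^ n) x)⟫_ℂ =
      gram μ₁ m p * gram μ₂ n q := fun m n p q => by
    rw [hxorb, hxorb, inner_smul_left, inner_smul_right, hgram]
    linear_combination (gram μ₁ m p * gram μ₂ n q) * hcc
  refine ⟨eq_of_denseRange hd fun ⟨m, n⟩ => ?_, eq_of_denseRange hd fun ⟨m, n⟩ => ?_,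
    fun m n p q => ?_⟩
  · change leftInv T₁ (T₂ _) = T₂ (leftInv T₁ _)
    rw [hVs]
    rcases m with _ | m
    · rw [apply_orbit_snd hcomm, leftInv_eq_zero (hker₁ _), leftInv_eq_zero (hker₁ _), map_zero]
    · rw [← apply_orbit_fst, h₁.leftInv_apply, ← commute_apply hcomm, h₁.leftInv_apply]
  · change leftInv T₂ (T₁ _) = T₁ (leftInv T₂ _)
    rw [hVs]
    rcases n with _ | n
    · rw [apply_orbit_fst, leftInv_eq_zero (hker₂ _), leftInv_eq_zero (hker₂ _), map_zero]
    · rw [← apply_orbit_snd hcomm, h₂.leftInv_apply, commute_apply hcomm, h₂.leftInv_apply]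
  · have e₁ := hgx m 0 p 0
    have e₂ := hgx 0 n 0 q
    rw [gram_zero_right, if_pos rfl, mul_one] at e₁
    rw [gram_zero_right, if_pos rfl, one_mul] at e₂
    rw [hgx, ← e₁, ← e₂]
    rfl

end Operators

end

end BidiscDirichlet

/-- Mathlib's inner product is linear in the second variable, so `⟨a, b⟩` (linear in the first
variable) is written `⟪b, a⟫_ℂ`. -/
theorem mainTheorem2 {H : Type*} [NormedAddCommGroup H] [InnerProductSpace ℂ H] [CompleteSpace H]
    (T₁ T₂ : H →L[ℂ] H) (hcomm : Commute T₁ T₂)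
    (h₁ : BidiscDirichlet.IsTwoIsometry T₁) (h₂ : BidiscDirichlet.IsTwoIsometry T₂)
    (ha₁ : BidiscDirichlet.IsAnalytic T₁) (ha₂ : BidiscDirichlet.IsAnalytic T₂)
    (x₀ : H) (hx₀ : ‖x₀‖ = 1) (hcyc : BidiscDirichlet.IsCyclicVector T₁ T₂ x₀)
    (hk₁ : ContinuousLinearMap.adjoint T₁ x₀ = 0) (hk₂ : ContinuousLinearMap.adjoint T₂ x₀ = 0) :
    (∃ μ₁ μ₂ : Measure BidiscDirichlet.unitCirc, IsFiniteMeasure μ₁ ∧ IsFiniteMeasure μ₂ ∧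
      BidiscDirichlet.IsUnitarilyEquivalentToShifts T₁ T₂ μ₁ μ₂) ↔
    (BidiscDirichlet.leftInv T₁ * T₂ = T₂ * BidiscDirichlet.leftInv T₁ ∧
      BidiscDirichlet.leftInv T₂ * T₁ = T₁ * BidiscDirichlet.leftInv T₂ ∧
      ∀ m n : ℕ, 1 ≤ m → 1 ≤ n →
        ⟪T₁ (T₂ x₀), (T₁ ^ m) ((T₂ ^ n) x₀)⟫_ℂ =
            ⟪T₁ x₀, (T₁ ^ m) x₀⟫_ℂ * ⟪T₂ x₀, (T₂ ^ n) x₀⟫_ℂ ∧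
        ⟪T₁ ((T₂ ^ n) x₀), (T₁ ^ m) (T₂ x₀)⟫_ℂ =
            ⟪T₁ x₀, (T₁ ^ m) x₀⟫_ℂ * ⟪(T₂ ^ n) x₀, T₂ x₀⟫_ℂ) := by
  constructor
  · rintro ⟨μ₁, μ₂, hμ₁, hμ₂, hU⟩
    obtain ⟨hL₁, hL₂, hg⟩ := BidiscDirichlet.conditions_of_isUnitarilyEquivalentToShifts hcomm h₁ h₂
      hx₀ hk₁ hk₂ hU
    exact ⟨hL₁, hL₂, fun m n _ _ =>
      ⟨by simpa only [pow_one] using hg m n 1 1, by simpa only [pow_one] using hg m 1 1 n⟩⟩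
  · rintro ⟨hL₁, hL₂, hg⟩
    exact BidiscDirichlet.isUnitarilyEquivalentToShifts_of_conditions hcomm h₁ h₂ hx₀ hcyc hk₁ hk₂
      hL₁ hL₂ (fun m n => (hg (m + 1) (n + 1) m.succ_pos n.succ_pos).1)
      (fun m n => (hg (m + 1) (n + 1) m.succ_pos n.succ_pos).2)
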